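/- Let $k$ be a positive integer and let $G$ be a finite simple graph with minimum degree at least $k+1$. Then there is an even integer $m$ such that $G$ contains a cycle of length $m+2i$ for every integer $i$ with $0\le i<\lfloor k/2\rfloor$; that is, $G$ contains $\lfloor k/2\rfloor$ cycles with consecutive even lengths. If in addition $G$ is 2-connected (it has at least three vertices, is connected, and remains connected after the deletion of any one vertex) and non-bipartite, then there is also an odd integer $m'$ such that $G$ contains a cycle of length $m'+2i$ for every integer $i$ with $0\le i<\lfloor k/2\rfloor$; that is, $G$ contains $\lfloor k/2\rfloor$ cycles with consecutive odd lengths. Here the length of a cycle is its number of edges. -/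

import Mathlib

namespace SimpleGraph

/-- `G` is 2-connected: it has at least three vertices, is connected, and has no cut-vertex
(deleting any single vertex leaves a connected graph). -/
structure IsTwoConnected {V : Type*} (G : SimpleGraph V) : Prop where
  three_le_card : 3 ≤ Nat.card V
  connected : G.Connected
  connected_delete : ∀ v : V, (G.induce ({v}ᶜ : Set V)).Connected

/-- `G` contains a cycle of length `n` (number of edges). -/
def HasCycleOfLength {V : Type*} (G : SimpleGraph V) (n : ℕ) : Prop :=
  ∃ (v : V) (c : G.Walk v v), c.IsCycle ∧ c.length = n

/-- `G` contains `t` cycles with consecutive even lengths, i.e. cycles of lengths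
`m, m + 2, …, m + 2 (t - 1)` for some even `m`. -/
def HasConsecutiveEvenCycles {V : Type*} (G : SimpleGraph V) (t : ℕ) : Prop :=
  ∃ m : ℕ, Even m ∧ ∀ i < t, G.HasCycleOfLength (m + 2 * i)

/-- `G` contains `t` cycles with consecutive odd lengths, i.e. cycles of lengths
`m, m + 2, …, m + 2 (t - 1)` for some odd `m`. -/
def HasConsecutiveOddCycles {V : Type*} (G : SimpleGraph V) (t : ℕ) : Prop :=
  ∃ m : ℕ, Odd m ∧ ∀ i < t, G.HasCycleOfLength (m + 2 * i)

end SimpleGraph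

/-! The cycles come from a theorem on paths (`solvable`). Take a bipartite graph with two roots x, y
that is 2-connected once xy is an edge, and let every other vertex have degree at least k + 1. Then
there are k paths from x to y whose lengths increase by two. The roots are virtual: D is the set of
other vertices, and X, Y are the neighbourhoods of x, y. Passing to a part of the graph, or
contracting a set T into a root, only changes D, X and Y (to `G.nbs T`, say), so the induction on
|D| never leaves the graph.

Families with a and b lengths glue to one with a + b - 1 lengths, so k is split between parts of the
graph. The case k = 2 (`twoSolvable`) is separate because it must tolerate one vertex of small
degree. For k ≥ 3, cuts with at most two vertices reduce to a smaller instance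
(`Solvable.irreducible`). Then take a maximum complete bipartite subgraph with sides A ∪ {x} and B ⊆
X (`IsCore`). It offers |A| + 1 lengths from x to a vertex of B, and by maximality contracting B
into x costs the remaining vertices at most |A| in degree, so the two effects balance. If the
contraction spoils connectivity, some part hangs on A and at most one further vertex, and
`Solvable.bridge`, `Solvable.of_cut_vertex` or `Solvable.of_three_cut` applies. Doing this for both
roots leaves only the case that x and y have the same neighbourhood B, settled by
`Solvable.of_common_neighbors`.

For cycles, let H consist of the bichromatic edges of a maximum cut. Degrees at least halve, to
⌊k/2⌋ + 1. A smallest set D whose outgoing H-edges all end in one vertex r behaves like an end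
block: for each p in D the path theorem gives ⌊k/2⌋ paths of H from p to r. Closing them by an
H-edge pr gives even cycles. If G is 2-connected and not bipartite, there is a monochromatic edge of
G with one end in D that closes such paths, prolonged outside D, to odd cycles. -/

namespace SimpleGraph

/-! ### Paths with prescribed vertex sets, and the arithmetic of their lengths -/

section PathsInSets

open Classical

variable {V : Type*} {G : SimpleGraph V}

/-- `G.PathIn S u v n`: there is a path of length `n` from `u` to `v` with all vertices in `S`. -/
inductive PathIn (G : SimpleGraph V) : Finset V → V → V → ℕ → Prop
  | single {S : Finset V} {u : V} : u ∈ S → PathIn G S u u 0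
  | cons {S : Finset V} {u w v : V} {n : ℕ} : u ∈ S → G.Adj u w → PathIn G (S.erase u) w v n →
      PathIn G S u v (n + 1)

/-- `G.ConnIn S u v`: the vertices `u` and `v` are joined by a walk inside `S`. -/
inductive ConnIn (G : SimpleGraph V) (S : Finset V) : V → V → Prop
  | refl {u : V} : u ∈ S → ConnIn G S u u
  | head {u w v : V} : u ∈ S → G.Adj u w → ConnIn G S w v → ConnIn G S u v

theorem PathIn.mono {S T : Finset V} {u v : V} {n : ℕ} (h : G.PathIn S u v n) (hST : S ⊆ T) :
    G.PathIn T u v n := by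
  induction h generalizing T with
  | single hu => exact .single (hST hu)
  | cons hu ha _ ih => exact .cons (hST hu) ha (ih (Finset.erase_subset_erase _ hST))

theorem PathIn.left_mem {S : Finset V} {u v : V} {n : ℕ} (h : G.PathIn S u v n) : u ∈ S := by
  cases h <;> assumption

theorem PathIn.right_mem {S : Finset V} {u v : V} {n : ℕ} (h : G.PathIn S u v n) : v ∈ S := by
  induction h with
  | single hu => exact hu
  | cons _ _ _ ih => exact Finset.mem_of_mem_erase ih

theorem PathIn.append {S T : Finset V} {u v w z : V} {n m : ℕ} (h : G.PathIn S u v n)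
    (hvw : G.Adj v w) (h' : G.PathIn T w z m) (hd : Disjoint S T) :
    G.PathIn (S ∪ T) u z (n + m + 1) := by
  induction h with
  | @single S u hu =>
    rw [Nat.zero_add]
    refine .cons (Finset.mem_union_left _ hu) hvw (h'.mono fun x hx => ?_)
    refine Finset.mem_erase.2 ⟨?_, Finset.mem_union_right _ hx⟩
    rintro rfl
    exact Finset.disjoint_left.1 hd hu hx
  | @cons S u a b n hu ha _ ih =>
    have := ih hvw (Finset.disjoint_of_subset_left (Finset.erase_subset _ _) hd)
    rw [show n + 1 + m + 1 = (n + m + 1) + 1 by ring]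
    refine .cons (Finset.mem_union_left _ hu) ha (this.mono fun x hx => ?_)
    rcases Finset.mem_union.1 hx with hxS | hxT
    · exact Finset.mem_erase.2 ⟨Finset.ne_of_mem_erase hxS,
        Finset.mem_union_left _ (Finset.mem_of_mem_erase hxS)⟩
    · refine Finset.mem_erase.2 ⟨?_, Finset.mem_union_right _ hxT⟩
      rintro rfl
      exact Finset.disjoint_left.1 hd hu hxT

theorem PathIn.symm {S : Finset V} {u v : V} {n : ℕ} (h : G.PathIn S u v n) :
    G.PathIn S v u n := by
  induction h with
  | single hu => exact .single hu
  | @cons S u w v n hu ha _ ih =>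
    have := ih.append ha.symm (.single (Finset.mem_singleton_self u))
      (Finset.disjoint_singleton_right.2 (Finset.notMem_erase u S))
    refine this.mono ?_
    intro x hx
    rcases Finset.mem_union.1 hx with hx | hx
    · exact Finset.mem_of_mem_erase hx
    · rwa [Finset.mem_singleton.1 hx]

/-- In the second alternative the path visits u, and the witness is its tail from u. -/
theorem PathIn.avoid_or {S : Finset V} {w v : V} {n : ℕ} (h : G.PathIn S w v n) (u : V) :
    G.PathIn (S.erase u) w v n ∨ ∃ m, G.PathIn S u v m := by
  induction h with
  | @single S w hw =>
    by_cases hwu : w = u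
    · subst hwu
      exact .inr ⟨0, .single hw⟩
    · exact .inl (.single (Finset.mem_erase.2 ⟨hwu, hw⟩))
  | @cons S w a v n hw ha hp ih =>
    by_cases hwu : w = u
    · subst hwu
      exact .inr ⟨_, .cons hw ha hp⟩
    · rcases ih with ih | ⟨m, ih⟩
      · left
        refine .cons (Finset.mem_erase.2 ⟨hwu, hw⟩) ha ?_
        rwa [Finset.erase_right_comm]
      · exact .inr ⟨m, ih.mono (Finset.erase_subset _ _)⟩

theorem PathIn.exists_isPath {S : Finset V} {u v : V} {n : ℕ} (h : G.PathIn S u v n) :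
    ∃ p : G.Walk u v, p.IsPath ∧ (∀ x ∈ p.support, x ∈ S) ∧ p.length = n := by
  induction h with
  | single hu => exact ⟨.nil, by simp, by simpa using hu, rfl⟩
  | @cons S u w v n hu ha _ ih =>
    obtain ⟨p, hp, hs, hl⟩ := ih
    refine ⟨.cons ha p, ?_, ?_, by simp [hl]⟩
    · rw [Walk.cons_isPath_iff]
      exact ⟨hp, fun hx => Finset.notMem_erase u S (hs _ hx)⟩
    · intro x hx
      rw [Walk.support_cons, List.mem_cons] at hx
      rcases hx with rfl | hx
      · exact hu
      · exact Finset.mem_of_mem_erase (hs _ hx)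

theorem ConnIn.mono {S T : Finset V} {u v : V} (h : G.ConnIn S u v) (hST : S ⊆ T) :
    G.ConnIn T u v := by
  induction h with
  | refl hu => exact .refl (hST hu)
  | head hu ha _ ih => exact .head (hST hu) ha ih

theorem ConnIn.left_mem {S : Finset V} {u v : V} (h : G.ConnIn S u v) : u ∈ S := by
  cases h <;> assumption

theorem ConnIn.right_mem {S : Finset V} {u v : V} (h : G.ConnIn S u v) : v ∈ S := by
  induction h with
  | refl hu => exact hu
  | head _ _ _ ih => exact ih

theorem ConnIn.trans {S : Finset V} {u v w : V} (h : G.ConnIn S u v) (h' : G.ConnIn S v w) :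
    G.ConnIn S u w := by
  induction h with
  | refl _ => exact h'
  | head hu ha _ ih => exact .head hu ha (ih h')

theorem ConnIn.tail {S : Finset V} {u v w : V} (h : G.ConnIn S u v) (ha : G.Adj v w)
    (hw : w ∈ S) : G.ConnIn S u w :=
  h.trans (.head h.right_mem ha (.refl hw))

theorem ConnIn.symm {S : Finset V} {u v : V} (h : G.ConnIn S u v) : G.ConnIn S v u := by
  induction h with
  | refl hu => exact .refl hu
  | head hu ha _ ih => exact ih.tail ha.symm hu

theorem ConnIn.exists_pathIn {S : Finset V} {u v : V} (h : G.ConnIn S u v) :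
    ∃ n, G.PathIn S u v n := by
  induction h with
  | refl hu => exact ⟨0, .single hu⟩
  | @head u w v hu ha _ ih =>
    obtain ⟨n, hn⟩ := ih
    rcases hn.avoid_or u with h | h
    · exact ⟨n + 1, .cons hu ha h⟩
    · exact h

/-- A walk inside `S` starting in `K` either stays in `K` or leaves it. -/
theorem ConnIn.escape {S : Finset V} {v t : V} (h : G.ConnIn S v t) (K : Finset V)
    (hv : v ∈ K) : G.ConnIn (S ∩ K) v t ∨
      ∃ u w, G.ConnIn (S ∩ K) v u ∧ w ∈ S ∧ w ∉ K ∧ G.Adj u w := by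
  induction h with
  | refl hu => exact .inl (.refl (Finset.mem_inter.2 ⟨hu, hv⟩))
  | @head u w t hu ha hc ih =>
    have hu' : u ∈ S ∩ K := Finset.mem_inter.2 ⟨hu, hv⟩
    by_cases hw : w ∈ K
    · rcases ih hw with h | ⟨a, b, h, hb⟩
      · exact .inl (.head hu' ha h)
      · exact .inr ⟨a, b, .head hu' ha h, hb⟩
    · exact .inr ⟨u, w, .refl hu', hc.left_mem, hw, ha⟩

/-- A walk inside `S` from `K` to the complement of `K` leaves `K` for a last time. -/
theorem ConnIn.last_exit {S : Finset V} {v t : V} (h : G.ConnIn S v t) (K : Finset V)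
    (hv : v ∈ K) (ht : t ∉ K) :
    ∃ u w, u ∈ S ∧ u ∈ K ∧ G.Adj u w ∧ G.ConnIn (S \ K) w t := by
  have hsub : S ∩ (S \ K) ⊆ S \ K := Finset.inter_subset_right
  rcases h.symm.escape (S \ K) (Finset.mem_sdiff.2 ⟨h.right_mem, ht⟩) with h' | ⟨u, w, h', hw, hwK, ha⟩
  · have := Finset.mem_sdiff.1 (hsub h'.right_mem)
    exact absurd hv this.2
  · refine ⟨w, u, hw, ?_, ha.symm, (h'.mono hsub).symm⟩
    by_contra hk
    exact hwK (Finset.mem_sdiff.2 ⟨hw, hk⟩)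

/-- The vertices joined to `v` inside `S`. -/
noncomputable def compIn (G : SimpleGraph V) (S : Finset V) (v : V) : Finset V :=
  S.filter fun u => G.ConnIn S v u

theorem mem_compIn {S : Finset V} {u v : V} : u ∈ G.compIn S v ↔ G.ConnIn S v u := by
  rw [compIn, Finset.mem_filter]
  exact ⟨fun h => h.2, fun h => ⟨h.right_mem, h⟩⟩

theorem compIn_subset {S : Finset V} {v : V} : G.compIn S v ⊆ S := Finset.filter_subset _ _

theorem self_mem_compIn {S : Finset V} {v : V} (hv : v ∈ S) : v ∈ G.compIn S v :=
  mem_compIn.2 (.refl hv)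

theorem compIn_closed {S : Finset V} {u v w : V} (hu : u ∈ G.compIn S v) (ha : G.Adj u w)
    (hw : w ∈ S) : w ∈ G.compIn S v :=
  mem_compIn.2 ((mem_compIn.1 hu).tail ha hw)

theorem ConnIn.in_compIn {S : Finset V} {u v w : V} (h : G.ConnIn S u w)
    (hu : u ∈ G.compIn S v) : G.ConnIn (G.compIn S v) u w := by
  induction h with
  | refl _ => exact .refl hu
  | head _ ha hc ih => exact .head hu ha (ih (compIn_closed hu ha hc.left_mem))

theorem connIn_compIn {S : Finset V} {u v w : V} (hu : u ∈ G.compIn S v)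
    (hw : w ∈ G.compIn S v) : G.ConnIn (G.compIn S v) u w :=
  ((mem_compIn.1 hu).symm.trans (mem_compIn.1 hw)).in_compIn hu

/-- The vertices with a neighbour in `T`. -/
def nbs (G : SimpleGraph V) (T : Finset V) : Set V := {v | ∃ t ∈ T, G.Adj v t}

theorem mem_nbs {T : Finset V} {v : V} : v ∈ G.nbs T ↔ ∃ t ∈ T, G.Adj v t := Iff.rfl

theorem mem_nbs_singleton {t v : V} : v ∈ G.nbs {t} ↔ G.Adj v t := by simp [mem_nbs]

/-- `D` contains paths from `X` to `Y` whose lengths are `k` terms of an arithmetic progression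
with difference two. -/
def HasPathLengths (G : SimpleGraph V) (D : Finset V) (X Y : Set V) (k : ℕ) : Prop :=
  ∃ l, ∀ i < k, ∃ u ∈ X, ∃ v ∈ Y, G.PathIn D u v (l + 2 * i)

theorem HasPathLengths.mono {D D' : Finset V} {X X' Y Y' : Set V} {k k' : ℕ}
    (h : G.HasPathLengths D X Y k) (hD : D ⊆ D') (hX : ∀ v ∈ D, v ∈ X → v ∈ X')
    (hY : ∀ v ∈ D, v ∈ Y → v ∈ Y') (hk : k' ≤ k) : G.HasPathLengths D' X' Y' k' := by
  obtain ⟨l, hl⟩ := h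
  refine ⟨l, fun i hi => ?_⟩
  obtain ⟨u, hu, v, hv, hp⟩ := hl i (hi.trans_le hk)
  exact ⟨u, hX _ hp.left_mem hu, v, hY _ hp.right_mem hv, hp.mono hD⟩

theorem HasPathLengths.weaken {D D' : Finset V} {X Y : Set V} {k k' : ℕ}
    (h : G.HasPathLengths D X Y k) (hD : D ⊆ D') (hk : k' ≤ k) : G.HasPathLengths D' X Y k' :=
  h.mono hD (fun _ _ h => h) (fun _ _ h => h) hk

theorem HasPathLengths.symm {D : Finset V} {X Y : Set V} {k : ℕ}
    (h : G.HasPathLengths D X Y k) : G.HasPathLengths D Y X k := by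
  obtain ⟨l, hl⟩ := h
  refine ⟨l, fun i hi => ?_⟩
  obtain ⟨u, hu, v, hv, hp⟩ := hl i hi
  exact ⟨v, hv, u, hu, hp.symm⟩

/-- For one length connectivity is enough, so the path theorem needs no degree condition when k ≤ 1.
-/
theorem HasPathLengths.of_connIn {D : Finset V} {X Y : Set V} {u v : V} (hu : u ∈ X) (hv : v ∈ Y)
    (h : G.ConnIn D u v) {k : ℕ} (hk : k ≤ 1) : G.HasPathLengths D X Y k := by
  obtain ⟨n, hn⟩ := h.exists_pathIn
  refine ⟨n, fun i hi => ⟨u, hu, v, hv, ?_⟩⟩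
  obtain rfl : i = 0 := by omega
  exact hn

/-- The sums of {0, …, a - 1} and {0, …, b - 1} fill {0, …, a + b - 2}; this is the count in every
gluing argument. -/
theorem exists_add_of_lt_add {i a b : ℕ} (ha : 0 < a) (hb : 0 < b) (h : i < a + b - 1) :
    ∃ j l, j < a ∧ l < b ∧ j + l = i :=
  ⟨min i (a - 1), i - min i (a - 1), by omega, by omega, by omega⟩

/-- Prefixing paths whose lengths do not depend on their last vertex. -/
theorem HasPathLengths.prefix {S D : Finset V} {X Y : Set V} {T : Finset V} {r k α : ℕ}
    (hpre : ∀ t ∈ T, ∀ j < r, ∃ u ∈ X, G.PathIn S u t (α + 2 * j))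
    (h : G.HasPathLengths D (G.nbs T) Y k) (hd : Disjoint S D) (hr : 0 < r) (hk : 0 < k) :
    G.HasPathLengths (S ∪ D) X Y (r + k - 1) := by
  obtain ⟨l, hl⟩ := h
  refine ⟨α + l + 1, fun i hi => ?_⟩
  obtain ⟨a, b, ha, hb, rfl⟩ := exists_add_of_lt_add hr hk hi
  obtain ⟨w, ⟨t, ht, hwt⟩, y, hy, hp⟩ := hl b hb
  obtain ⟨u, hu, hq⟩ := hpre t ht a ha
  refine ⟨u, hu, y, hy, ?_⟩
  have := hq.append hwt.symm hp hd
  rwa [show α + 2 * a + (l + 2 * b) + 1 = α + l + 1 + 2 * (a + b) by ring] at this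

/-- A fixed tail is a family with a single length, so no length is lost; this is `prefix` with r =
1, read backwards. -/
theorem HasPathLengths.suffix {S D : Finset V} {X Y : Set V} {c y : V} {k : ℕ}
    (h : G.HasPathLengths D X (G.nbs {c}) k) (hc : G.ConnIn S c y) (hy : y ∈ Y)
    (hd : Disjoint S D) : G.HasPathLengths (S ∪ D) X Y k := by
  rcases Nat.eq_zero_or_pos k with rfl | hk
  · exact ⟨0, by simp⟩
  obtain ⟨m, hm⟩ := hc.exists_pathIn
  have := h.symm.prefix (S := S) (X := Y) (r := 1) (α := m) (fun t ht j hj => by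
    obtain rfl : j = 0 := by omega
    obtain rfl := Finset.mem_singleton.1 ht
    exact ⟨y, hy, hm.symm⟩) hd one_pos hk
  simpa [Nat.add_comm 1 k] using this.symm

/-- Concatenating two families of paths at a vertex `c`. -/
theorem HasPathLengths.glue {S T : Finset V} {X Y : Set V} {c : V} {a b : ℕ}
    (h : G.HasPathLengths S X (G.nbs {c}) a) (h' : G.HasPathLengths T (G.nbs {c}) Y b)
    (hd : Disjoint S T) (hcS : c ∉ S) (hcT : c ∉ T) (ha : 0 < a) (hb : 0 < b) :
    G.HasPathLengths (insert c (S ∪ T)) X Y (a + b - 1) := by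
  obtain ⟨l, hl⟩ := h
  obtain ⟨m, hm⟩ := h'
  refine ⟨l + m + 2, fun i hi => ?_⟩
  obtain ⟨p, q, hp, hq, rfl⟩ := exists_add_of_lt_add ha hb hi
  obtain ⟨u, hu, v, hv, h1⟩ := hl p hp
  obtain ⟨u', hu', v', hv', h2⟩ := hm q hq
  rw [mem_nbs_singleton] at hv hu'
  refine ⟨u, hu, v', hv', ?_⟩
  have h3 := h1.append hv (.single (Finset.mem_singleton_self c))
    (Finset.disjoint_singleton_right.2 hcS)
  have h4 := h3.append hu'.symm h2 (by
    rw [Finset.disjoint_union_left]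
    exact ⟨hd, Finset.disjoint_singleton_left.2 hcT⟩)
  rw [show l + 2 * p + 0 + 1 + (m + 2 * q) + 1 = l + m + 2 + 2 * (p + q) by ring] at h4
  refine h4.mono ?_
  intro x
  simp only [Finset.mem_union, Finset.mem_insert, Finset.mem_singleton]
  tauto

/-- Path lengths between vertices on the same side of a complete bipartite graph. -/
theorem exists_pathIn_of_complete {A B : Finset V} (hAB : ∀ a ∈ A, ∀ b ∈ B, G.Adj a b)
    (hd : Disjoint A B) (j : ℕ) (hA : j ≤ A.card) (hB : j + 1 ≤ B.card) {b : V} (hb : b ∈ B) :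
    ∃ b' ∈ B, G.PathIn (A ∪ B) b' b (2 * j) := by
  induction j generalizing A B b with
  | zero => exact ⟨b, hb, .single (Finset.mem_union_right _ hb)⟩
  | succ j ih =>
    -- A path ending in b₁, taken in the graph without a and b, is prolonged by a and then b.
    obtain ⟨a, ha⟩ : A.Nonempty := Finset.card_pos.1 (by omega)
    obtain ⟨b₁, hb₁⟩ : (B.erase b).Nonempty :=
      Finset.card_pos.1 (by rw [Finset.card_erase_of_mem hb]; omega)
    obtain ⟨b', hb', hp⟩ := ih (A := A.erase a) (B := B.erase b)
      (fun x hx y hy => hAB x (Finset.mem_of_mem_erase hx) y (Finset.mem_of_mem_erase hy))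
      (Finset.disjoint_of_subset_left (Finset.erase_subset _ _)
        (Finset.disjoint_of_subset_right (Finset.erase_subset _ _) hd))
      (by rw [Finset.card_erase_of_mem ha]; omega) (by rw [Finset.card_erase_of_mem hb]; omega) hb₁
    refine ⟨b', Finset.mem_of_mem_erase hb', ?_⟩
    have hab : a ≠ b := (hAB a ha b hb).ne
    have h1 : G.PathIn {a, b} a b 1 := .cons (by simp) (hAB a ha b hb) (.single (by
      simp [hab.symm]))
    have h2 := hp.append (hAB a ha b₁ (Finset.mem_of_mem_erase hb₁)).symm h1 (by
      rw [Finset.disjoint_left]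
      intro x hx hx'
      simp only [Finset.mem_union, Finset.mem_erase, Finset.mem_insert,
        Finset.mem_singleton] at hx hx'
      rcases hx' with rfl | rfl
      · rcases hx with hx | hx
        · exact hx.1 rfl
        · exact Finset.disjoint_left.1 hd ha hx.2
      · rcases hx with hx | hx
        · exact Finset.disjoint_left.1 hd hx.2 hb
        · exact hx.1 rfl)
    rw [show 2 * j + 1 + 1 = 2 * (j + 1) by ring] at h2
    refine h2.mono ?_
    intro x hx
    simp only [Finset.mem_union, Finset.mem_erase, Finset.mem_insert,
      Finset.mem_singleton] at hx ⊢
    rcases hx with (hx | hx) | rfl | rfl <;> tauto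

/-- Path lengths between vertices on different sides of a complete bipartite graph. -/
theorem exists_pathIn_of_complete' {A B : Finset V} (hAB : ∀ a ∈ A, ∀ b ∈ B, G.Adj a b)
    (hd : Disjoint A B) (j : ℕ) (hA : j + 1 ≤ A.card) (hB : j + 1 ≤ B.card) {a : V}
    (ha : a ∈ A) : ∃ b' ∈ B, G.PathIn (A ∪ B) b' a (1 + 2 * j) := by
  obtain ⟨b, hb⟩ : B.Nonempty := Finset.card_pos.1 (by omega)
  obtain ⟨b', hb', hp⟩ := exists_pathIn_of_complete (A := A.erase a)
    (fun x hx y hy => hAB x (Finset.mem_of_mem_erase hx) y hy)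
    (Finset.disjoint_of_subset_left (Finset.erase_subset _ _) hd) j
    (by rw [Finset.card_erase_of_mem ha]; omega) hB hb
  refine ⟨b', hb', ?_⟩
  have h2 := hp.append (hAB a ha b hb).symm (.single (Finset.mem_singleton_self a)) (by
    rw [Finset.disjoint_singleton_right, Finset.mem_union, not_or]
    exact ⟨Finset.notMem_erase _ _, Finset.disjoint_left.1 hd ha⟩)
  rw [show 2 * j + 0 + 1 = 1 + 2 * j by ring] at h2
  refine h2.mono ?_
  intro x hx
  simp only [Finset.mem_union, Finset.mem_erase, Finset.mem_singleton] at hx ⊢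
  rcases hx with (hx | hx) | rfl <;> tauto

end PathsInSets

end SimpleGraph

namespace SimpleGraph

/-! ### Rooted configurations, fans and degrees -/

section Linked

open Classical

variable {V : Type*} {G : SimpleGraph V}

/-- Adding to `G[D]` a vertex with neighbourhood `X` and a vertex with neighbourhood `Y`, joined by
an edge, gives a 2-connected graph. -/
structure Linked (G : SimpleGraph V) (D : Finset V) (X Y : Set V) : Prop where
  cut : ∀ v ∈ D, ∀ c ∈ D, c ≠ v → ∃ t, (t ∈ X ∨ t ∈ Y) ∧ G.ConnIn (D.erase c) v t
  left : ∀ v ∈ D, ∃ t ∈ X, G.ConnIn D v t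
  right : ∀ v ∈ D, ∃ t ∈ Y, G.ConnIn D v t

theorem Linked.symm {D : Finset V} {X Y : Set V} (h : G.Linked D X Y) : G.Linked D Y X where
  cut v hv c hc hcv := by
    obtain ⟨t, ht, h'⟩ := h.cut v hv c hc hcv
    exact ⟨t, ht.symm, h'⟩
  left := h.right
  right := h.left

/-- Take a path from v to t; past v it stays in the component of t in S - v. Adding v to that
component gives a set in which v is not needed to link the other vertices with t. -/
theorem ConnIn.trim {S : Finset V} {v t : V} (h : G.ConnIn S v t) :
    ∃ S' ⊆ S, G.ConnIn S' v t ∧ ∀ r ∈ S', r ≠ v → G.ConnIn (S'.erase v) r t := by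
  obtain ⟨n, hn⟩ := h.exists_pathIn
  cases hn with
  | single hv =>
    refine ⟨{v}, by simpa using hv, .refl (by simp), ?_⟩
    intro r hr hrv
    exact absurd (Finset.mem_singleton.1 hr) hrv
  | @cons _ _ w _ n hv ha hp =>
    have hc : ∀ {S : Finset V} {u v : V} {n : ℕ}, G.PathIn S u v n → G.ConnIn S u v := by
      intro S u v n h
      induction h with
      | single hu => exact .refl hu
      | cons hu ha _ ih => exact .head hu ha (ih.mono (Finset.erase_subset _ _))
    have hwt := hc hp
    have hvc : v ∉ G.compIn (S.erase v) t := fun h => Finset.notMem_erase v S (compIn_subset h)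
    refine ⟨insert v (G.compIn (S.erase v) t), ?_, ?_, ?_⟩
    · exact Finset.insert_subset hv (compIn_subset.trans (Finset.erase_subset _ _))
    · exact .head (Finset.mem_insert_self _ _) ha
        ((hwt.in_compIn (mem_compIn.2 hwt.symm)).mono (Finset.subset_insert _ _))
    · intro r hr hrv
      rw [Finset.erase_insert hvc]
      have hr' := Finset.mem_of_mem_insert_of_ne hr hrv
      exact connIn_compIn hr' (self_mem_compIn hwt.right_mem)

/-- Two walks from `v`, one to `X` and one to `Y`, that share only `v`. -/
def HasFan (G : SimpleGraph V) (D : Finset V) (X Y : Set V) (v : V) : Prop :=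
  ∃ S₁ ⊆ D, ∃ S₂ ⊆ D, (∀ z ∈ S₁, z ∈ S₂ → z = v) ∧ (∃ x ∈ X, G.ConnIn S₁ v x) ∧
    ∃ y ∈ Y, G.ConnIn S₂ v y

theorem HasFan.symm {D : Finset V} {X Y : Set V} {v : V} (h : G.HasFan D X Y v) :
    G.HasFan D Y X v := by
  obtain ⟨S, hS, T, hT, hST, hx, hy⟩ := h
  exact ⟨T, hT, S, hS, fun z h1 h2 => hST z h2 h1, hy, hx⟩

theorem HasFan.of_step {D S T : Finset V} {X Y : Set V} {u w x y : V} (ha : G.Adj u w)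
    (hT : T ⊆ D) (hS : S ⊆ D) (hTS : ∀ z ∈ T, z ∉ S ∨ z = w) (hx : x ∈ X)
    (hTx : G.ConnIn T w x) (hy : y ∈ Y) (hSy : G.ConnIn S u y) : G.HasFan D X Y w := by
  refine ⟨T, hT, insert w S, Finset.insert_subset (hT hTx.left_mem) hS, ?_, ⟨x, hx, hTx⟩, y, hy,
    .head (Finset.mem_insert_self _ _) ha.symm (hSy.mono (Finset.subset_insert _ _))⟩
  intro z hz hz'
  rcases hTS z hz with h | h
  · exact (Finset.mem_insert.1 hz').resolve_right h
  · exact h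

/-- A case of Menger's fan theorem, proved by transport along edges. A vertex of X has a trivial
fan, and a fan at u yields one at each neighbour w. If w lies on a walk of the fan, that walk is cut
at w and the other one is reached by stepping back to u. If not, a walk from w to X ∪ Y avoiding u
is followed until it ends or meets the fan. -/
theorem Linked.hasFan {D : Finset V} {X Y : Set V} (h : G.Linked D X Y) {v : V} (hv : v ∈ D) :
    G.HasFan D X Y v := by
  have step : ∀ {u w : V}, G.HasFan D X Y u → G.Adj u w → w ∈ D → G.HasFan D X Y w := by
    rintro u w ⟨S₁, hS₁, S₂, hS₂, hS, ⟨x, hx, hux⟩, y, hy, huy⟩ ha hw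
    obtain ⟨T₁, hTS₁, hux, hT₁⟩ := hux.trim
    obtain ⟨T₂, hTS₂, huy, hT₂⟩ := huy.trim
    have hT : ∀ z ∈ T₁, z ∈ T₂ → z = u := fun z h1 h2 => hS z (hTS₁ h1) (hTS₂ h2)
    have hD₁ := hTS₁.trans hS₁
    have hD₂ := hTS₂.trans hS₂
    have huD := hD₁ hux.left_mem
    have e₁ : ∀ z ∈ T₁.erase u, z ∉ T₂ := fun z hz hz' =>
      (Finset.mem_erase.1 hz).1 (hT z (Finset.mem_erase.1 hz).2 hz')
    have e₂ : ∀ z ∈ T₂.erase u, z ∉ T₁ := fun z hz hz' =>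
      (Finset.mem_erase.1 hz).1 (hT z hz' (Finset.mem_erase.1 hz).2)
    have f₁ : T₁.erase u ⊆ D := (Finset.erase_subset _ _).trans hD₁
    have f₂ : T₂.erase u ⊆ D := (Finset.erase_subset _ _).trans hD₂
    by_cases h₁ : w ∈ T₁
    · exact .of_step ha f₁ hD₂ (fun z hz => .inl (e₁ z hz)) hx (hT₁ w h₁ ha.ne') hy huy
    by_cases h₂ : w ∈ T₂
    · exact .symm (.of_step ha f₂ hD₁ (fun z hz => .inl (e₂ z hz)) hy (hT₂ w h₂ ha.ne') hx hux)
    set K := D \ (T₁ ∪ T₂) with hK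
    have hKD : K ⊆ D := Finset.sdiff_subset
    have k₁ : ∀ z ∈ K, z ∉ T₁ := fun z hz hz' =>
      (Finset.mem_sdiff.1 hz).2 (Finset.mem_union_left _ hz')
    have k₂ : ∀ z ∈ K, z ∉ T₂ := fun z hz hz' =>
      (Finset.mem_sdiff.1 hz).2 (Finset.mem_union_right _ hz')
    have hwK : w ∈ K := by simp [hK, hw, h₁, h₂]
    obtain ⟨t, ht, hwt⟩ := h.cut w hw u huD ha.ne
    rcases hwt.escape K hwK with h' | ⟨p, r, hp, hr, hrK, hpr⟩
    · have h' := h'.mono (Finset.inter_subset_right)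
      rcases ht with ht | ht
      · exact .of_step ha hKD hD₂ (fun z hz => .inl (k₂ z hz)) ht h' hy huy
      · exact .symm (.of_step ha hKD hD₁ (fun z hz => .inl (k₁ z hz)) ht h' hx hux)
    · have hp := hp.mono (Finset.inter_subset_right)
      obtain ⟨hru, hrD⟩ := Finset.mem_erase.1 hr
      have hr' : r ∈ T₁ ∪ T₂ := by
        by_contra hc
        exact hrK (Finset.mem_sdiff.2 ⟨hrD, hc⟩)
      rcases Finset.mem_union.1 hr' with hr' | hr'
      · have hc := hT₁ r hr' hru
        refine .of_step (T := K ∪ T₁.erase u) ha (Finset.union_subset hKD f₁) hD₂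
          (fun z hz => .inl ?_) hx (((hp.mono Finset.subset_union_left).tail hpr
            (Finset.mem_union_right _ hc.left_mem)).trans (hc.mono Finset.subset_union_right))
            hy huy
        rcases Finset.mem_union.1 hz with hz | hz
        exacts [k₂ z hz, e₁ z hz]
      · have hc := hT₂ r hr' hru
        refine .symm (.of_step (T := K ∪ T₂.erase u) ha (Finset.union_subset hKD f₂) hD₁
          (fun z hz => .inl ?_) hy (((hp.mono Finset.subset_union_left).tail hpr
            (Finset.mem_union_right _ hc.left_mem)).trans (hc.mono Finset.subset_union_right))
            hx hux)
        rcases Finset.mem_union.1 hz with hz | hz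
        exacts [k₁ z hz, e₂ z hz]
  obtain ⟨x, hx, hvx⟩ := h.left v hv
  have key : ∀ {a b : V}, G.ConnIn D a b → G.HasFan D X Y a → G.HasFan D X Y b := by
    intro a b hab
    induction hab with
    | refl _ => exact id
    | head _ ha hc ih => exact fun hQ => ih (step hQ ha hc.left_mem)
  obtain ⟨y, hy, hxy⟩ := h.right x hvx.right_mem
  exact key hvx.symm ⟨{x}, by simpa using hvx.right_mem, D, subset_rfl,
    fun z hz _ => Finset.mem_singleton.1 hz, ⟨x, hx, .refl (by simp)⟩, y, hy, hxy⟩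

/-- The number of neighbours of `v` in `D`. -/
noncomputable def degIn (G : SimpleGraph V) (D : Finset V) (v : V) : ℕ := (D.filter (G.Adj v)).card

/-- The indicator function of `X`. -/
noncomputable def ind (X : Set V) (v : V) : ℕ := if v ∈ X then 1 else 0

theorem ind_of_mem {X : Set V} {v : V} (h : v ∈ X) : ind X v = 1 := if_pos h

theorem ind_of_notMem {X : Set V} {v : V} (h : v ∉ X) : ind X v = 0 := if_neg h

theorem ind_le_one (X : Set V) (v : V) : ind X v ≤ 1 := by
  unfold ind
  split <;> simp

theorem degIn_mono {D D' : Finset V} {v : V} (h : ∀ w ∈ D, G.Adj v w → w ∈ D') :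
    G.degIn D v ≤ G.degIn D' v := by
  refine Finset.card_le_card fun w hw => ?_
  rw [Finset.mem_filter] at hw ⊢
  exact ⟨h w hw.1 hw.2, hw.2⟩

theorem degIn_union_le (D D' : Finset V) (v : V) :
    G.degIn (D ∪ D') v ≤ G.degIn D v + G.degIn D' v := by
  rw [degIn, Finset.filter_union]
  exact Finset.card_union_le _ _

theorem degIn_le_add {D S T : Finset V} {v : V} (h : ∀ w ∈ D, G.Adj v w → w ∈ S ∨ w ∈ T) :
    G.degIn D v ≤ G.degIn S v + G.degIn T v :=
  (degIn_mono (D' := S ∪ T) fun w hw ha => Finset.mem_union.2 (h w hw ha)).trans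
    (degIn_union_le S T v)

theorem degIn_eq_zero {D : Finset V} {v : V} (h : ∀ w ∈ D, ¬ G.Adj v w) : G.degIn D v = 0 := by
  rw [degIn, Finset.card_eq_zero, Finset.filter_eq_empty_iff]
  exact h

theorem degIn_pos {D : Finset V} {v : V} : 0 < G.degIn D v ↔ ∃ w ∈ D, G.Adj v w := by
  rw [degIn, Finset.card_pos]
  simp [Finset.Nonempty]

theorem degIn_le_card (D : Finset V) (v : V) : G.degIn D v ≤ D.card := Finset.card_filter_le _ _

theorem degIn_singleton (c v : V) : G.degIn {c} v = ind (G.nbs {c}) v := by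
  unfold degIn ind
  rw [Finset.filter_singleton]
  simp only [mem_nbs_singleton]
  split <;> simp

/-- All vertices of `X` have the same colour. -/
def Mono (f : V → Bool) (X : Set V) : Prop := ∀ u ∈ X, ∀ v ∈ X, f u = f v

/-- Contracting a monochromatic set into a root keeps the configuration bipartite. -/
theorem mono_nbs {f : V → Bool} (hf : ∀ u v, G.Adj u v → f u ≠ f v) {T : Finset V}
    (hT : ∀ u ∈ T, ∀ v ∈ T, f u = f v) : Mono f (G.nbs T) := by
  rintro u ⟨s, hs, hus⟩ v ⟨t, ht, hvt⟩
  have h1 := hf _ _ hus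
  have h2 := hf _ _ hvt
  have h3 := hT s hs t ht
  revert h1 h2 h3
  cases f u <;> cases f v <;> cases f s <;> cases f t <;> simp

theorem mono_nbs_singleton {f : V → Bool} (hf : ∀ u v, G.Adj u v → f u ≠ f v) (c : V) :
    Mono f (G.nbs {c}) :=
  mono_nbs hf (by simp)

/-- Leaving `K` along a walk that ends in `Z`. -/
theorem ConnIn.escape_of_forall {S K S' : Finset V} {v t : V} {P : V → Prop}
    (h : G.ConnIn S v t) (hv : v ∈ K) (hSK : ∀ z ∈ S, z ∈ K → z ∈ S')
    (ht : t ∈ K → P t)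
    (hout : ∀ u w, u ∈ S → u ∈ K → w ∈ S → w ∉ K → G.Adj u w → P u) :
    ∃ u, P u ∧ G.ConnIn S' v u := by
  have hsub : S ∩ K ⊆ S' := fun z hz =>
    hSK z (Finset.mem_inter.1 hz).1 (Finset.mem_inter.1 hz).2
  rcases h.escape K hv with h' | ⟨u, w, h', hw, hwK, ha⟩
  · exact ⟨t, ht (Finset.mem_inter.1 h'.right_mem).2, h'.mono hsub⟩
  · have := Finset.mem_inter.1 h'.right_mem
    exact ⟨u, hout u w this.1 this.2 hw hwK ha, h'.mono hsub⟩

end Linked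

end SimpleGraph

namespace SimpleGraph

/-! ### The path theorem for k = 2, with one vertex exempt from the degree condition -/

section TwoLengths

open Classical

variable {V : Type*} {G : SimpleGraph V}

theorem eq_of_adj_compIn_erase {D : Finset V} {c u v w : V} (hu : u ∈ G.compIn (D.erase c) v)
    (hw : w ∉ G.compIn (D.erase c) v) (ha : G.Adj u w) (hwD : w ∈ D) : w = c := by
  by_contra hwc
  exact hw (compIn_closed hu ha (Finset.mem_erase.2 ⟨hwc, hwD⟩))

/-- Every walk from the component to Y has to leave through c, so c can take over the role of y. -/
theorem Linked.compIn_erase {D : Finset V} {X Y : Set V} (h : G.Linked D X Y) {v c : V}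
    (hY : ∀ t ∈ G.compIn (D.erase c) v, t ∉ Y) (hc : c ∈ D) :
    G.Linked (G.compIn (D.erase c) v) X (G.nbs {c}) := by
  have hsub : ∀ u ∈ G.compIn (D.erase c) v, u ≠ c ∧ u ∈ D := fun u hu =>
    Finset.mem_erase.1 (compIn_subset hu)
  constructor
  · intro u hu c' hc' hcu
    obtain ⟨t, ht, hut⟩ := h.cut u (hsub u hu).2 c' (hsub c' hc').2 hcu
    refine hut.escape_of_forall (K := G.compIn (D.erase c) v) hu ?_ ?_ ?_
    · intro z hz hzK
      exact Finset.mem_erase.2 ⟨(Finset.mem_erase.1 hz).1, hzK⟩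
    · intro htK
      exact .inl (ht.resolve_right (hY t htK))
    · intro p q _ hp hq hqK hpq
      right
      rw [mem_nbs_singleton, ← eq_of_adj_compIn_erase hp hqK hpq (Finset.mem_of_mem_erase hq)]
      exact hpq
  · intro u hu
    obtain ⟨t, ht, hut⟩ := h.cut u (hsub u hu).2 c hc (hsub u hu).1.symm
    have := hut.in_compIn hu
    exact ⟨t, ht.resolve_right (hY t this.right_mem), this⟩
  · intro u hu
    obtain ⟨t, ht, hut⟩ := h.right u (hsub u hu).2
    refine hut.escape_of_forall (K := G.compIn (D.erase c) v) hu (fun z _ hz => hz) ?_ ?_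
    · intro htK
      exact absurd ht (hY t htK)
    · intro p q _ hp hq hqK hpq
      rw [mem_nbs_singleton, ← eq_of_adj_compIn_erase hp hqK hpq hq]
      exact hpq

theorem degIn_compIn_erase {D : Finset V} {v c u : V} (hu : u ∈ G.compIn (D.erase c) v) :
    G.degIn D u ≤ G.degIn (G.compIn (D.erase c) v) u + ind (G.nbs {c}) u := by
  rw [← degIn_singleton]
  refine degIn_le_add fun w hw ha => ?_
  by_cases hwK : w ∈ G.compIn (D.erase c) v
  · exact .inl hwK
  · exact .inr (Finset.mem_singleton.2 (eq_of_adj_compIn_erase hu hwK ha hw))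

theorem card_compIn_erase_lt {D : Finset V} {c : V} (hc : c ∈ D) (v : V) :
    (G.compIn (D.erase c) v).card < D.card :=
  (Finset.card_le_card compIn_subset).trans_lt (Finset.card_erase_lt_of_mem hc)

/-- All paths of the family can be continued to c and then by one fixed walk from c to Y outside the
component. -/
theorem Linked.hasPathLengths_of_compIn_erase {D : Finset V} {X Y : Set V} (h : G.Linked D X Y)
    {v c : V} (hv : v ∈ D) (hcv : c ≠ v) (hY : ∀ t ∈ G.compIn (D.erase c) v, t ∉ Y) {k : ℕ}
    (hp : G.HasPathLengths (G.compIn (D.erase c) v) X (G.nbs {c}) k) :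
    G.HasPathLengths D X Y k := by
  obtain ⟨t, ht, hvt⟩ := h.right v hv
  obtain ⟨u, w, _, hu, ha, hc⟩ := hvt.last_exit (G.compIn (D.erase c) v)
    (self_mem_compIn (Finset.mem_erase.2 ⟨hcv.symm, hv⟩)) fun h => hY t h ht
  have hw := Finset.mem_sdiff.1 hc.left_mem
  obtain rfl := eq_of_adj_compIn_erase hu hw.2 ha hw.1
  exact (hp.suffix hc ht Finset.sdiff_disjoint).weaken
    (Finset.union_subset Finset.sdiff_subset (compIn_subset.trans (Finset.erase_subset _ _))) le_rfl

/-- The paths from `X` to `Y` of two lengths given by a cycle of length four through the root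
with neighbourhood `X`. -/
theorem hasPathLengths_two_of_square {D : Finset V} {X Y : Set V} {b b' w t : V} (hw : w ∈ D)
    (hbX : b ∈ X) (hb'X : b' ∈ X) (hb'D : b' ∈ D) (hbb : b ≠ b') (hwb : G.Adj w b)
    (hwb' : G.Adj w b') (ht : t ∈ Y) (hbt : G.ConnIn (D.erase w) b t) :
    G.HasPathLengths D X Y 2 := by
  have key : ∀ {p p' : V} {m : ℕ}, p ∈ X → p' ∈ X → p' ∈ D → G.Adj w p → G.Adj w p' →
      G.PathIn ((D.erase w).erase p') p t m → G.HasPathLengths D X Y 2 := by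
    intro p p' m hp hp' hp'D hwp hwp' hm
    refine ⟨m, fun i hi => ?_⟩
    obtain rfl | rfl : i = 0 ∨ i = 1 := by omega
    · exact ⟨p, hp, t, ht, hm.mono ((Finset.erase_subset _ _).trans (Finset.erase_subset _ _))⟩
    · refine ⟨p', hp', t, ht, ?_⟩
      rw [Finset.erase_right_comm] at hm
      exact .cons hp'D hwp'.symm (.cons (Finset.mem_erase.2 ⟨hwp'.ne, hw⟩) hwp hm)
  have hbD := hbt.left_mem
  obtain ⟨n, hn⟩ := hbt.exists_pathIn
  cases hn with
  | single _ => exact key hbX hb'X hb'D hwb hwb' (.single (Finset.mem_erase.2 ⟨hbb, hbD⟩))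
  | cons _ ha hp =>
    -- If the path from b visits b', its tail from b' is used instead and b, b' change roles. Either
    -- way the detour p', w, p in front of the path adds two to the length.
    rcases hp.avoid_or b' with hp | ⟨m, hp⟩
    · rw [Finset.erase_right_comm] at hp
      exact key hbX hb'X hb'D hwb hwb' (.cons (Finset.mem_erase.2 ⟨hbb, hbD⟩) ha hp)
    · exact key hb'X hbX (Finset.mem_of_mem_erase hbD) hwb' hwb hp

variable {f : V → Bool}

/-- The induction hypothesis for paths of two lengths with an exceptional vertex. -/
def TwoSolvable (G : SimpleGraph V) (f : V → Bool) (n : ℕ) : Prop :=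
  ∀ (D : Finset V) (X Y : Set V) (z : V), D.card < n → (∃ v ∈ D, v ≠ z) → Mono f X → Mono f Y →
    G.Linked D X Y → (∀ v ∈ D, v ≠ z → 3 ≤ G.degIn D v + ind X v + ind Y v) →
      G.HasPathLengths D X Y 2

/-- If w has neighbours b ≠ b' in X, then x b and x b' w b differ in length by two, which suffices
if b reaches Y without w. Otherwise w replaces y on the component of b, and the induction hypothesis
applies provided b ≠ z. By symmetry the same holds for b', and b, b' are not both z. -/
theorem TwoSolvable.square_or (hf : ∀ u v, G.Adj u v → f u ≠ f v) {D : Finset V} {X Y : Set V}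
    {z : V} (ih : TwoSolvable G f D.card) (hX : Mono f X) (h : G.Linked D X Y)
    (hdeg : ∀ v ∈ D, v ≠ z → 3 ≤ G.degIn D v + ind X v + ind Y v) :
    G.HasPathLengths D X Y 2 ∨ ∀ w ∈ D, ∀ b ∈ D, ∀ b' ∈ D, b ∈ X → b' ∈ X → G.Adj w b →
      G.Adj w b' → b = b' := by
  by_contra! hcon
  obtain ⟨hno, w, hw, b, hb, b', hb', hbX, hb'X, hwb, hwb', hbb⟩ := hcon
  have key : ∀ {b b' : V}, b ∈ D → b' ∈ D → b ∈ X → b' ∈ X → G.Adj w b → G.Adj w b' → b ≠ b' →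
      b = z := by
    intro b b' hb hb' hbX hb'X hwb hwb' hbb
    by_contra hbz
    by_cases hY : ∀ t ∈ G.compIn (D.erase w) b, t ∉ Y
    · refine hno (h.hasPathLengths_of_compIn_erase hb hwb.ne hY (ih _ _ _ z
        (card_compIn_erase_lt hw b) ⟨b, self_mem_compIn (Finset.mem_erase.2 ⟨hwb.ne', hb⟩), hbz⟩
        hX (mono_nbs_singleton hf w) (h.compIn_erase hY hw) fun u hu huz => ?_))
      have h1 := hdeg u (Finset.mem_of_mem_erase (compIn_subset hu)) huz
      have h2 := degIn_compIn_erase hu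
      have h3 := ind_of_notMem (hY u hu)
      omega
    · push Not at hY
      obtain ⟨t, ht, htY⟩ := hY
      exact hno (hasPathLengths_two_of_square hw hbX hb'X hb' hbb hwb hwb' htY (mem_compIn.1 ht))
  exact hbb ((key hb hb' hbX hb'X hwb hwb' hbb).trans
    (key hb' hb hb'X hbX hwb' hwb hbb.symm).symm)

/-- A vertex with at most one neighbour in T loses no degree when T is contracted into a root. -/
theorem degIn_le_ind {T : Finset V} {u : V}
    (h : ∀ b ∈ T, ∀ b' ∈ T, G.Adj u b → G.Adj u b' → b = b') :
    G.degIn T u ≤ ind (G.nbs T) u := by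
  rcases Nat.eq_zero_or_pos (G.degIn T u) with h0 | h0
  · omega
  · rw [ind_of_mem (X := G.nbs T) (degIn_pos.1 h0)]
    refine Finset.card_le_one.2 fun b hb b' hb' => ?_
    rw [Finset.mem_filter] at hb hb'
    exact h b hb.1 b' hb'.1 hb.2 hb'.2

/-- Contract B = X ∩ D into x. By `hsq` no degree is lost, so the induction hypothesis settles any
component of D \ B that meets Y and contains a vertex other than z. What remains is that z is the
only vertex of Y outside B. It is adjacent to B, so the colours exclude Y from B; hence Y ∩ D = {z},
and z replaces y on a component of D - z. -/
theorem TwoSolvable.or_subset (hf : ∀ u v, G.Adj u v → f u ≠ f v) {D : Finset V} {X Y : Set V}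
    {z : V} (ih : TwoSolvable G f D.card) (hz : ∃ v ∈ D, v ≠ z) (hX : Mono f X) (hY : Mono f Y)
    (h : G.Linked D X Y)
    (hdeg : ∀ v ∈ D, v ≠ z → 3 ≤ G.degIn D v + ind X v + ind Y v)
    (hsq : ∀ w ∈ D, ∀ b ∈ D, ∀ b' ∈ D, b ∈ X → b' ∈ X → G.Adj w b → G.Adj w b' → b = b') :
    G.HasPathLengths D X Y 2 ∨ ∀ t ∈ D, t ∈ Y → t ∈ X := by
  by_contra! hcon
  obtain ⟨hno, t, ht, htY, htX⟩ := hcon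
  set B := D.filter (· ∈ X) with hB
  have hBX : ∀ b ∈ B, b ∈ D ∧ b ∈ X := fun b hb => Finset.mem_filter.1 hb
  have hout : ∀ w ∈ D, w ∉ D \ B → w ∈ B := fun w hw hw' => by
    by_contra h
    exact hw' (Finset.mem_sdiff.2 ⟨hw, h⟩)
  have hBm : Mono f (G.nbs B) := mono_nbs hf fun u hu v hv => hX u (hBX u hu).2 v (hBX v hv).2
  have key : ∀ v, ∀ t ∈ Y, G.ConnIn (D \ B) v t → v = z := by
    intro v t htY hvt
    have ht := (Finset.mem_sdiff.1 hvt.right_mem).1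
    by_contra hvz
    set D' := G.compIn (D \ B) v with hD'
    have hD'D : ∀ u ∈ D', u ∈ D ∧ u ∉ B := fun u hu => Finset.mem_sdiff.1 (compIn_subset hu)
    have hexit : ∀ p ∈ D', ∀ q ∈ D, q ∉ D' → G.Adj p q → q ∈ B := fun p hp q hq hqK hpq =>
      hout q hq fun h => hqK (compIn_closed hp hpq h)
    have hlink : G.Linked D' (G.nbs B) Y := by
      constructor
      · intro u hu c hc hcu
        obtain ⟨s, hs, hus⟩ := h.cut u (hD'D u hu).1 c (hD'D c hc).1 hcu
        refine hus.escape_of_forall (K := D') hu ?_ ?_ ?_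
        · intro x hx hxK
          exact Finset.mem_erase.2 ⟨(Finset.mem_erase.1 hx).1, hxK⟩
        · intro hsK
          exact .inr (hs.resolve_left fun hsX =>
            (hD'D s hsK).2 (Finset.mem_filter.2 ⟨(hD'D s hsK).1, hsX⟩))
        · intro p q _ hp hq hqK hpq
          exact .inl ⟨q, hexit p hp q (Finset.mem_of_mem_erase hq) hqK hpq, hpq⟩
      · intro u hu
        obtain ⟨s, hs, hus⟩ := h.left u (hD'D u hu).1
        refine hus.escape_of_forall (K := D') hu (fun x _ hx => hx) ?_ ?_
        · intro hsK
          exact absurd (Finset.mem_filter.2 ⟨(hD'D s hsK).1, hs⟩) (hD'D s hsK).2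
        · intro p q _ hp hq hqK hpq
          exact ⟨q, hexit p hp q hq hqK hpq, hpq⟩
      · intro u hu
        exact ⟨t, htY, connIn_compIn hu (mem_compIn.2 hvt)⟩
    have hBne : B.Nonempty := by
      obtain ⟨s, hs, hvs⟩ := h.left t ht
      exact ⟨s, Finset.mem_filter.2 ⟨hvs.right_mem, hs⟩⟩
    have hD'card : D'.card < D.card := by
      obtain ⟨b, hb⟩ := hBne
      exact Finset.card_lt_card ⟨fun u hu => (hD'D u hu).1, fun hsub =>
        (hD'D b (hsub (hBX b hb).1)).2 hb⟩
    have := ih D' (G.nbs B) Y z hD'card ⟨v, self_mem_compIn hvt.left_mem, hvz⟩ hBm hY hlink (by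
      intro u hu huz
      have h1 := hdeg u (hD'D u hu).1 huz
      have h2 : G.degIn D u ≤ G.degIn D' u + G.degIn B u := degIn_le_add fun w hw ha => by
        by_cases hwK : w ∈ D'
        · exact .inl hwK
        · exact .inr (hexit u hu w hw hwK ha)
      have h3 := degIn_le_ind (G := G) (T := B) (u := u) fun b hb b' hb' hub hub' =>
        hsq u (hD'D u hu).1 b (hBX b hb).1 b' (hBX b' hb').1 (hBX b hb).2 (hBX b' hb').2 hub hub'
      have h4 : ind X u = 0 := ind_of_notMem fun hx =>
        (hD'D u hu).2 (Finset.mem_filter.2 ⟨(hD'D u hu).1, hx⟩)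
      omega)
    refine hno ((this.prefix (S := B) (X := X) (r := 1) (α := 0) ?_ ?_ one_pos two_pos).weaken
      (Finset.union_subset (Finset.filter_subset _ _) fun u hu => (hD'D u hu).1) le_rfl)
    · intro s hs j hj
      obtain rfl : j = 0 := by omega
      exact ⟨s, (hBX s hs).2, .single hs⟩
    · rw [Finset.disjoint_right]
      exact fun u hu => (hD'D u hu).2
  have htB : t ∉ B := fun h => htX (hBX t h).2
  have htDB : t ∈ D \ B := Finset.mem_sdiff.2 ⟨ht, htB⟩
  obtain rfl : t = z := key t t htY (.refl htDB)
  have htw : ∃ w ∈ D, w ∈ X ∧ G.Adj t w := by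
    obtain ⟨s, hs, hts⟩ := h.left t ht
    cases hts with
    | refl _ => exact absurd hs htX
    | @head _ w _ _ ha hc =>
      have hwB : w ∈ B := hout w hc.left_mem fun hw =>
        ha.ne' (key w t htY (.head hw ha.symm (.refl htDB)))
      exact ⟨w, hc.left_mem, (hBX w hwB).2, ha⟩
  obtain ⟨w, hw, hwX, htw⟩ := htw
  have hYt : ∀ s ∈ D, s ∈ Y → s = t := by
    intro s hs hsY
    refine key s s hsY (.refl (Finset.mem_sdiff.2 ⟨hs, fun hsB => ?_⟩))
    exact hf _ _ htw ((hY t htY s hsY).trans (hX s (hBX s hsB).2 w hwX))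
  obtain ⟨v, hv, hvt⟩ := hz
  have hnoY : ∀ s ∈ G.compIn (D.erase t) v, s ∉ Y := fun s hs hsY => by
    have hs' := Finset.mem_erase.1 (compIn_subset hs)
    exact hs'.1 (hYt s hs'.2 hsY)
  refine hno (h.hasPathLengths_of_compIn_erase hv hvt.symm hnoY (ih _ _ _ t
    (card_compIn_erase_lt ht v) ⟨v, self_mem_compIn (Finset.mem_erase.2 ⟨hvt, hv⟩), hvt⟩
    hX (mono_nbs_singleton hf t) (h.compIn_erase hnoY ht) fun u hu huz => ?_))
  have h1 := hdeg u (Finset.mem_of_mem_erase (compIn_subset hu)) huz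
  have h2 := degIn_compIn_erase hu
  have h3 := ind_of_notMem (hnoY u hu)
  omega

/-- Both roots have the neighbourhood B in D. One vertex b₀ of B replaces y, the rest of B is
contracted into x, and by `hsq` no degree is lost. -/
theorem TwoSolvable.of_eq (hf : ∀ u v, G.Adj u v → f u ≠ f v) {D : Finset V} {X Y : Set V}
    {z : V} (ih : TwoSolvable G f D.card) (hz : ∃ v ∈ D, v ≠ z) (hX : Mono f X)
    (h : G.Linked D X Y)
    (hdeg : ∀ v ∈ D, v ≠ z → 3 ≤ G.degIn D v + ind X v + ind Y v)
    (hsq : ∀ w ∈ D, ∀ b ∈ D, ∀ b' ∈ D, b ∈ X → b' ∈ X → G.Adj w b → G.Adj w b' → b = b')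
    (hXY : ∀ t ∈ D, t ∈ X → t ∈ Y) (hYX : ∀ t ∈ D, t ∈ Y → t ∈ X) :
    G.HasPathLengths D X Y 2 := by
  set B := D.filter (· ∈ X) with hB
  have hBX : ∀ b, b ∈ B ↔ b ∈ D ∧ b ∈ X := fun b => Finset.mem_filter
  have hadj : ∀ b ∈ D, b ∈ X → ∀ w, G.Adj b w → w ∉ X := fun b _ hbX w ha hwX =>
    hf _ _ ha (hX b hbX w hwX)
  have hmem : ∀ t ∈ D, t ∈ X ∨ t ∈ Y → t ∈ X := fun t ht h => h.elim id (hYX t ht)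
  -- b₀ ≠ z guarantees that b₀ has a neighbour in D. If B had only one vertex t, then t would cut D
  -- off from the roots, or D = {t} would violate the degree condition.
  obtain ⟨b₀, hb₀, hb₀X, hb₀z, b₁, hb₁, hb₁X, hbb⟩ :
      ∃ b₀ ∈ D, b₀ ∈ X ∧ b₀ ≠ z ∧ ∃ b₁ ∈ D, b₁ ∈ X ∧ b₁ ≠ b₀ := by
    have two : ∃ b ∈ D, b ∈ X ∧ ∃ b' ∈ D, b' ∈ X ∧ b' ≠ b := by
      obtain ⟨v, hv, hvz⟩ := hz
      obtain ⟨t, ht, hvt⟩ := h.left v hv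
      have htD := hvt.right_mem
      by_cases hD : ∃ u ∈ D, t ≠ u
      · obtain ⟨u, hu, htu⟩ := hD
        obtain ⟨s, hs, hus⟩ := h.cut u hu t htD htu
        have hs' := Finset.mem_erase.1 hus.right_mem
        exact ⟨t, htD, ht, s, hs'.2, hmem s hs'.2 hs, hs'.1⟩
      · push Not at hD
        have h0 : G.degIn D v = 0 := degIn_eq_zero fun w hw ha =>
          ha.ne ((hD v hv).symm.trans (hD w hw))
        have h1 := hdeg v hv hvz
        have h2 := ind_le_one X v
        have h3 := ind_le_one Y v
        omega
    obtain ⟨b, hb, hbX, b', hb', hb'X, hbb⟩ := two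
    by_cases hbz : b = z
    · exact ⟨b', hb', hb'X, fun h => hbb (h.trans hbz.symm), b, hb, hbX, hbb.symm⟩
    · exact ⟨b, hb, hbX, hbz, b', hb', hb'X, hbb⟩
  obtain ⟨w, hw, hbw⟩ : ∃ w ∈ D, G.Adj b₀ w := by
    refine degIn_pos.1 ?_
    have h1 := hdeg b₀ hb₀ hb₀z
    have h2 := ind_le_one X b₀
    have h3 := ind_le_one Y b₀
    omega
  have hwB : w ∈ D \ B := Finset.mem_sdiff.2 ⟨hw, fun hwB =>
    hadj b₀ hb₀ hb₀X w hbw ((hBX w).1 hwB).2⟩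
  set D' := G.compIn (D \ B) w with hD'
  have hD'D : ∀ u ∈ D', u ∈ D ∧ u ∉ X := fun u hu => by
    have := Finset.mem_sdiff.1 (compIn_subset hu)
    exact ⟨this.1, fun hx => this.2 ((hBX u).2 ⟨this.1, hx⟩)⟩
  have hexit : ∀ p ∈ D', ∀ q ∈ D, q ∉ D' → G.Adj p q → q ∈ B := fun p hp q hq hqK hpq => by
    by_contra h
    exact hqK (compIn_closed hp hpq (Finset.mem_sdiff.2 ⟨hq, h⟩))
  have hno : ∀ t ∈ D', ¬ (t ∈ X ∨ t ∈ Y) := fun t ht h => (hD'D t ht).2 (hmem t (hD'D t ht).1 h)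
  have hsplit : ∀ p, ∀ q ∈ B, G.Adj p q → p ∈ G.nbs (B.erase b₀) ∨ p ∈ G.nbs {b₀} := by
    intro p q hq hpq
    by_cases hqb : q = b₀
    · subst hqb
      exact .inr (mem_nbs_singleton.2 hpq)
    · exact .inl ⟨q, Finset.mem_erase.2 ⟨hqb, hq⟩, hpq⟩
  have hwD' : w ∈ D' := self_mem_compIn hwB
  have hlink : G.Linked D' (G.nbs (B.erase b₀)) (G.nbs {b₀}) := by
    constructor
    · intro u hu c hc hcu
      obtain ⟨s, hs, hus⟩ := h.cut u (hD'D u hu).1 c (hD'D c hc).1 hcu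
      refine hus.escape_of_forall (K := D') hu ?_ ?_ ?_
      · intro x hx hxK
        exact Finset.mem_erase.2 ⟨(Finset.mem_erase.1 hx).1, hxK⟩
      · intro hsK
        exact absurd hs (hno s hsK)
      · intro p q _ hp hq hqK hpq
        exact hsplit p q (hexit p hp q (Finset.mem_of_mem_erase hq) hqK hpq) hpq
    · intro u hu
      have hbu : b₀ ≠ u := fun h => (hD'D u hu).2 (h ▸ hb₀X)
      obtain ⟨s, hs, hus⟩ := h.cut u (hD'D u hu).1 b₀ hb₀ hbu
      refine hus.escape_of_forall (K := D') hu (fun x _ hx => hx) ?_ ?_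
      · intro hsK
        exact absurd hs (hno s hsK)
      · intro p q _ hp hq hqK hpq
        have hq' := Finset.mem_erase.1 hq
        exact ⟨q, Finset.mem_erase.2 ⟨hq'.1, hexit p hp q hq'.2 hqK hpq⟩, hpq⟩
    · intro u hu
      exact ⟨w, mem_nbs_singleton.2 hbw.symm, connIn_compIn hu hwD'⟩
  -- If w = z, a walk from w to the roots that avoids b₀ begins with a step inside D', since w has
  -- no second neighbour in B.
  have hnonz : ∃ v ∈ D', v ≠ z := by
    by_cases hwz : w = z
    · have hbw' : b₀ ≠ w := hbw.ne
      obtain ⟨s, hs, hws⟩ := h.cut w hw b₀ hb₀ hbw'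
      cases hws with
      | refl _ => exact absurd hs (hno w hwD')
      | @head _ a _ _ ha hc =>
        have ha' := Finset.mem_erase.1 hc.left_mem
        refine ⟨a, ?_, fun h => ha.ne (hwz.trans h.symm)⟩
        by_contra haD
        have haB := hexit w hwD' a ha'.2 haD ha
        exact ha'.1 (hsq w hw a ha'.2 b₀ hb₀ ((hBX a).1 haB).2 hb₀X ha hbw.symm)
    · exact ⟨w, hwD', hwz⟩
  have hcard : D'.card < D.card := Finset.card_lt_card ⟨fun u hu => (hD'D u hu).1, fun hsub =>
    (hD'D b₀ (hsub hb₀)).2 hb₀X⟩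
  have hmain := ih D' _ _ z hcard hnonz (mono_nbs hf fun u hu v hv =>
    hX u ((hBX u).1 (Finset.mem_of_mem_erase hu)).2 v ((hBX v).1 (Finset.mem_of_mem_erase hv)).2)
    (mono_nbs_singleton hf b₀) hlink (by
      intro u hu huz
      have h1 := hdeg u (hD'D u hu).1 huz
      have h2 : G.degIn D u ≤ G.degIn D' u + G.degIn B u := degIn_le_add fun w hw ha => by
        by_cases hwK : w ∈ D'
        · exact .inl hwK
        · exact .inr (hexit u hu w hw hwK ha)
      have h3 : G.degIn B u ≤ G.degIn (B.erase b₀) u + G.degIn {b₀} u := degIn_le_add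
        fun w hw _ => by
          by_cases hwb : w = b₀
          · exact .inr (Finset.mem_singleton.2 hwb)
          · exact .inl (Finset.mem_erase.2 ⟨hwb, hw⟩)
      rw [degIn_singleton] at h3
      have h4 := degIn_le_ind (G := G) (T := B.erase b₀) (u := u) fun b hb b' hb' hub hub' => by
        have e1 := (hBX b).1 (Finset.mem_of_mem_erase hb)
        have e2 := (hBX b').1 (Finset.mem_of_mem_erase hb')
        exact hsq u (hD'D u hu).1 b e1.1 b' e2.1 e1.2 e2.2 hub hub'
      have h5 := ind_of_notMem fun hx => hno u hu (.inl hx)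
      have h6 := ind_of_notMem fun hx => hno u hu (.inr hx)
      omega)
  have h1 := hmain.suffix (Y := Y) (.refl (Finset.mem_singleton_self b₀)) (hXY b₀ hb₀ hb₀X)
    (Finset.disjoint_singleton_left.2 fun h => (hD'D b₀ h).2 hb₀X)
  refine (h1.prefix (S := B.erase b₀) (X := X) (r := 1) (α := 0) ?_ ?_ one_pos
    two_pos).weaken ?_ le_rfl
  · intro s hs j hj
    obtain rfl : j = 0 := by omega
    exact ⟨s, ((hBX s).1 (Finset.mem_of_mem_erase hs)).2, .single hs⟩
  · rw [Finset.disjoint_left]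
    intro u hu hu'
    rcases Finset.mem_union.1 hu' with hu' | hu'
    · exact (Finset.mem_erase.1 hu).1 (Finset.mem_singleton.1 hu')
    · exact (hD'D u hu').2 ((hBX u).1 (Finset.mem_of_mem_erase hu)).2
  · intro u hu
    rcases Finset.mem_union.1 hu with hu | hu
    · exact ((hBX u).1 (Finset.mem_of_mem_erase hu)).1
    · rcases Finset.mem_union.1 hu with hu | hu
      · rwa [Finset.mem_singleton.1 hu]
      · exact (hD'D u hu).1

theorem twoSolvable (hf : ∀ u v, G.Adj u v → f u ≠ f v) (n : ℕ) : TwoSolvable G f n := by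
  induction n with
  | zero => exact fun D X Y z hD => absurd hD (Nat.not_lt_zero _)
  | succ n ih =>
    intro D X Y z hD hz hX hY h hdeg
    have ih' : TwoSolvable G f D.card := fun D' X' Y' z' hD' =>
      ih D' X' Y' z' (by omega)
    have hdeg' : ∀ v ∈ D, v ≠ z → 3 ≤ G.degIn D v + ind Y v + ind X v := fun v hv hvz => by
      have := hdeg v hv hvz
      omega
    rcases ih'.square_or hf hX h hdeg with h1 | h1
    · exact h1
    rcases ih'.square_or hf hY h.symm hdeg' with h2 | h2
    · exact h2.symm
    rcases ih'.or_subset hf hz hX hY h hdeg h1 with h3 | h3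
    · exact h3
    rcases ih'.or_subset hf hz hY hX h.symm hdeg' h2 with h4 | h4
    · exact h4.symm
    exact ih'.of_eq hf hz hX h hdeg h1 h4 h3

end TwoLengths

end SimpleGraph

namespace SimpleGraph

/-! ### Reduction along small cuts -/

section Irreducible

open Classical

variable {V : Type*} {G : SimpleGraph V} {f : V → Bool}

/-- The induction hypothesis for the path lengths theorem. -/
def Solvable (G : SimpleGraph V) (f : V → Bool) (n : ℕ) : Prop :=
  ∀ (D : Finset V) (X Y : Set V) (k : ℕ), D.card < n → D.Nonempty → Mono f X → Mono f Y →
    G.Linked D X Y → (1 < k → ∀ v ∈ D, k + 1 ≤ G.degIn D v + ind X v + ind Y v) →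
      G.HasPathLengths D X Y k

/-- The connectivity of configurations that do not reduce to a smaller one along a cut of size at
most two. -/
structure Irreducible (G : SimpleGraph V) (D : Finset V) (X Y : Set V) : Prop where
  conn : ∀ u ∈ D, ∀ v ∈ D, G.ConnIn D u v
  toLeft : ∀ v ∈ D, ∀ c ∈ D, c ≠ v → ∃ t ∈ X, G.ConnIn (D.erase c) v t
  toRight : ∀ v ∈ D, ∀ c ∈ D, c ≠ v → ∃ t ∈ Y, G.ConnIn (D.erase c) v t
  two : ∀ v ∈ D, ∀ p ∈ D, ∀ q ∈ D, p ≠ v → q ≠ v →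
    ∃ t, (t ∈ X ∨ t ∈ Y) ∧ G.ConnIn ((D.erase p).erase q) v t

theorem Irreducible.symm {D : Finset V} {X Y : Set V} (h : Irreducible G D X Y) :
    Irreducible G D Y X where
  conn := h.conn
  toLeft := h.toRight
  toRight := h.toLeft
  two v hv p hp q hq hpv hqv := by
    obtain ⟨t, ht, h'⟩ := h.two v hv p hp q hq hpv hqv
    exact ⟨t, ht.symm, h'⟩

theorem HasPathLengths.extend_both {K S T : Finset V} {X Y : Set V} {a b x y : V} {k : ℕ}
    (h : G.HasPathLengths K (G.nbs {a}) (G.nbs {b}) k) (hx : x ∈ X) (hy : y ∈ Y)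
    (hax : G.ConnIn S a x) (hby : G.ConnIn T b y) (hST : Disjoint S T) (hSK : Disjoint S K)
    (hTK : Disjoint T K) : G.HasPathLengths (S ∪ (T ∪ K)) X Y k :=
  ((h.suffix hby hy hTK).symm.suffix hax hx (Finset.disjoint_union_right.2 ⟨hST, hSK⟩)).symm

/-- Otherwise {x, c} is a cut, and c replaces y on the part cut off from Y at no cost in degree. -/
theorem Solvable.toRight {D : Finset V} {X Y : Set V} {k : ℕ} (ih : Solvable G f D.card)
    (hf : ∀ u v, G.Adj u v → f u ≠ f v) (hX : Mono f X) (h : G.Linked D X Y)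
    (hdeg : ∀ v ∈ D, k + 1 ≤ G.degIn D v + ind X v + ind Y v)
    (hno : ¬ G.HasPathLengths D X Y k) :
    ∀ v ∈ D, ∀ c ∈ D, c ≠ v → ∃ t ∈ Y, G.ConnIn (D.erase c) v t := by
  intro v hv c hc hcv
  by_contra! hcon
  have hY' : ∀ t ∈ G.compIn (D.erase c) v, t ∉ Y := fun t ht htY =>
    hcon t htY (mem_compIn.1 ht)
  refine hno (h.hasPathLengths_of_compIn_erase hv hcv hY' (ih _ _ _ _ (card_compIn_erase_lt hc v)
    ⟨v, self_mem_compIn (Finset.mem_erase.2 ⟨hcv.symm, hv⟩)⟩ hX (mono_nbs_singleton hf c)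
    (h.compIn_erase hY' hc) fun _ u hu => ?_))
  have h1 := hdeg u (Finset.mem_of_mem_erase (compIn_subset hu))
  have h2 := degIn_compIn_erase hu
  have h3 := ind_of_notMem (hY' u hu)
  omega

/-- Otherwise {x, y} is a cut, and a single component of D with the same roots is a smaller
instance. -/
theorem Solvable.conn {D : Finset V} {X Y : Set V} {k : ℕ} (ih : Solvable G f D.card)
    (hX : Mono f X) (hY : Mono f Y) (h : G.Linked D X Y)
    (hdeg : ∀ v ∈ D, k + 1 ≤ G.degIn D v + ind X v + ind Y v)
    (hno : ¬ G.HasPathLengths D X Y k) : ∀ u ∈ D, ∀ v ∈ D, G.ConnIn D u v := by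
  intro u hu v hv
  by_contra hcon
  set K := G.compIn D u with hK
  have hKD : ∀ p ∈ K, p ∈ D := fun p hp => compIn_subset hp
  have hexit : ∀ p ∈ K, ∀ q ∈ D, q ∉ K → ¬ G.Adj p q := fun p hp q hq hqK hpq =>
    hqK (compIn_closed hp hpq hq)
  have hcard : K.card < D.card := Finset.card_lt_card ⟨compIn_subset, fun hsub =>
    hcon (mem_compIn.1 (hsub hv))⟩
  refine hno ((ih K X Y k hcard ⟨u, self_mem_compIn hu⟩ hX hY ⟨?_, ?_, ?_⟩
    fun _ w hw => ?_).weaken compIn_subset le_rfl)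
  · intro w hw c hc hcw
    obtain ⟨t, ht, hwt⟩ := h.cut w (hKD w hw) c (hKD c hc) hcw
    exact hwt.escape_of_forall (K := K) hw
      (fun z hz hzK => Finset.mem_erase.2 ⟨(Finset.mem_erase.1 hz).1, hzK⟩) (fun _ => ht)
      fun p q _ hp hq hqK hpq => absurd hpq (hexit p hp q (Finset.mem_of_mem_erase hq) hqK)
  · intro w hw
    obtain ⟨t, ht, hwt⟩ := h.left w (hKD w hw)
    exact ⟨t, ht, hwt.in_compIn hw⟩
  · intro w hw
    obtain ⟨t, ht, hwt⟩ := h.right w (hKD w hw)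
    exact ⟨t, ht, hwt.in_compIn hw⟩
  · have h1 := hdeg w (hKD w hw)
    have h2 : G.degIn D w ≤ G.degIn K w := degIn_mono fun q hq ha => compIn_closed hw ha hq
    omega

/-- Otherwise {p, q} separates a part K from both roots. The induction hypothesis gives the paths
through K between p and q, and the two walks of a fan from v, taken after they leave K for the last
time, lead disjointly from p and q to the roots. -/
theorem Solvable.two {D : Finset V} {X Y : Set V} {k : ℕ} (ih : Solvable G f D.card)
    (hf : ∀ u v, G.Adj u v → f u ≠ f v) (h : G.Linked D X Y)
    (hdeg : ∀ v ∈ D, k + 1 ≤ G.degIn D v + ind X v + ind Y v)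
    (hno : ¬ G.HasPathLengths D X Y k) {v p q : V} (hv : v ∈ D) (hp : p ∈ D) (hq : q ∈ D)
    (hpv : p ≠ v) (hqv : q ≠ v) :
    ∃ t, (t ∈ X ∨ t ∈ Y) ∧ G.ConnIn ((D.erase p).erase q) v t := by
  by_cases hpq : p = q
  · subst hpq
    rw [Finset.erase_eq_of_notMem (Finset.notMem_erase p D)]
    exact h.cut v hv p hp hpv
  by_contra! hcon
  set K := G.compIn ((D.erase p).erase q) v with hK
  have hKD : ∀ u ∈ K, u ≠ q ∧ u ≠ p ∧ u ∈ D := fun u hu => by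
    have h1 := Finset.mem_erase.1 (compIn_subset hu)
    exact ⟨h1.1, Finset.mem_erase.1 h1.2⟩
  have hno' : ∀ t ∈ K, ¬ (t ∈ X ∨ t ∈ Y) := fun t ht h => hcon t h (mem_compIn.1 ht)
  have hvK : v ∈ K := self_mem_compIn
    (Finset.mem_erase.2 ⟨hqv.symm, Finset.mem_erase.2 ⟨hpv.symm, hv⟩⟩)
  have hexit : ∀ u ∈ K, ∀ w ∈ D, w ∉ K → G.Adj u w → w = p ∨ w = q := by
    intro u hu w hw hwK ha
    by_contra! hc
    exact hwK (compIn_closed hu ha (Finset.mem_erase.2 ⟨hc.2, Finset.mem_erase.2 ⟨hc.1, hw⟩⟩))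
  have hlink : G.Linked K (G.nbs {p}) (G.nbs {q}) := by
    refine ⟨?_, ?_, ?_⟩
    · intro u hu c hc hcu
      obtain ⟨t, ht, hut⟩ := h.cut u (hKD u hu).2.2 c (hKD c hc).2.2 hcu
      refine hut.escape_of_forall (K := K) hu
        (fun z hz hzK => Finset.mem_erase.2 ⟨(Finset.mem_erase.1 hz).1, hzK⟩)
        (fun htK => absurd ht (hno' t htK)) ?_
      intro a b _ ha hb hbK hab
      rw [mem_nbs_singleton, mem_nbs_singleton]
      rcases hexit a ha b (Finset.mem_of_mem_erase hb) hbK hab with rfl | rfl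
      exacts [.inl hab, .inr hab]
    · intro u hu
      obtain ⟨t, ht, hut⟩ := h.cut u (hKD u hu).2.2 q hq (hKD u hu).1.symm
      refine hut.escape_of_forall (K := K) hu (fun z _ hzK => hzK)
        (fun htK => absurd ht (hno' t htK)) ?_
      intro a b _ ha hb hbK hab
      have hb' := Finset.mem_erase.1 hb
      obtain rfl := (hexit a ha b hb'.2 hbK hab).resolve_right hb'.1
      exact mem_nbs_singleton.2 hab
    · intro u hu
      obtain ⟨t, ht, hut⟩ := h.cut u (hKD u hu).2.2 p hp (hKD u hu).2.1.symm
      refine hut.escape_of_forall (K := K) hu (fun z _ hzK => hzK)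
        (fun htK => absurd ht (hno' t htK)) ?_
      intro a b _ ha hb hbK hab
      have hb' := Finset.mem_erase.1 hb
      obtain rfl := (hexit a ha b hb'.2 hbK hab).resolve_left hb'.1
      exact mem_nbs_singleton.2 hab
  have hcard : K.card < D.card := Finset.card_lt_card ⟨fun u hu => (hKD u hu).2.2, fun hsub =>
    (hKD p (hsub hp)).2.1 rfl⟩
  have hmain := ih K _ _ k hcard ⟨v, hvK⟩ (mono_nbs_singleton hf p) (mono_nbs_singleton hf q)
    hlink (by
      intro _ u hu
      have h1 := hdeg u (hKD u hu).2.2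
      have h2 : G.degIn D u ≤ G.degIn K u + G.degIn ({p} ∪ {q}) u := degIn_le_add
        fun w hw ha => by
          by_cases hwK : w ∈ K
          · exact .inl hwK
          · right
            rcases hexit u hu w hw hwK ha with rfl | rfl <;> simp
      have h3 := degIn_union_le (G := G) {p} {q} u
      rw [degIn_singleton, degIn_singleton] at h3
      have h4 := ind_of_notMem fun hx => hno' u hu (.inl hx)
      have h5 := ind_of_notMem fun hx => hno' u hu (.inr hx)
      omega)
  obtain ⟨S, hS, T, hT, hST, ⟨x, hx, hvx⟩, y, hy, hvy⟩ := h.hasFan hv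
  obtain ⟨a, b, _, ha, hab, hbx⟩ := hvx.last_exit K hvK fun h => hno' x h (.inl hx)
  obtain ⟨c, d, _, hc, hcd, hdy⟩ := hvy.last_exit K hvK fun h => hno' y h (.inr hy)
  have hb := Finset.mem_sdiff.1 hbx.left_mem
  have hd := Finset.mem_sdiff.1 hdy.left_mem
  have hbd : b ≠ d := by
    rintro rfl
    exact hb.2 (hST b hb.1 hd.1 ▸ hvK)
  have hdisj : Disjoint (S \ K) (T \ K) := by
    rw [Finset.disjoint_left]
    intro z hz hz'
    have hz := Finset.mem_sdiff.1 hz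
    exact hz.2 (hST z hz.1 (Finset.mem_sdiff.1 hz').1 ▸ hvK)
  have hmain' : G.HasPathLengths K (G.nbs {b}) (G.nbs {d}) k := by
    rcases hexit a ha b (hS hb.1) hb.2 hab with rfl | rfl
    · rcases hexit c hc d (hT hd.1) hd.2 hcd with rfl | rfl
      exacts [absurd rfl hbd, hmain]
    · rcases hexit c hc d (hT hd.1) hd.2 hcd with rfl | rfl
      exacts [hmain.symm, absurd rfl hbd]
  refine hno ((hmain'.extend_both hx hy hbx hdy hdisj Finset.sdiff_disjoint
    Finset.sdiff_disjoint).weaken ?_ le_rfl)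
  intro z hz
  simp only [Finset.mem_union, Finset.mem_sdiff] at hz
  rcases hz with hz | hz | hz
  exacts [hS hz.1, hT hz.1, (hKD z hz).2.2]

theorem Solvable.irreducible {D : Finset V} {X Y : Set V} {k : ℕ} (ih : Solvable G f D.card)
    (hf : ∀ u v, G.Adj u v → f u ≠ f v) (hX : Mono f X) (hY : Mono f Y) (h : G.Linked D X Y)
    (hdeg : ∀ v ∈ D, k + 1 ≤ G.degIn D v + ind X v + ind Y v)
    (hno : ¬ G.HasPathLengths D X Y k) : Irreducible G D X Y where
  conn := ih.conn hX hY h hdeg hno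
  toLeft := ih.toRight (k := k) hf hY h.symm (fun v hv => by
    have := hdeg v hv
    omega) fun h => hno h.symm
  toRight := ih.toRight hf hX h hdeg hno
  two _ hv _ hp _ hq hpv hqv := ih.two hf h hdeg hno hv hp hq hpv hqv

/-- Paths through a part `K` of the graph that is attached to a complete bipartite subgraph along
the set `A` of its second side. -/
theorem Solvable.bridge {D : Finset V} {X Y T : Set V} {k : ℕ} (ih : Solvable G f D.card)
    (hf : ∀ u v, G.Adj u v → f u ≠ f v) (irr : Irreducible G D X Y)
    (hdeg : ∀ v ∈ D, k + 1 ≤ G.degIn D v + ind X v + ind Y v)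
    {K A B E : Finset V} (hKD : K ⊆ D) (hAD : A ⊆ D) (hBD : B ⊆ D) (hED : E ⊆ D)
    (hK : K.Nonempty) (hA : A.Nonempty) (hBX : ∀ b ∈ B, b ∈ X) (hT : Mono f T)
    (hAB : ∀ a ∈ A, ∀ b ∈ B, G.Adj a b) (hcard : A.card ≤ B.card)
    (hAK : Disjoint A (K ∪ E)) (hBK : Disjoint B (K ∪ E))
    (hexit : ∀ u ∈ K, ∀ w ∈ D, w ∉ K → G.Adj u w → w ∈ A ∨ u ∈ T)
    (hYT : ∀ u ∈ K, u ∈ Y → u ∈ T)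
    (hleft : ∀ u ∈ K, ∃ t ∈ G.nbs A, G.ConnIn K u t)
    (hright : ∀ u ∈ K, ∃ t ∈ T, G.ConnIn K u t)
    (hdegK : ∀ u ∈ K, G.degIn D u + ind Y u ≤ G.degIn K u + G.degIn A u + ind T u)
    (hXA : ∀ u ∈ K, u ∈ X → 2 ≤ A.card ∧ G.degIn A u < A.card)
    (hsuf : ∀ k', G.HasPathLengths K (G.nbs A) T k' → G.HasPathLengths (K ∪ E) (G.nbs A) Y k') :
    G.HasPathLengths D X Y k := by
  have hApos := hA.card_pos
  have hlink : G.Linked K (G.nbs A) T := by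
    refine ⟨?_, hleft, hright⟩
    intro u hu c hc hcu
    obtain ⟨t, ht, hut⟩ := irr.toRight u (hKD hu) c (hKD hc) hcu
    refine hut.escape_of_forall (K := K) hu
      (fun z hz hzK => Finset.mem_erase.2 ⟨(Finset.mem_erase.1 hz).1, hzK⟩)
      (fun htK => .inr (hYT t htK ht)) ?_
    intro p q _ hp hq hqK hpq
    rcases hexit p hp q (Finset.mem_of_mem_erase hq) hqK hpq with h | h
    · exact .inl ⟨q, h, hpq⟩
    · exact .inr h
  have hmonoA : ∀ u ∈ A, ∀ v ∈ A, f u = f v := by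
    obtain ⟨b, hb⟩ : B.Nonempty := Finset.card_pos.1 (hApos.trans_le hcard)
    intro u hu v hv
    have h1 := hf _ _ (hAB u hu b hb)
    have h2 := hf _ _ (hAB v hv b hb)
    revert h1 h2
    cases f u <;> cases f v <;> cases f b <;> simp
  obtain ⟨a, ha⟩ := hA
  have hKcard : K.card < D.card := Finset.card_lt_card ⟨hKD, fun hsub =>
    Finset.disjoint_left.1 hAK ha (Finset.mem_union_left _ (hsub (hAD ha)))⟩
  -- The paths from B to a vertex of A have `A.card` lengths, so k + 1 - `A.card` lengths through K
  -- suffice. A vertex adjacent to A exchanges at most `A.card` edges for one; for vertices of X,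
  -- `hXA` also pays for the lost edge to x. The `max 1` keeps the family nonempty when `A.card`
  -- exceeds k.
  have hmain := ih K (G.nbs A) T (max 1 (k + 1 - A.card)) hKcard hK (mono_nbs hf hmonoA) hT hlink (by
    intro hk u hu
    have h1 := hdeg u (hKD hu)
    have h2 := hdegK u hu
    have h3 := degIn_le_card (G := G) A u
    rcases Nat.eq_zero_or_pos (G.degIn A u) with h4 | h4
    · by_cases huX : u ∈ X
      · have h5 := hXA u hu huX
        rw [ind_of_mem huX] at h1
        omega
      · rw [ind_of_notMem huX] at h1
        omega
    · have h6 : ind (G.nbs A) u = 1 := ind_of_mem (degIn_pos.1 h4)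
      by_cases huX : u ∈ X
      · have h5 := hXA u hu huX
        rw [ind_of_mem huX] at h1
        omega
      · rw [ind_of_notMem huX] at h1
        omega)
  have hABd : Disjoint A B := Finset.disjoint_left.2 fun z hz hz' => G.irrefl (hAB z hz z hz')
  have hpre : ∀ t ∈ A, ∀ j < A.card, ∃ u ∈ X, G.PathIn (A ∪ B) u t (1 + 2 * j) := by
    intro t ht j hj
    obtain ⟨b, hb, hp⟩ := exists_pathIn_of_complete' hAB hABd j hj (by omega) ht
    exact ⟨b, hBX b hb, hp⟩
  refine ((hsuf _ hmain).prefix hpre (Finset.disjoint_union_left.2 ⟨hAK, hBK⟩) hApos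
    (by omega)).weaken ?_ (by omega)
  exact Finset.union_subset (Finset.union_subset hAD hBD) (Finset.union_subset hKD hED)

/-- On a side of the cut {a, x, y} the root x is dropped in favour of a. Connectivity survives
because `irr.toRight` provides walks to Y that do not rely on X. -/
theorem Irreducible.linked_side {D K : Finset V} {X Y : Set V} {a : V}
    (irr : Irreducible G D X Y) (ha : a ∈ D) (haK : a ∉ K) (hKD : K ⊆ D)
    (hexit : ∀ u ∈ K, ∀ w ∈ D, w ∉ K → G.Adj u w → w = a) :
    G.Linked K (G.nbs {a}) Y := by
  have hne : ∀ u ∈ K, a ≠ u := fun u hu h => haK (h ▸ hu)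
  refine ⟨?_, ?_, ?_⟩
  · intro u hu c hc hcu
    obtain ⟨t, ht, hut⟩ := irr.toRight u (hKD hu) c (hKD hc) hcu
    refine hut.escape_of_forall (K := K) hu
      (fun z hz hzK => Finset.mem_erase.2 ⟨(Finset.mem_erase.1 hz).1, hzK⟩) (fun _ => .inr ht) ?_
    intro p q _ hp hq hqK hpq
    obtain rfl := hexit p hp q (Finset.mem_of_mem_erase hq) hqK hpq
    exact .inl (mem_nbs_singleton.2 hpq)
  · intro u hu
    refine (irr.conn u (hKD hu) a ha).escape_of_forall (K := K) hu (fun z _ hz => hz)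
      (fun h => absurd h haK) ?_
    intro p q _ hp hq hqK hpq
    obtain rfl := hexit p hp q hq hqK hpq
    exact mem_nbs_singleton.2 hpq
  · intro u hu
    obtain ⟨t, ht, hut⟩ := irr.toRight u (hKD hu) a ha (hne u hu)
    refine hut.escape_of_forall (K := K) hu (fun z _ hz => hz) (fun _ => ht) ?_
    intro p q _ hp hq hqK hpq
    have hq' := Finset.mem_erase.1 hq
    exact absurd (hexit p hp q hq'.2 hqK hpq) hq'.1

theorem degIn_le_of_exit {D K : Finset V} {a u : V}
    (hexit : ∀ w ∈ D, w ∉ K → G.Adj u w → w = a) :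
    G.degIn D u ≤ G.degIn K u + ind (G.nbs {a}) u := by
  rw [← degIn_singleton]
  refine degIn_le_add fun w hw ha => ?_
  by_cases hwK : w ∈ K
  · exact .inl hwK
  · exact .inr (Finset.mem_singleton.2 (hexit w hw hwK ha))

theorem degIn_le_of_exit₂ {D K : Finset V} {a c u : V}
    (hexit : ∀ w ∈ D, w ∉ K → G.Adj u w → w = a ∨ w = c) :
    G.degIn D u ≤ G.degIn K u + ind (G.nbs {a}) u + ind (G.nbs {c}) u := by
  rw [← degIn_singleton, ← degIn_singleton, add_assoc]
  have h1 : G.degIn D u ≤ G.degIn K u + G.degIn ({a} ∪ {c}) u := degIn_le_add fun w hw ha => by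
    by_cases hwK : w ∈ K
    · exact .inl hwK
    · right
      rcases hexit w hw hwK ha with rfl | rfl <;> simp
  exact h1.trans (Nat.add_le_add_left (degIn_union_le _ _ _) _)

/-- A cut consisting of one vertex and both roots. -/
theorem Solvable.of_cut_vertex {D : Finset V} {X Y : Set V} {k : ℕ} (ih : Solvable G f D.card)
    (hf : ∀ u v, G.Adj u v → f u ≠ f v) (hX : Mono f X) (hY : Mono f Y)
    (irr : Irreducible G D X Y)
    (hdeg : ∀ v ∈ D, k + 1 ≤ G.degIn D v + ind X v + ind Y v) (hk : 3 ≤ k) {K : Finset V} {a v : V}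
    (ha : a ∈ D) (haK : a ∉ K) (hKD : K ⊆ D) (hK : K.Nonempty)
    (hexit : ∀ u ∈ K, ∀ w ∈ D, w ∉ K → G.Adj u w → w = a) (hv : v ∈ D) (hvK : v ∉ K)
    (hva : v ≠ a) : G.HasPathLengths D X Y k := by
  set E := D \ insert a K with hE
  have hEm : ∀ u, u ∈ E ↔ u ∈ D ∧ u ≠ a ∧ u ∉ K := fun u => by simp [hE]
  have haE : a ∉ E := fun h => ((hEm a).1 h).2.1 rfl
  have hEexit : ∀ u ∈ E, ∀ w ∈ D, w ∉ E → G.Adj u w → w = a := by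
    intro u hu w hw hwE huw
    by_contra hwa
    have hwK : w ∈ K := by
      by_contra hwK
      exact hwE ((hEm w).2 ⟨hw, hwa, hwK⟩)
    have := (hEm u).1 hu
    exact this.2.1 (hexit w hwK u this.1 this.2.2 huw.symm)
  have hED : E ⊆ D := Finset.sdiff_subset
  have lt : ∀ S : Finset V, S ⊆ D → a ∉ S → S.card < D.card := fun S hS haS =>
    Finset.card_lt_card ⟨hS, fun hsub => haS (hsub ha)⟩
  -- Each side loses only one root. So K still has degree k, enough for k - 1 lengths from a to Y,
  -- and E has degree at least 3, enough for two lengths from X to a; 2 + (k - 1) - 1 = k.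
  have h1 := ih K _ Y (k - 1) (lt K hKD haK) hK (mono_nbs_singleton hf a) hY
    (irr.linked_side ha haK hKD hexit) (by
      intro _ u hu
      have h1 := hdeg u (hKD hu)
      have h2 := degIn_le_of_exit (G := G) (hexit u hu)
      have h3 := ind_le_one X u
      omega)
  have h2 := ih E X _ 2 (lt E hED haE) ⟨v, (hEm v).2 ⟨hv, hva, hvK⟩⟩ hX (mono_nbs_singleton hf a)
    (irr.symm.linked_side ha haE hED hEexit).symm (by
      intro _ u hu
      have h1 := hdeg u (hED hu)
      have h2 := degIn_le_of_exit (G := G) (hEexit u hu)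
      have h3 := ind_le_one Y u
      omega)
  refine (h2.glue h1 ?_ haE haK two_pos (by omega)).weaken ?_ (by omega)
  · exact Finset.disjoint_left.2 fun u hu => ((hEm u).1 hu).2.2
  · exact Finset.insert_subset ha (Finset.union_subset hED hKD)

end Irreducible

end SimpleGraph

namespace SimpleGraph

/-! ### Cuts consisting of one root and two vertices -/

section ThreeCut

open Classical

variable {V : Type*} {G : SimpleGraph V} {f : V → Bool}

/-- Two parts attached along cuts of three vertices that share `a` and the root of `X`. -/
theorem Solvable.of_two_cuts {D : Finset V} {X Y : Set V} {k : ℕ} (ih : Solvable G f D.card)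
    (hf : ∀ u v, G.Adj u v → f u ≠ f v) (hX : Mono f X)
    (irr : Irreducible G D X Y)
    (hdeg : ∀ v ∈ D, k + 1 ≤ G.degIn D v + ind X v + ind Y v) (hk : 3 ≤ k) {K E : Finset V}
    {a c e : V} (ha : a ∈ D) (hc : c ∈ D) (he : e ∈ D) (haK : a ∉ K) (hcK : c ∉ K) (hac : a ≠ c)
    (haE : a ∉ E) (hcE : c ∉ E) (heE : e ∉ E) (hKD : K ⊆ D) (hED : E ⊆ D)
    (hK : K.Nonempty) (hE : E.Nonempty) (hEK : Disjoint E K)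
    (hKexit : ∀ u ∈ K, ∀ w ∈ D, w ∉ K → G.Adj u w → w = a ∨ w = c)
    (hEexit : ∀ u ∈ E, ∀ w ∈ D, w ∉ E → G.Adj u w → w = a ∨ w = e)
    (hKY : ∀ u ∈ K, u ∉ Y) (hEY : ∀ u ∈ E, u ∉ Y)
    (hEa : ∀ u ∈ E, ∃ t ∈ G.nbs {a}, G.ConnIn E u t) : G.HasPathLengths D X Y k := by
  have neK : ∀ {z : V}, z ∉ K → ∀ u ∈ K, z ≠ u := fun h u hu h' => h (h' ▸ hu)
  have neE : ∀ {z : V}, z ∉ E → ∀ u ∈ E, z ≠ u := fun h u hu h' => h (h' ▸ hu)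
  have lt : ∀ S : Finset V, S ⊆ D → a ∉ S → S.card < D.card := fun S hS haS =>
    Finset.card_lt_card ⟨hS, fun hsub => haS (hsub ha)⟩
  have hlinkK : G.Linked K (G.nbs {a}) (G.nbs {c}) := by
    refine ⟨?_, ?_, ?_⟩
    · intro u hu z hz hzu
      obtain ⟨t, ht, hut⟩ := irr.toRight u (hKD hu) z (hKD hz) hzu
      refine hut.escape_of_forall (K := K) hu
        (fun x hx hxK => Finset.mem_erase.2 ⟨(Finset.mem_erase.1 hx).1, hxK⟩)
        (fun h => absurd ht (hKY t h)) ?_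
      intro p q _ hp hq hqK hpq
      rw [mem_nbs_singleton, mem_nbs_singleton]
      rcases hKexit p hp q (Finset.mem_of_mem_erase hq) hqK hpq with rfl | rfl
      exacts [.inl hpq, .inr hpq]
    · intro u hu
      obtain ⟨t, ht, hut⟩ := irr.toRight u (hKD hu) c hc (neK hcK u hu)
      refine hut.escape_of_forall (K := K) hu (fun z _ hz => hz)
        (fun h => absurd ht (hKY t h)) ?_
      intro p q _ hp hq hqK hpq
      have hq' := Finset.mem_erase.1 hq
      obtain rfl := (hKexit p hp q hq'.2 hqK hpq).resolve_right hq'.1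
      exact mem_nbs_singleton.2 hpq
    · intro u hu
      obtain ⟨t, ht, hut⟩ := irr.toRight u (hKD hu) a ha (neK haK u hu)
      refine hut.escape_of_forall (K := K) hu (fun z _ hz => hz)
        (fun h => absurd ht (hKY t h)) ?_
      intro p q _ hp hq hqK hpq
      have hq' := Finset.mem_erase.1 hq
      obtain rfl := (hKexit p hp q hq'.2 hqK hpq).resolve_left hq'.1
      exact mem_nbs_singleton.2 hpq
  have hlinkE : G.Linked E X (G.nbs {a}) := by
    refine ⟨?_, ?_, hEa⟩
    · intro u hu z hz hzu
      obtain ⟨t, ht, hut⟩ := irr.two u (hED hu) e he z (hED hz) (neE heE u hu) hzu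
      refine hut.escape_of_forall (K := E) hu
        (fun x hx hxK => Finset.mem_erase.2 ⟨(Finset.mem_erase.1 hx).1, hxK⟩)
        (fun h => .inl (ht.resolve_right (hEY t h))) ?_
      intro p q _ hp hq hqK hpq
      have hq' := Finset.mem_erase.1 (Finset.mem_of_mem_erase hq)
      obtain rfl := (hEexit p hp q hq'.2 hqK hpq).resolve_right hq'.1
      exact .inr (mem_nbs_singleton.2 hpq)
    · intro u hu
      obtain ⟨t, ht, hut⟩ := irr.two u (hED hu) a ha e he (neE haE u hu) (neE heE u hu)
      refine hut.escape_of_forall (K := E) hu (fun z _ hz => hz)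
        (fun h => ht.resolve_right (hEY t h)) ?_
      intro p q _ hp hq hqK hpq
      have hq' := Finset.mem_erase.1 hq
      have hq'' := Finset.mem_erase.1 hq'.2
      rcases hEexit p hp q hq''.2 hqK hpq with h | h
      exacts [absurd h hq''.1, absurd h hq'.1]
  -- The route is x through E to a (two lengths), a through K to c (k - 1 lengths), and a fixed walk
  -- from c to Y. In K the edges to x are given up, in E those to e.
  have h1 := ih K _ _ (k - 1) (lt K hKD haK) hK (mono_nbs_singleton hf a)
    (mono_nbs_singleton hf c) hlinkK (by
      intro _ u hu
      have h1 := hdeg u (hKD hu)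
      have h2 := degIn_le_of_exit₂ (G := G) (hKexit u hu)
      have h3 := ind_le_one X u
      have h4 := ind_of_notMem (hKY u hu)
      omega)
  have h2 := ih E X _ 2 (lt E hED haE) hE hX (mono_nbs_singleton hf a) hlinkE (by
      intro _ u hu
      have h1 := hdeg u (hED hu)
      have h2 := degIn_le_of_exit₂ (G := G) (hEexit u hu)
      have h3 := ind_le_one (G.nbs {e}) u
      have h4 := ind_of_notMem (hEY u hu)
      omega)
  set M := (D.erase a \ K) \ E with hM
  have hMm : ∀ u, u ∈ M ↔ u ∈ D ∧ u ≠ a ∧ u ∉ K ∧ u ∉ E := fun u => by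
    simp only [hM, Finset.mem_sdiff, Finset.mem_erase]
    tauto
  have hsuf : ∃ t ∈ Y, G.ConnIn M c t := by
    obtain ⟨u, hu⟩ := hK
    obtain ⟨t, ht, hut⟩ := irr.toRight u (hKD hu) a ha (neK haK u hu)
    obtain ⟨p, q, _, hp, hpq, hqt⟩ := hut.last_exit K hu fun h => hKY t h ht
    have hq := Finset.mem_sdiff.1 hqt.left_mem
    have hq' := Finset.mem_erase.1 hq.1
    obtain rfl := (hKexit p hp q hq'.2 hq.2 hpq).resolve_left hq'.1
    refine ⟨t, ht, ?_⟩
    -- Away from a and K, the set E is entered only from e. So if the walk from c to t visits E,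
    -- then c and t both reach e outside E.
    have toe : ∀ z, z ∉ E → ∀ s, G.ConnIn (D.erase a \ K) z s →
        G.ConnIn M z s ∨ G.ConnIn M z e := by
      intro z hz s hzs
      rcases hzs.escape M (Finset.mem_sdiff.2 ⟨hzs.left_mem, hz⟩) with h | ⟨x, y, h, hy, hyM, hxy⟩
      · exact .inl (h.mono Finset.inter_subset_right)
      · have hyE : y ∈ E := by
          by_contra hyE
          exact hyM (Finset.mem_sdiff.2 ⟨hy, hyE⟩)
        have h := h.mono Finset.inter_subset_right
        have hx := (hMm x).1 h.right_mem
        obtain rfl := (hEexit y hyE x hx.1 hx.2.2.2 hxy.symm).resolve_left hx.2.1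
        exact .inr h
    rcases toe q hcE t hqt with h | h
    · exact h
    rcases toe t (fun h => hEY t h ht) q hqt.symm with h' | h'
    exacts [h'.symm, h.trans h'.symm]
  obtain ⟨t, ht, hct⟩ := hsuf
  have h3 := h1.suffix hct ht (Finset.disjoint_left.2 fun u hu => ((hMm u).1 hu).2.2.1)
  refine (h2.glue h3 ?_ haE ?_ two_pos (by omega)).weaken ?_ (by omega)
  · rw [Finset.disjoint_union_right]
    exact ⟨Finset.disjoint_right.2 fun u hu => ((hMm u).1 hu).2.2.2, hEK⟩
  · rw [Finset.mem_union, not_or]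
    exact ⟨fun h => ((hMm a).1 h).2.1 rfl, haK⟩
  · exact Finset.insert_subset ha (Finset.union_subset hED (Finset.union_subset
      (fun u hu => ((hMm u).1 hu).1) hKD))

/-- A cut consisting of the root of `X` and two further vertices. -/
theorem Solvable.of_three_cut {D : Finset V} {X Y : Set V} {k : ℕ} (ih : Solvable G f D.card)
    (hf : ∀ u v, G.Adj u v → f u ≠ f v) (hX : Mono f X) (hY : Mono f Y)
    (irr : Irreducible G D X Y)
    (hdeg : ∀ v ∈ D, k + 1 ≤ G.degIn D v + ind X v + ind Y v) (hk : 3 ≤ k) {K : Finset V}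
    {a c b b' : V} (ha : a ∈ D) (hc : c ∈ D) (haK : a ∉ K) (hcK : c ∉ K) (hac : a ≠ c)
    (hKD : K ⊆ D) (hK : K.Nonempty)
    (hKexit : ∀ u ∈ K, ∀ w ∈ D, w ∉ K → G.Adj u w → w = a ∨ w = c)
    (hKY : ∀ u ∈ K, u ∉ Y) (hb : b ∈ D) (hb' : b' ∈ D) (hbb : b ≠ b') (hbK : b ∉ K)
    (hbK' : b' ∉ K) (hbc : b ≠ c) (hbc' : b' ≠ c) (hab : G.Adj a b) (hab' : G.Adj a b') :
    G.HasPathLengths D X Y k := by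
  have neK : ∀ {z : V}, z ∉ K → ∀ u ∈ K, z ≠ u := fun h u hu h' => h (h' ▸ hu)
  set Q := D \ insert c K with hQ
  have hQm : ∀ u, u ∈ Q ↔ u ∈ D ∧ u ≠ c ∧ u ∉ K := fun u => by simp [hQ]
  have haQ : a ∈ Q := (hQm a).2 ⟨ha, hac, haK⟩
  have hQK : ∀ u ∈ Q, u ≠ a → ∀ w ∈ K, ¬ G.Adj u w := by
    intro u hu hua w hw huw
    have hu := (hQm u).1 hu
    rcases hKexit w hw u hu.1 hu.2.2 huw.symm with h | h
    exacts [hua h, hu.2.1 h]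
  have hQD : Q ⊆ D := Finset.sdiff_subset
  have hcQ : c ∉ Q := fun h => ((hQm c).1 h).2.1 rfl
  obtain ⟨x₀, hx₀⟩ := hK
  have lt : ∀ S : Finset V, S ⊆ D → c ∉ S → S.card < D.card := fun S hS hcS =>
    Finset.card_lt_card ⟨hS, fun hsub => hcS (hsub hc)⟩
  have hPexit : ∀ Q' ⊆ Q, ∀ v, (∀ t ∈ G.compIn Q' v, ¬ G.Adj t c) → ∀ u ∈ G.compIn Q' v, u ≠ a →
      ∀ w ∈ D, w ∉ G.compIn Q' v → G.Adj u w → w ∈ Q \ Q' := by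
    intro Q' hQ' v hnc u hu hua w hw hwP huw
    have hwQ : w ∈ Q := (hQm w).2 ⟨hw, fun h => hnc u hu (h ▸ huw), fun h =>
      hQK u (hQ' (compIn_subset hu)) hua w h huw⟩
    exact Finset.mem_sdiff.2 ⟨hwQ, fun h => hwP (compIn_closed hu huw h)⟩
  by_cases hlink : G.Linked Q (G.nbs {c}) Y
  · have h1 : G.HasPathLengths Q (G.nbs {c}) Y 2 := by
      -- Only a can have neighbours in K, so only its degree in Q is uncontrolled; this is the
      -- purpose of the exceptional vertex. The two lengths here and k - 1 lengths through K from X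
      -- to c give k.
      refine twoSolvable hf D.card Q (G.nbs {c}) Y a (lt Q hQD hcQ)
        ⟨b, (hQm b).2 ⟨hb, hbc, hbK⟩, hab.ne'⟩ (mono_nbs_singleton hf c) hY hlink ?_
      intro u hu hua
      have h1 := hdeg u (hQD hu)
      have h2 := degIn_le_of_exit (G := G) (D := D) (K := Q) (a := c) (u := u) (by
        intro w hw hwQ huw
        by_contra hwc
        refine hwQ ((hQm w).2 ⟨hw, hwc, fun h => hQK u hu hua w h huw⟩))
      have h3 := ind_le_one X u
      omega
    have hlinkK : G.Linked K X (G.nbs {c}) := by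
      refine ⟨?_, ?_, ?_⟩
      · intro u hu z hz hzu
        obtain ⟨t, ht, hut⟩ := irr.two u (hKD hu) a ha z (hKD hz) (neK haK u hu) hzu
        refine hut.escape_of_forall (K := K) hu
          (fun x hx hxK => Finset.mem_erase.2 ⟨(Finset.mem_erase.1 hx).1, hxK⟩)
          (fun h => .inl (ht.resolve_right (hKY t h))) ?_
        intro p q _ hp hq hqK hpq
        have hq' := Finset.mem_erase.1 (Finset.mem_of_mem_erase hq)
        obtain rfl := (hKexit p hp q hq'.2 hqK hpq).resolve_left hq'.1
        exact .inr (mem_nbs_singleton.2 hpq)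
      · intro u hu
        obtain ⟨t, ht, hut⟩ := irr.two u (hKD hu) a ha c hc (neK haK u hu) (neK hcK u hu)
        refine hut.escape_of_forall (K := K) hu (fun z _ hz => hz)
          (fun h => ht.resolve_right (hKY t h)) ?_
        intro p q _ hp hq hqK hpq
        have hq' := Finset.mem_erase.1 hq
        have hq'' := Finset.mem_erase.1 hq'.2
        rcases hKexit p hp q hq''.2 hqK hpq with h | h
        exacts [absurd h hq''.1, absurd h hq'.1]
      · intro u hu
        obtain ⟨t, ht, hut⟩ := irr.toRight u (hKD hu) a ha (neK haK u hu)
        refine hut.escape_of_forall (K := K) hu (fun z _ hz => hz)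
          (fun h => absurd ht (hKY t h)) ?_
        intro p q _ hp hq hqK hpq
        have hq' := Finset.mem_erase.1 hq
        obtain rfl := (hKexit p hp q hq'.2 hqK hpq).resolve_left hq'.1
        exact mem_nbs_singleton.2 hpq
    have h2 := ih K X _ (k - 1) (lt K hKD hcK) ⟨x₀, hx₀⟩ hX (mono_nbs_singleton hf c) hlinkK (by
      intro _ u hu
      have h1 := hdeg u (hKD hu)
      have h2 := degIn_le_of_exit₂ (G := G) (hKexit u hu)
      have h3 := ind_le_one (G.nbs {a}) u
      have h4 := ind_of_notMem (hKY u hu)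
      omega)
    refine (h2.glue h1 ?_ hcK hcQ (by omega) two_pos).weaken ?_ (by omega)
    · exact Finset.disjoint_right.2 fun u hu => ((hQm u).1 hu).2.2
    · exact Finset.insert_subset hc (Finset.union_subset hKD hQD)
  · by_contra hno
    -- Each failure of linkage exhibits a further cut. A part behind a and e is handled by
    -- `of_two_cuts`, a part behind a and the roots by `of_cut_vertex`; the remaining cases leave a
    -- part separated from Y by one vertex, against `irr.toRight`.
    refine hlink ⟨?_, ?_, ?_⟩
    · intro v hv e he hev
      by_contra! hcon
      set P := G.compIn (Q.erase e) v with hP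
      have hPY : ∀ t ∈ P, t ∉ Y := fun t ht htY => hcon t (.inr htY) (mem_compIn.1 ht)
      have hPc : ∀ t ∈ P, ¬ G.Adj t c := fun t ht htc =>
        hcon t (.inl (mem_nbs_singleton.2 htc)) (mem_compIn.1 ht)
      have hPQ : P ⊆ Q := compIn_subset.trans (Finset.erase_subset _ _)
      have heP : e ∉ P := fun h => (Finset.mem_erase.1 (compIn_subset h)).1 rfl
      have hvP : v ∈ P := self_mem_compIn (Finset.mem_erase.2 ⟨hev.symm, hv⟩)
      have hexit : ∀ u ∈ P, u ≠ a → ∀ w ∈ D, w ∉ P → G.Adj u w → w = e := by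
        intro u hu hua w hw hwP huw
        have := Finset.mem_sdiff.1
          (hPexit (Q.erase e) (Finset.erase_subset _ _) v hPc u hu hua w hw hwP huw)
        by_contra hwe
        exact this.2 (Finset.mem_erase.2 ⟨hwe, this.1⟩)
      by_cases haP : a ∈ P
      · have hae : a ≠ e := fun h => heP (h ▸ haP)
        -- At most one of the two neighbours b, b' of a equals e; the other lies in P.
        have hbE : ∃ z ∈ P, z ≠ a := by
          have hmem : ∀ z ∈ D, z ≠ c → z ∉ K → G.Adj a z → z ≠ e → z ∈ P := fun z h1 h2 h3 h4 h5 =>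
            compIn_closed haP h4 (Finset.mem_erase.2 ⟨h5, (hQm z).2 ⟨h1, h2, h3⟩⟩)
          by_cases hbe : b = e
          · exact ⟨b', hmem b' hb' hbc' hbK' hab' fun h => hbb (hbe.trans h.symm), hab'.ne'⟩
          · exact ⟨b, hmem b hb hbc hbK hab hbe, hab.ne'⟩
        obtain ⟨z, hz, hza⟩ := hbE
        refine hno (ih.of_two_cuts hf hX irr hdeg hk ha hc (hQD he) haK hcK hac
          (Finset.notMem_erase a P) (fun h => hcQ (hPQ (Finset.mem_of_mem_erase h)))
          (fun h => heP (Finset.mem_of_mem_erase h)) hKD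
          ((Finset.erase_subset _ _).trans (hPQ.trans hQD)) ⟨x₀, hx₀⟩
          ⟨z, Finset.mem_erase.2 ⟨hza, hz⟩⟩ ?_ hKexit ?_ hKY
          (fun u hu => hPY u (Finset.mem_of_mem_erase hu)) ?_)
        · exact Finset.disjoint_left.2 fun u hu =>
            ((hQm u).1 (hPQ (Finset.mem_of_mem_erase hu))).2.2
        · intro u hu w hw hwP huw
          have hu' := Finset.mem_erase.1 hu
          by_cases hwa : w = a
          · exact .inl hwa
          · exact .inr (hexit u hu'.2 hu'.1 w hw
              (fun h => hwP (Finset.mem_erase.2 ⟨hwa, h⟩)) huw)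
        · intro u hu
          have hu' := Finset.mem_erase.1 hu
          refine (connIn_compIn hu'.2 haP).escape_of_forall (K := P.erase a) hu (fun z _ hz => hz)
            (fun h => absurd h (Finset.notMem_erase a P)) ?_
          intro p q _ hp hq hqK hpq
          have hqa : q = a := by
            by_contra hqa
            exact hqK (Finset.mem_erase.2 ⟨hqa, hq⟩)
          exact mem_nbs_singleton.2 (hqa ▸ hpq)
      · obtain ⟨t, ht, hvt⟩ := irr.toRight v (hQD hv) e (hQD he) hev
        rcases hvt.escape P hvP with h | ⟨p, q, h, hq, hqP, hpq⟩
        · exact hPY t (Finset.mem_inter.1 h.right_mem).2 ht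
        · have hp := (Finset.mem_inter.1 h.right_mem).2
          have hq' := Finset.mem_erase.1 hq
          exact hq'.1 (hexit p hp (fun h => haP (h ▸ hp)) q hq'.2 hqP hpq)
    · intro v hv
      by_contra! hcon
      set P := G.compIn Q v with hP
      have hPc : ∀ t ∈ P, ¬ G.Adj t c := fun t ht htc =>
        hcon t (mem_nbs_singleton.2 htc) (mem_compIn.1 ht)
      have hvP : v ∈ P := self_mem_compIn hv
      have hbE : ∃ z ∈ P, z ≠ a := by
        by_cases hva : v = a
        · exact ⟨b, compIn_closed (hva ▸ hvP) hab ((hQm b).2 ⟨hb, hbc, hbK⟩), hab.ne'⟩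
        · exact ⟨v, hvP, hva⟩
      obtain ⟨z, hz, hza⟩ := hbE
      refine hno (ih.of_cut_vertex hf hX hY irr hdeg hk (K := P.erase a) (v := c) ha
        (Finset.notMem_erase a P) ((Finset.erase_subset _ _).trans (compIn_subset.trans hQD))
        ⟨z, Finset.mem_erase.2 ⟨hza, hz⟩⟩ ?_ hc
        (fun h => hcQ (compIn_subset (Finset.mem_of_mem_erase h))) hac.symm)
      intro u hu w hw hwP huw
      have hu' := Finset.mem_erase.1 hu
      by_contra hwa
      have := hPexit Q subset_rfl v hPc u hu'.2 hu'.1 w hw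
        (fun h => hwP (Finset.mem_erase.2 ⟨hwa, h⟩)) huw
      rw [Finset.sdiff_self] at this
      exact Finset.notMem_empty _ this
    · intro v hv
      by_contra! hcon
      set P := G.compIn Q v with hP
      have hPY : ∀ t ∈ P, t ∉ Y := fun t ht htY => hcon t htY (mem_compIn.1 ht)
      have hvP : v ∈ P := self_mem_compIn hv
      have hv' := (hQm v).1 hv
      obtain ⟨t, ht, hvt⟩ := irr.toRight v hv'.1 c hc hv'.2.1.symm
      have hPout : ∀ p ∈ P, ∀ q ∈ D.erase c, q ∉ P → G.Adj p q → q ∈ K ∧ p = a := by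
        intro p hp q hq hqP hpq
        have hq' := Finset.mem_erase.1 hq
        have hqK : q ∈ K := by
          by_contra hqK
          exact hqP (compIn_closed hp hpq ((hQm q).2 ⟨hq'.2, hq'.1, hqK⟩))
        refine ⟨hqK, ?_⟩
        by_contra hpa
        exact hQK p (compIn_subset hp) hpa q hqK hpq
      rcases hvt.escape P hvP with h | ⟨p, q, h, hq, hqP, hpq⟩
      · exact hPY t (Finset.mem_inter.1 h.right_mem).2 ht
      · have hp := (Finset.mem_inter.1 h.right_mem).2
        obtain ⟨_, rfl⟩ := hPout p hp q hq hqP hpq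
        rcases hvt.escape (P ∪ K) (Finset.mem_union_left _ hvP) with
          h | ⟨r, s, h, hs, hsP, hrs⟩
        · rcases Finset.mem_union.1 (Finset.mem_inter.1 h.right_mem).2 with h | h
          exacts [hPY t h ht, hKY t h ht]
        · rw [Finset.mem_union, not_or] at hsP
          have hs' := Finset.mem_erase.1 hs
          rcases Finset.mem_union.1 (Finset.mem_inter.1 h.right_mem).2 with h | h
          · exact hsP.2 (hPout r h s hs hsP.1 hrs).1
          · rcases hKexit r h s hs'.2 hsP.2 hrs with rfl | h
            exacts [hsP.1 hp, hs'.1 h]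

end ThreeCut

end SimpleGraph

namespace SimpleGraph

/-! ### Maximum complete bipartite subgraphs at a root -/

section Core

open Classical

variable {V : Type*} {G : SimpleGraph V} {f : V → Bool}

/-- A complete bipartite graph with sides `A` plus the root of `X`, and `B`, with `A` maximum. -/
structure IsCore (G : SimpleGraph V) (D : Finset V) (X : Set V) (A B : Finset V) : Prop where
  subset : A ⊆ D
  mem_iff : ∀ b, b ∈ B ↔ b ∈ D ∧ b ∈ X ∧ ∀ a ∈ A, G.Adj a b
  card_lt : A.card + 1 ≤ B.card
  degIn_le : ∀ w ∈ D, w ∉ A → G.degIn B w ≤ A.card + 1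

/-- The empty set is a candidate for A because X meets D. For A of maximum size, a vertex with
`A.card` + 2 neighbours in B could be added to A. -/
theorem exists_isCore (D : Finset V) (X : Set V) (hX : ∃ x ∈ D, x ∈ X) :
    ∃ A B, IsCore G D X A B := by
  set N : Finset V → Finset V := fun A => D.filter fun b => b ∈ X ∧ ∀ a ∈ A, G.Adj a b with hN
  obtain ⟨A, hA, hmax⟩ := (D.powerset.filter fun A => A.card + 1 ≤ (N A).card).exists_max_image
    Finset.card ⟨∅, by
      obtain ⟨x, hx, hxX⟩ := hX
      simp only [Finset.mem_filter, Finset.empty_mem_powerset, Finset.card_empty, zero_add,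
        true_and, Nat.one_le_iff_ne_zero, ← Nat.pos_iff_ne_zero, Finset.card_pos]
      exact ⟨x, by simp [hN, hx, hxX]⟩⟩
  rw [Finset.mem_filter, Finset.mem_powerset] at hA
  refine ⟨A, N A, hA.1, fun b => by simp [hN], hA.2, ?_⟩
  intro w hw hwA
  by_contra! hlt
  have heq : N (insert w A) = (N A).filter (G.Adj w) := by
    ext b
    simp only [hN, Finset.mem_filter, Finset.forall_mem_insert]
    tauto
  have h := hmax (insert w A) (by
    rw [Finset.mem_filter, Finset.mem_powerset, heq, Finset.card_insert_of_notMem hwA]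
    exact ⟨Finset.insert_subset hw hA.1, hlt⟩)
  rw [Finset.card_insert_of_notMem hwA] at h
  omega

namespace IsCore

variable {D A B : Finset V} {X : Set V}

theorem adj (h : IsCore G D X A B) : ∀ a ∈ A, ∀ b ∈ B, G.Adj a b := fun a ha b hb =>
  ((h.mem_iff b).1 hb).2.2 a ha

theorem subset_right (h : IsCore G D X A B) : B ⊆ D := fun b hb => ((h.mem_iff b).1 hb).1

theorem mem_right (h : IsCore G D X A B) {b : V} (hb : b ∈ B) : b ∈ X := ((h.mem_iff b).1 hb).2.1

theorem disjoint (h : IsCore G D X A B) : Disjoint A B :=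
  Finset.disjoint_left.2 fun z hz hz' => G.irrefl (h.adj z hz z hz')

theorem nonempty_right (h : IsCore G D X A B) : B.Nonempty :=
  Finset.card_pos.1 (by have := h.card_lt; omega)

/-- A vertex of X adjacent to all of A would belong to B. -/
theorem degIn_lt (h : IsCore G D X A B) {w : V} (hw : w ∈ D) (hwX : w ∈ X) (hwB : w ∉ B) :
    G.degIn A w < A.card := by
  refine Finset.card_lt_card (Finset.filter_ssubset.2 ?_)
  by_contra! hcon
  exact hwB ((h.mem_iff w).2 ⟨hw, hwX, fun a ha => (hcon a ha).symm⟩)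

/-- A neighbour of B has the colour of A, opposite to X. So no vertex loses edges to B and also to A
or x. -/
theorem degIn_eq_zero_of_adj (hf : ∀ u v, G.Adj u v → f u ≠ f v) (hX : Mono f X)
    (h : IsCore G D X A B) {u : V} (hu : 0 < G.degIn B u) : G.degIn A u = 0 ∧ ind X u = 0 := by
  obtain ⟨b, hb, hub⟩ := degIn_pos.1 hu
  refine ⟨degIn_eq_zero fun a ha hua => ?_, ind_of_notMem fun hu =>
    hf _ _ hub (hX u hu b (h.mem_right hb))⟩
  have h1 := hf _ _ hub
  have h2 := hf _ _ hua
  have h3 := hf _ _ (h.adj a ha b hb)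
  revert h1 h2 h3
  cases f u <;> cases f a <;> cases f b <;> simp

theorem exists_pathIn (h : IsCore G D X A B) {A' B' : Finset V} (hA : A' ⊆ A) (hB : B' ⊆ B) {b : V}
    (hb : b ∈ B') {j : ℕ} (hjA : j ≤ A'.card) (hjB : j + 1 ≤ B'.card) :
    ∃ u ∈ X, G.PathIn (A' ∪ B') u b (0 + 2 * j) := by
  obtain ⟨b', hb', hp⟩ := exists_pathIn_of_complete
    (fun a ha b hb => h.adj a (hA ha) b (hB hb))
    (Finset.disjoint_of_subset_left hA (Finset.disjoint_of_subset_right hB h.disjoint))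
    j hjA hjB hb
  rw [Nat.zero_add]
  exact ⟨b', h.mem_right (hB hb'), hp⟩

end IsCore

theorem mem_or_mem_of_exit {D A B C : Finset V} {v u w : V} (hC : C = G.compIn (D \ (A ∪ B)) v)
    (hu : u ∈ C) (hw : w ∈ D) (hwC : w ∉ C) (ha : G.Adj u w) : w ∈ A ∨ w ∈ B := by
  subst hC
  by_contra! hcon
  exact hwC (compIn_closed hu ha (Finset.mem_sdiff.2 ⟨hw, fun h =>
    (Finset.mem_union.1 h).elim hcon.1 hcon.2⟩))

/-- If the root of `Y` is joined to a vertex outside the core, the paths exist. -/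
theorem Solvable.of_core_connIn {D : Finset V} {X Y : Set V} {k : ℕ} (ih : Solvable G f D.card)
    (hf : ∀ u v, G.Adj u v → f u ≠ f v) (hX : Mono f X) (hY : Mono f Y)
    (irr : Irreducible G D X Y)
    (hdeg : ∀ v ∈ D, k + 1 ≤ G.degIn D v + ind X v + ind Y v) (hk : 3 ≤ k) {A B : Finset V}
    (core : IsCore G D X A B) {t : V} (ht : t ∈ Y) (htD : t ∈ D) (htA : t ∉ A) (htB : t ∉ B) :
    G.HasPathLengths D X Y k := by
  set C := G.compIn (D \ (A ∪ B)) t with hC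
  have hCm : ∀ u ∈ C, u ∈ D ∧ u ∉ A ∧ u ∉ B := fun u hu => by
    have := Finset.mem_sdiff.1 (compIn_subset hu)
    rw [Finset.mem_union, not_or] at this
    exact this
  have hCD : C ⊆ D := fun u hu => (hCm u hu).1
  have htC : t ∈ C := self_mem_compIn (by simp [htD, htA, htB])
  have hexit : ∀ u ∈ C, ∀ w ∈ D, w ∉ C → G.Adj u w → w ∈ A ∨ w ∈ B := fun u hu w hw hwC ha =>
    mem_or_mem_of_exit hC hu hw hwC ha
  have hAC : Disjoint A C := Finset.disjoint_right.2 fun u hu => (hCm u hu).2.1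
  have hBC : Disjoint B C := Finset.disjoint_right.2 fun u hu => (hCm u hu).2.2
  obtain ⟨b, hb⟩ := core.nonempty_right
  have hbC : b ∉ C := fun h => (hCm b h).2.2 hb
  by_cases hlink : G.Linked C (G.nbs B) Y
  · have h1 := ih C (G.nbs B) Y (max 1 (k - A.card)) (Finset.card_lt_card ⟨hCD, fun hsub =>
      hbC (hsub (core.subset_right hb))⟩) ⟨t, htC⟩
      (mono_nbs hf fun u hu v hv => hX u (core.mem_right hu) v (core.mem_right hv)) hY hlink (by
        intro hk' u hu
        have h1 := hdeg u (hCD hu)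
        have h2 : G.degIn D u ≤ G.degIn C u + G.degIn (A ∪ B) u := degIn_le_add fun w hw ha => by
          by_cases hwC : w ∈ C
          · exact .inl hwC
          · exact .inr (Finset.mem_union.2 (hexit u hu w hw hwC ha))
        have h3 := degIn_union_le (G := G) A B u
        rcases Nat.eq_zero_or_pos (G.degIn B u) with h4 | h4
        · have h5 : G.degIn A u + ind X u ≤ A.card := by
            by_cases huX : u ∈ X
            · have := core.degIn_lt (hCD hu) huX (hCm u hu).2.2
              rw [ind_of_mem huX]
              omega
            · rw [ind_of_notMem huX]
              exact degIn_le_card A u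
          omega
        · have h5 := core.degIn_eq_zero_of_adj hf hX h4
          have h6 := core.degIn_le u (hCD hu) (hCm u hu).2.1
          have h7 : ind (G.nbs B) u = 1 := ind_of_mem (degIn_pos.1 h4)
          omega)
    have hcard := core.card_lt
    refine (h1.prefix (S := A ∪ B) (X := X) (r := A.card + 1) (α := 0)
      (fun s hs j hj => core.exists_pathIn subset_rfl subset_rfl hs (by omega) (by omega))
      (Finset.disjoint_union_left.2 ⟨hAC, hBC⟩) (by omega) (by omega)).weaken
      (Finset.union_subset (Finset.union_subset core.subset core.subset_right) hCD) (by omega)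
  · by_contra hno
    -- If linkage fails, a part is attached, besides the roots, to A and at most one vertex c. With
    -- two or more vertices in A this is a case for `bridge`; a single vertex of A gives a cut for
    -- `of_three_cut` or `of_cut_vertex`.
    refine hlink ⟨?_, ?_, fun u hu => ⟨t, ht, connIn_compIn hu htC⟩⟩
    · intro v hv c hc hcv
      by_contra! hcon
      set K := G.compIn (C.erase c) v with hK
      have hKC : K ⊆ C := compIn_subset.trans (Finset.erase_subset _ _)
      have hKY : ∀ u ∈ K, u ∉ Y := fun u hu huY => hcon u (.inr huY) (mem_compIn.1 hu)
      have hcK : c ∉ K := fun h => (Finset.mem_erase.1 (compIn_subset h)).1 rfl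
      have hvK : v ∈ K := self_mem_compIn (Finset.mem_erase.2 ⟨hcv.symm, hv⟩)
      have hKexit : ∀ u ∈ K, ∀ w ∈ D, w ∉ K → G.Adj u w → w ∈ A ∨ w = c := by
        intro u hu w hw hwK ha
        by_cases hwC : w ∈ C
        · exact .inr (eq_of_adj_compIn_erase hu hwK ha hwC)
        · refine .inl ((hexit u (hKC hu) w hw hwC ha).resolve_right fun hwB => ?_)
          exact hcon u (.inl ⟨w, hwB, ha⟩) (mem_compIn.1 hu)
      obtain ⟨p, q, _, hp, hpq, hqt⟩ := (connIn_compIn hv htC).last_exit K hvK fun h => hKY t h ht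
      have hq := Finset.mem_sdiff.1 hqt.left_mem
      obtain rfl := eq_of_adj_compIn_erase hp hq.2 hpq hq.1
      have hcA : q ∉ A := (hCm q hc).2.1
      have hcut : ∀ u ∈ K, ∃ s ∈ G.nbs A, G.ConnIn K u s := by
        intro u hu
        obtain ⟨s, hs, hus⟩ := irr.toRight u (hCD (hKC hu)) q (hCD hc) fun h => hcK (h ▸ hu)
        refine hus.escape_of_forall (K := K) hu (fun z _ hz => hz)
          (fun h => absurd hs (hKY s h)) ?_
        intro x y _ hx hy hyK hxy
        have hy' := Finset.mem_erase.1 hy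
        exact ⟨y, (hKexit x hx y hy'.2 hyK hxy).resolve_right hy'.1, hxy⟩
      obtain ⟨s, ⟨a, ha, _⟩, _⟩ := hcut v hvK
      by_cases hA1 : A.card = 1
      · obtain ⟨b₁, hb₁, b₂, hb₂, hbb⟩ := Finset.one_lt_card.1
          (show 1 < B.card by have := core.card_lt; omega)
        have ne : ∀ z ∈ B, z ≠ q ∧ z ∉ K := fun z hz =>
          ⟨fun h => (hCm q hc).2.2 (h ▸ hz), fun h => (hCm z (hKC h)).2.2 hz⟩
        obtain ⟨a', hA⟩ := Finset.card_eq_one.1 hA1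
        obtain rfl : a = a' := by simpa [hA] using ha
        refine hno (ih.of_three_cut hf hX hY irr hdeg hk (core.subset ha) (hCD hc)
          (fun h => (hCm a (hKC h)).2.1 ha) hcK (fun h => hcA (h ▸ ha)) (hKC.trans hCD) ⟨v, hvK⟩
          ?_ hKY (core.subset_right hb₁) (core.subset_right hb₂) hbb (ne b₁ hb₁).2 (ne b₂ hb₂).2
          (ne b₁ hb₁).1 (ne b₂ hb₂).1 (core.adj a ha b₁ hb₁) (core.adj a ha b₂ hb₂))
        intro u hu w hw hwK huw
        have := hKexit u hu w hw hwK huw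
        rwa [hA, Finset.mem_singleton] at this
      · have hA0 := Finset.card_pos.2 ⟨a, ha⟩
        have hKE : K ∪ C \ K ⊆ C := Finset.union_subset hKC Finset.sdiff_subset
        refine hno (ih.bridge hf irr hdeg (K := K) (A := A) (B := B) (E := C \ K)
          (T := G.nbs {q}) (hKC.trans hCD) core.subset core.subset_right
          (Finset.sdiff_subset.trans hCD) ⟨v, hvK⟩ ⟨a, ha⟩ (fun b hb => core.mem_right hb)
          (mono_nbs_singleton hf q) core.adj (by have := core.card_lt; omega)
          (Finset.disjoint_of_subset_right hKE hAC) (Finset.disjoint_of_subset_right hKE hBC)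
          ?_ (fun u hu huY => absurd huY (hKY u hu)) hcut ?_ ?_ ?_ ?_)
        · intro u hu w hw hwK huw
          refine (hKexit u hu w hw hwK huw).imp id ?_
          rintro rfl
          exact mem_nbs_singleton.2 huw
        · intro u hu
          refine (connIn_compIn (hKC hu) hc).escape_of_forall (K := K) hu (fun z _ hz => hz)
            (fun h => absurd h hcK) ?_
          intro x y _ hx hy hyK hxy
          obtain rfl := eq_of_adj_compIn_erase hx hyK hxy hy
          exact mem_nbs_singleton.2 hxy
        · intro u hu
          have h1 : G.degIn D u ≤ G.degIn (K ∪ A) u + G.degIn {q} u := degIn_le_add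
            fun w hw huw => by
              by_cases hwK : w ∈ K
              · exact .inl (Finset.mem_union_left _ hwK)
              · exact (hKexit u hu w hw hwK huw).imp (Finset.mem_union_right _)
                  Finset.mem_singleton.2
          have h2 := degIn_union_le (G := G) K A u
          rw [degIn_singleton] at h1
          rw [ind_of_notMem (hKY u hu)]
          omega
        · intro u hu huX
          exact ⟨by omega, core.degIn_lt (hCD (hKC hu)) huX (hCm u (hKC hu)).2.2⟩
        · intro k' h
          rw [Finset.union_comm]
          exact h.suffix hqt ht Finset.sdiff_disjoint
    · intro v hv
      by_contra! hcon
      have hCexit : ∀ u ∈ C, ∀ w ∈ D, w ∉ C → G.Adj u w → w ∈ A := by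
        intro u hu w hw hwC ha
        refine (hexit u hu w hw hwC ha).resolve_right fun hwB => ?_
        exact hcon u ⟨w, hwB, ha⟩ (connIn_compIn hv hu)
      have hcut : ∀ u ∈ C, ∃ s ∈ G.nbs A, G.ConnIn C u s := by
        intro u hu
        refine (irr.conn u (hCD hu) b (core.subset_right hb)).escape_of_forall (K := C) hu
          (fun z _ hz => hz) (fun h => absurd h hbC) ?_
        intro x y _ hx hy hyC hxy
        exact ⟨y, hCexit x hx y hy hyC hxy, hxy⟩
      obtain ⟨s, ⟨a, ha, _⟩, _⟩ := hcut v hv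
      have haC : a ∉ C := fun h => (hCm a h).2.1 ha
      by_cases hA1 : A.card = 1
      · obtain ⟨a', hA⟩ := Finset.card_eq_one.1 hA1
        obtain rfl : a = a' := by simpa [hA] using ha
        refine hno (ih.of_cut_vertex hf hX hY irr hdeg hk (core.subset ha) haC hCD ⟨v, hv⟩ ?_
          (core.subset_right hb) hbC (core.adj a ha b hb).ne')
        intro u hu w hw hwC huw
        have := hCexit u hu w hw hwC huw
        rwa [hA, Finset.mem_singleton] at this
      · have hA0 := Finset.card_pos.2 ⟨a, ha⟩
        refine hno (ih.bridge hf irr hdeg (K := C) (A := A) (B := B) (E := ∅) (T := Y) hCD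
          core.subset core.subset_right (Finset.empty_subset _) ⟨v, hv⟩ ⟨a, ha⟩
          (fun b hb => core.mem_right hb) hY core.adj (by have := core.card_lt; omega)
          (by rwa [Finset.union_empty]) (by rwa [Finset.union_empty])
          (fun u hu w hw hwK huw => .inl (hCexit u hu w hw hwK huw)) (fun _ _ h => h) hcut
          (fun u hu => ⟨t, ht, connIn_compIn hu htC⟩) ?_ ?_ ?_)
        · intro u hu
          have h1 : G.degIn D u ≤ G.degIn C u + G.degIn A u := degIn_le_add fun w hw huw => by
            by_cases hwC : w ∈ C
            · exact .inl hwC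
            · exact .inr (hCexit u hu w hw hwC huw)
          omega
        · intro u hu huX
          exact ⟨by omega, core.degIn_lt (hCD hu) huX (hCm u hu).2.2⟩
        · intro k' h
          rwa [Finset.union_empty]

end Core

end SimpleGraph

namespace SimpleGraph

/-! ### Roots with a common neighbourhood, and the path theorem -/

section PathLengths

open Classical

variable {V : Type*} {G : SimpleGraph V} {f : V → Bool}

/-- If Y met A, the colours would force Y ∩ D ⊆ A, hence B' ⊆ A and then B ⊆ A', so that |B'| ≤ |A|
< |B| ≤ |A'| < |B'|. -/
theorem IsCore.subset_of_isCore {D A B A' B' : Finset V} {X Y : Set V}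
    (hf : ∀ u v, G.Adj u v → f u ≠ f v) (hX : Mono f X) (hY : Mono f Y)
    (core : IsCore G D X A B) (core' : IsCore G D Y A' B')
    (hYA : ∀ t ∈ D, t ∈ Y → t ∈ A ∨ t ∈ B) (hXA : ∀ t ∈ D, t ∈ X → t ∈ A' ∨ t ∈ B') :
    ∀ t ∈ D, t ∈ Y → t ∈ B := by
  intro t htD htY
  by_contra htB
  have htA := (hYA t htD htY).resolve_right htB
  have hYA' : ∀ s ∈ D, s ∈ Y → s ∈ A := fun s hs hsY => by
    refine (hYA s hs hsY).resolve_right fun hsB => ?_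
    exact hf _ _ (core.adj t htA s hsB) (hY t htY s hsY)
  have hAX : ∀ a ∈ A, a ∉ X := fun a ha haX => by
    obtain ⟨b, hb⟩ := core.nonempty_right
    exact hf _ _ (core.adj a ha b hb) (hX a haX b (core.mem_right hb))
  have h1 : B' ⊆ A := fun b hb => hYA' b (core'.subset_right hb) (core'.mem_right hb)
  have h2 : B ⊆ A' := fun b hb => by
    refine (hXA b (core.subset_right hb) (core.mem_right hb)).resolve_right fun h => ?_
    exact hAX b (h1 h) (core.mem_right hb)
  have h3 := Finset.card_le_card h1
  have h4 := Finset.card_le_card h2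
  have h5 := core.card_lt
  have h6 := core'.card_lt
  omega

variable {D : Finset V} {X Y : Set V} {k : ℕ}

/-- `Solvable.bridge` for a core whose second side is the neighbourhood of both roots. -/
theorem Solvable.of_attached (ih : Solvable G f D.card)
    (hf : ∀ u v, G.Adj u v → f u ≠ f v) (irr : Irreducible G D X Y)
    (hdeg : ∀ v ∈ D, k + 1 ≤ G.degIn D v + ind X v + ind Y v) {A B : Finset V}
    (core : IsCore G D X A B) (hXB : ∀ t ∈ D, t ∈ X → t ∈ B) (hYB : ∀ t ∈ D, t ∈ Y ↔ t ∈ B)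
    {K A' E : Finset V} {v c b : V} (hv : v ∈ K) (hKD : K ⊆ D \ (A ∪ B)) (hA' : A' ⊆ A)
    (hAB : A'.card + 1 ≤ B.card) (hc : c ∈ D) (hcK : c ∉ K)
    (hb : b ∈ B) (hED : E ⊆ D) (hEA : Disjoint A' E) (hEK : Disjoint E K)
    (hEB : ∀ z ∈ E, z ∈ B → z = b) (hcb : G.ConnIn E c b)
    (hexit : ∀ u ∈ K, ∀ w ∈ D, w ∉ K → G.Adj u w → w ∈ A' ∨ w = c)
    (hright : ∀ u ∈ K, ∃ t ∈ G.nbs {c}, G.ConnIn K u t) :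
    G.HasPathLengths D X Y k := by
  have hKm : ∀ u ∈ K, u ∈ D ∧ u ∉ A ∧ u ∉ B := fun u hu => by
    have := Finset.mem_sdiff.1 (hKD hu)
    rwa [Finset.mem_union, not_or] at this
  have hK : K ⊆ D := fun u hu => (hKm u hu).1
  have hKY : ∀ u ∈ K, u ∉ Y := fun u hu h => (hKm u hu).2.2 ((hYB u (hK hu)).1 h)
  have hcut : ∀ u ∈ K, ∃ s ∈ G.nbs A', G.ConnIn K u s := by
    intro u hu
    obtain ⟨s, hs, hus⟩ := irr.toRight u (hK hu) c hc fun h => hcK (h ▸ hu)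
    refine hus.escape_of_forall (K := K) hu (fun z _ hz => hz)
      (fun h => absurd hs (hKY s h)) ?_
    intro x y _ hx hy hyK hxy
    have hy' := Finset.mem_erase.1 hy
    exact ⟨y, (hexit x hx y hy'.2 hyK hxy).resolve_right hy'.1, hxy⟩
  obtain ⟨s, ⟨a, ha, _⟩, _⟩ := hcut v hv
  -- The vertex b is withheld from the bipartite part: it lies in Y, and all paths end there after
  -- passing c and E.
  refine ih.bridge hf irr hdeg (K := K) (A := A') (B := B.erase b) (E := E) (T := G.nbs {c}) hK
    (hA'.trans core.subset) ((Finset.erase_subset _ _).trans core.subset_right) hED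
    ⟨v, hv⟩ ⟨a, ha⟩ (fun z hz => core.mem_right (Finset.mem_of_mem_erase hz))
    (mono_nbs_singleton hf c)
    (fun x hx y hy => core.adj x (hA' hx) y (Finset.mem_of_mem_erase hy))
    (by rw [Finset.card_erase_of_mem hb]; omega) ?_ ?_ ?_
    (fun u hu h => absurd h (hKY u hu)) hcut hright ?_ ?_ ?_
  · rw [Finset.disjoint_union_right]
    exact ⟨Finset.disjoint_right.2 fun u hu hu' => (hKm u hu).2.1 (hA' hu'), hEA⟩
  · rw [Finset.disjoint_union_right]
    refine ⟨Finset.disjoint_right.2 fun u hu hu' => (hKm u hu).2.2 (Finset.mem_of_mem_erase hu'),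
      Finset.disjoint_right.2 fun u hu hu' => ?_⟩
    have := Finset.mem_erase.1 hu'
    exact this.1 (hEB u hu this.2)
  · intro u hu w hw hwK huw
    refine (hexit u hu w hw hwK huw).imp id ?_
    rintro rfl
    exact mem_nbs_singleton.2 huw
  · intro u hu
    have h1 : G.degIn D u ≤ G.degIn (K ∪ A') u + G.degIn {c} u := degIn_le_add
      fun w hw huw => by
        by_cases hwK : w ∈ K
        · exact .inl (Finset.mem_union_left _ hwK)
        · exact (hexit u hu w hw hwK huw).imp (Finset.mem_union_right _)
            Finset.mem_singleton.2
    have h2 := degIn_union_le (G := G) K A' u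
    rw [degIn_singleton] at h1
    rw [ind_of_notMem (hKY u hu)]
    omega
  · intro u hu huX
    exact absurd (hXB u (hK hu) huX) (hKm u hu).2.2
  · intro k' h
    rw [Finset.union_comm]
    exact h.suffix hcb ((hYB b (core.subset_right hb)).2 hb) hEK

/-- The vertex c cuts off a part K of C without neighbours in B. So K is attached only to A and c,
and c reaches b through the rest of C and p. -/
theorem Solvable.of_sub_component (ih : Solvable G f D.card)
    (hf : ∀ u v, G.Adj u v → f u ≠ f v) (irr : Irreducible G D X Y)
    (hdeg : ∀ v ∈ D, k + 1 ≤ G.degIn D v + ind X v + ind Y v) {A B C : Finset V}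
    (core : IsCore G D X A B) (hXB : ∀ t ∈ D, t ∈ X → t ∈ B) (hYB : ∀ t ∈ D, t ∈ Y ↔ t ∈ B)
    {w v c b p : V} (hC : C = G.compIn (D \ (A ∪ B)) w) (hv : v ∈ C) (hc : c ∈ C) (hcv : c ≠ v)
    (hp : p ∈ C) (hb : b ∈ B) (hpb : G.Adj p b)
    (hno : ∀ u ∈ G.compIn (C.erase c) v, ∀ z ∈ B, ¬ G.Adj u z) :
    G.HasPathLengths D X Y k := by
  set K := G.compIn (C.erase c) v with hK
  have hKC : K ⊆ C := compIn_subset.trans (Finset.erase_subset _ _)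
  have hCW : C ⊆ D \ (A ∪ B) := hC ▸ compIn_subset
  have hCm : ∀ u ∈ C, u ∈ D ∧ u ∉ A ∧ u ∉ B := fun u hu => by
    have := Finset.mem_sdiff.1 (hCW hu)
    rwa [Finset.mem_union, not_or] at this
  have hcK : c ∉ K := fun h => (Finset.mem_erase.1 (compIn_subset h)).1 rfl
  have hvK : v ∈ K := self_mem_compIn (Finset.mem_erase.2 ⟨hcv.symm, hv⟩)
  have hconn : ∀ x ∈ C, ∀ y ∈ C, G.ConnIn C x y := by
    subst hC
    exact fun x hx y hy => connIn_compIn hx hy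
  obtain ⟨x, q, _, hx, hxq, hqp⟩ := (hconn v hv p hp).last_exit K hvK fun h => hno p h b hb hpb
  have hq := Finset.mem_sdiff.1 hqp.left_mem
  obtain rfl := eq_of_adj_compIn_erase hx hq.2 hxq hq.1
  refine ih.of_attached hf irr hdeg core hXB hYB (K := K) (A' := A) (E := insert b (C \ K)) hvK
    (hKC.trans hCW) subset_rfl core.card_lt (hCm q hc).1 hcK hb ?_ ?_ ?_ ?_
    ((hqp.mono (Finset.subset_insert _ _)).tail hpb (Finset.mem_insert_self _ _)) ?_ ?_
  · exact Finset.insert_subset (core.subset_right hb) fun u hu =>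
      (hCm u (Finset.mem_sdiff.1 hu).1).1
  · rw [Finset.disjoint_insert_right]
    exact ⟨fun h => Finset.disjoint_left.1 core.disjoint h hb,
      Finset.disjoint_right.2 fun u hu => (hCm u (Finset.mem_sdiff.1 hu).1).2.1⟩
  · rw [Finset.disjoint_insert_left]
    exact ⟨fun h => (hCm b (hKC h)).2.2 hb, Finset.sdiff_disjoint⟩
  · intro z hz hzB
    rcases Finset.mem_insert.1 hz with h | h
    exacts [h, absurd hzB (hCm z (Finset.mem_sdiff.1 h).1).2.2]
  · intro u hu y hy hyK huy
    by_cases hyC : y ∈ C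
    · exact .inr (eq_of_adj_compIn_erase hu hyK huy hyC)
    · exact .inl ((mem_or_mem_of_exit hC (hKC hu) hy hyC huy).resolve_right fun h =>
        hno u hu y h huy)
  · intro u hu
    refine (hconn u (hKC hu) q hc).escape_of_forall (K := K) hu (fun z _ hz => hz)
      (fun h => absurd h hcK) ?_
    intro y z _ hy hz hzK hyz
    obtain rfl := eq_of_adj_compIn_erase hy hzK hyz hz
    exact mem_nbs_singleton.2 hyz

theorem degIn_le_erase_add {B : Finset V} (b u : V) :
    G.degIn B u ≤ G.degIn (B.erase b) u + ind (G.nbs {b}) u := by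
  rw [← degIn_singleton]
  refine degIn_le_add fun w hw _ => ?_
  by_cases hwb : w = b
  · exact .inr (Finset.mem_singleton.2 hwb)
  · exact .inl (Finset.mem_erase.2 ⟨hwb, hw⟩)

/-- The paths use r lengths in the core without b, then cross C and end at b, which replaces y. By
`hdA` and `hdB`, contracting the rest of B costs a vertex of C at most r - 1 in degree, so C
supplies k + 1 - r lengths. -/
theorem Solvable.of_component (ih : Solvable G f D.card)
    (hf : ∀ u v, G.Adj u v → f u ≠ f v) (hX : Mono f X) (irr : Irreducible G D X Y)
    (hdeg : ∀ v ∈ D, k + 1 ≤ G.degIn D v + ind X v + ind Y v) {A B C : Finset V}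
    (core : IsCore G D X A B) (hXB : ∀ t ∈ D, t ∈ X → t ∈ B) (hYB : ∀ t ∈ D, t ∈ Y ↔ t ∈ B)
    {w b : V} {r : ℕ} (hC : C = G.compIn (D \ (A ∪ B)) w) (hw : w ∈ C) (hb : b ∈ B)
    (hwb : G.Adj w b) (hr : 0 < r) (hrA : r ≤ A.card + 1) (hrB : r + 1 ≤ B.card)
    (hdA : ∀ u ∈ C, G.degIn A u ≤ r - 1) (hdB : ∀ u ∈ C, G.degIn (B.erase b) u ≤ r) :
    G.HasPathLengths D X Y k := by
  have hCW : C ⊆ D \ (A ∪ B) := hC ▸ compIn_subset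
  have hCm : ∀ u ∈ C, u ∈ D ∧ u ∉ A ∧ u ∉ B := fun u hu => by
    have := Finset.mem_sdiff.1 (hCW hu)
    rwa [Finset.mem_union, not_or] at this
  have hCD : C ⊆ D := fun u hu => (hCm u hu).1
  have hconn : ∀ x ∈ C, ∀ y ∈ C, G.ConnIn C x y := by
    subst hC
    exact fun x hx y hy => connIn_compIn hx hy
  have hbC : b ∉ C := fun h => (hCm b h).2.2 hb
  have hbD := core.subset_right hb
  by_cases hlink : G.Linked C (G.nbs (B.erase b)) (G.nbs {b})
  · have h1 := ih C _ _ (max 1 (k + 1 - r)) (Finset.card_lt_card ⟨hCD, fun hsub =>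
      hbC (hsub hbD)⟩) ⟨w, hw⟩ (mono_nbs hf fun u hu v hv =>
        hX u (core.mem_right (Finset.mem_of_mem_erase hu)) v
          (core.mem_right (Finset.mem_of_mem_erase hv)))
      (mono_nbs_singleton hf b) hlink (by
        intro hk' u hu
        have h1 := hdeg u (hCD hu)
        have h2 : G.degIn D u ≤ G.degIn C u + G.degIn (A ∪ B) u := degIn_le_add fun w hw ha => by
          by_cases hwC : w ∈ C
          · exact .inl hwC
          · exact .inr (Finset.mem_union.2 (mem_or_mem_of_exit hC hu hw hwC ha))
        have h3 := degIn_union_le (G := G) A B u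
        have h4 := degIn_le_erase_add (G := G) (B := B) b u
        have h5 := ind_of_notMem fun h => (hCm u hu).2.2 (hXB u (hCD hu) h)
        have h6 := ind_of_notMem fun h => (hCm u hu).2.2 ((hYB u (hCD hu)).1 h)
        have h7 := hdA u hu
        have h8 := hdB u hu
        rcases Nat.eq_zero_or_pos (G.degIn B u) with h9 | h9
        · omega
        · have h10 := core.degIn_eq_zero_of_adj hf hX h9
          rcases Nat.eq_zero_or_pos (G.degIn (B.erase b) u) with h11 | h11
          · omega
          · have h12 : ind (G.nbs (B.erase b)) u = 1 := ind_of_mem (degIn_pos.1 h11)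
            omega)
    have h2 := h1.suffix (Y := Y) (.refl (Finset.mem_singleton_self b)) ((hYB b hbD).2 hb)
      (Finset.disjoint_singleton_left.2 hbC)
    have hcard := Finset.card_erase_of_mem hb
    refine (h2.prefix (S := A ∪ B.erase b) (X := X) (r := r) (α := 0)
      (fun s hs j hj => core.exists_pathIn subset_rfl (Finset.erase_subset _ _) hs (by omega)
        (by omega)) ?_ hr (by omega)).weaken ?_ (by omega)
    · rw [Finset.disjoint_left]
      intro z hz hz'
      rcases Finset.mem_union.1 hz' with h | h
      · rw [Finset.mem_singleton.1 h] at hz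
        rcases Finset.mem_union.1 hz with h | h
        exacts [Finset.disjoint_left.1 core.disjoint h hb, Finset.notMem_erase _ _ h]
      · rcases Finset.mem_union.1 hz with h' | h'
        exacts [(hCm z h).2.1 h', (hCm z h).2.2 (Finset.mem_of_mem_erase h')]
    · exact Finset.union_subset (Finset.union_subset core.subset
        ((Finset.erase_subset _ _).trans core.subset_right))
        (Finset.union_subset (Finset.singleton_subset_iff.2 hbD) hCD)
  · by_contra hno
    refine hlink ⟨?_, ?_, fun u hu => ⟨w, mem_nbs_singleton.2 hwb, hconn u hu w hw⟩⟩
    · intro v hv c hc hcv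
      by_contra! hcon
      refine hno (ih.of_sub_component hf irr hdeg core hXB hYB hC hv hc hcv hw hb hwb ?_)
      intro u hu z hz huz
      refine hcon u ?_ (mem_compIn.1 hu)
      by_cases hzb : z = b
      · exact .inr (mem_nbs_singleton.2 (hzb ▸ huz))
      · exact .inl ⟨z, Finset.mem_erase.2 ⟨hzb, hz⟩, huz⟩
    · intro v hv
      by_contra! hcon
      refine hno (ih.of_attached hf irr hdeg core hXB hYB (K := C) (A' := A) (E := {b}) hv hCW
        subset_rfl core.card_lt hbD hbC hb (Finset.singleton_subset_iff.2 hbD)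
        (Finset.disjoint_singleton_right.2 fun h => Finset.disjoint_left.1 core.disjoint h hb)
        (Finset.disjoint_singleton_left.2 hbC) (fun z hz _ => Finset.mem_singleton.1 hz)
        (.refl (Finset.mem_singleton_self b)) ?_
        fun u hu => ⟨w, mem_nbs_singleton.2 hwb, hconn u hu w hw⟩)
      intro u hu y hy hyC huy
      refine (mem_or_mem_of_exit hC hu hy hyC huy).imp id fun hyB => ?_
      by_contra hyb
      exact hcon u ⟨y, Finset.mem_erase.2 ⟨hyb, hyB⟩, huy⟩ (hconn v hv u hu)

/-- The case of a component that is not joined to the second side of the core. -/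
theorem Solvable.of_component_disjoint (ih : Solvable G f D.card)
    (hf : ∀ u v, G.Adj u v → f u ≠ f v) (irr : Irreducible G D X Y)
    (hdeg : ∀ v ∈ D, k + 1 ≤ G.degIn D v + ind X v + ind Y v) {A B C : Finset V}
    (core : IsCore G D X A B) (hXB : ∀ t ∈ D, t ∈ X → t ∈ B) (hYB : ∀ t ∈ D, t ∈ Y ↔ t ∈ B)
    {w : V} (hC : C = G.compIn (D \ (A ∪ B)) w) (hw : w ∈ C)
    (hno : ∀ u ∈ C, ∀ z ∈ B, ¬ G.Adj u z) : G.HasPathLengths D X Y k := by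
  have hCW : C ⊆ D \ (A ∪ B) := hC ▸ compIn_subset
  have hCm : ∀ u ∈ C, u ∈ D ∧ u ∉ A ∧ u ∉ B := fun u hu => by
    have := Finset.mem_sdiff.1 (hCW hu)
    rwa [Finset.mem_union, not_or] at this
  have hconn : ∀ x ∈ C, ∀ y ∈ C, G.ConnIn C x y := by
    subst hC
    exact fun x hx y hy => connIn_compIn hx hy
  obtain ⟨b, hb⟩ := core.nonempty_right
  have hbC : b ∉ C := fun h => (hCm b h).2.2 hb
  have hbD := core.subset_right hb
  have hexit : ∀ u ∈ C, ∀ y ∈ D, y ∉ C → G.Adj u y → y ∈ A := fun u hu y hy hyC huy =>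
    (mem_or_mem_of_exit hC hu hy hyC huy).resolve_right fun h => hno u hu y h huy
  obtain ⟨p, ⟨c, hcA, hpc⟩, _⟩ : ∃ p, (∃ c ∈ A, G.Adj p c) ∧ G.ConnIn C w p := by
    refine (irr.conn w (hCm w hw).1 b hbD).escape_of_forall (K := C) hw (fun z _ hz => hz)
      (fun h => absurd h hbC) ?_
    intro x y _ hx hy hyC hxy
    exact ⟨y, hexit x hx y hy hyC hxy, hxy⟩
  rename_i hwp
  have hcC : c ∉ C := fun h => (hCm c h).2.1 hcA
  have hcb := core.adj c hcA b hb
  -- A vertex c of A with a neighbour in C is taken out of A to serve as the link from C to b.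
  refine ih.of_attached hf irr hdeg core hXB hYB (K := C) (A' := A.erase c) (E := {c, b}) hw hCW
    (Finset.erase_subset _ _) ?_ (core.subset hcA) hcC hb ?_ ?_ ?_ ?_
    (.head (by simp) hcb (.refl (by simp))) ?_
    fun u hu => ⟨p, mem_nbs_singleton.2 hpc, hconn u hu p hwp.right_mem⟩
  · have := core.card_lt
    rw [Finset.card_erase_of_mem hcA]
    omega
  · exact Finset.insert_subset (core.subset hcA) (Finset.singleton_subset_iff.2 hbD)
  · rw [Finset.disjoint_insert_right, Finset.disjoint_singleton_right]
    exact ⟨Finset.notMem_erase _ _, fun h =>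
      Finset.disjoint_left.1 core.disjoint (Finset.mem_of_mem_erase h) hb⟩
  · rw [Finset.disjoint_insert_left, Finset.disjoint_singleton_left]
    exact ⟨hcC, hbC⟩
  · intro z hz hzB
    rcases Finset.mem_insert.1 hz with rfl | h
    exacts [absurd hzB (Finset.disjoint_left.1 core.disjoint hcA), Finset.mem_singleton.1 h]
  · intro u hu y hy hyC huy
    by_cases hyc : y = c
    · exact .inr hyc
    · exact .inl (Finset.mem_erase.2 ⟨hyc, hexit u hu y hy hyC huy⟩)

/-- For k ≤ |A| + 1 the core alone has the paths. Otherwise some b in B is set aside as the end of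
all paths. If |B| ≥ |A| + 2, the core without b still has |A| + 1 lengths. If |B| = |A| + 1 it has
only |A|, so vertices outside may lose one neighbour in A less: either a component outside the core
misses some a in A, or a itself is moved from the core to the outside. -/
theorem Solvable.of_common_neighbors (ih : Solvable G f D.card)
    (hf : ∀ u v, G.Adj u v → f u ≠ f v) (hX : Mono f X) (irr : Irreducible G D X Y)
    (hdeg : ∀ v ∈ D, k + 1 ≤ G.degIn D v + ind X v + ind Y v) {A B : Finset V}
    (core : IsCore G D X A B) (hXB : ∀ t ∈ D, t ∈ X → t ∈ B) (hYB : ∀ t ∈ D, t ∈ Y ↔ t ∈ B) :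
    G.HasPathLengths D X Y k := by
  have hcard := core.card_lt
  have hAd := core.disjoint
  by_cases hkA : k ≤ A.card + 1
  · obtain ⟨b, hb⟩ := core.nonempty_right
    refine ⟨0, fun i hi => ?_⟩
    obtain ⟨u, hu, hp⟩ := core.exists_pathIn subset_rfl subset_rfl hb
      (show i ≤ A.card by omega) (by omega)
    exact ⟨u, hu, b, (hYB b (core.subset_right hb)).2 hb,
      hp.mono (Finset.union_subset core.subset core.subset_right)⟩
  push Not at hkA
  have hW : ∀ b ∈ B, ∃ w ∈ D \ (A ∪ B), G.Adj b w := by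
    intro b hb
    refine degIn_pos.1 ?_
    have hbD := core.subset_right hb
    have h1 := hdeg b hbD
    have h2 := ind_le_one X b
    have h3 := ind_le_one Y b
    have h4 : G.degIn D b ≤ G.degIn (D \ (A ∪ B)) b + G.degIn A b := degIn_le_add
      fun w hw ha => by
        by_cases hwA : w ∈ A
        · exact .inr hwA
        · refine .inl (Finset.mem_sdiff.2 ⟨hw, fun h => ?_⟩)
          have hwB := (Finset.mem_union.1 h).resolve_left hwA
          exact hf _ _ ha (hX b (core.mem_right hb) w (core.mem_right hwB))
    have h5 := degIn_le_card (G := G) A b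
    omega
  -- A single vertex b in B would separate its neighbour w from Y.
  have hB2 : 2 ≤ B.card := by
    by_contra hB
    obtain ⟨b, hBb⟩ := Finset.card_eq_one.1 (show B.card = 1 by omega)
    have hb : b ∈ B := by simp [hBb]
    obtain ⟨w, hw, hbw⟩ := hW b hb
    obtain ⟨t, ht, hwt⟩ := irr.toRight w (Finset.mem_sdiff.1 hw).1 b (core.subset_right hb) hbw.ne
    have ht' := Finset.mem_erase.1 hwt.right_mem
    have := (hYB t ht'.2).1 ht
    rw [hBb, Finset.mem_singleton] at this
    exact ht'.1 this
  by_cases hBA : A.card + 2 ≤ B.card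
  · obtain ⟨b, hb⟩ := core.nonempty_right
    obtain ⟨w, hw, hbw⟩ := hW b hb
    refine ih.of_component hf hX irr hdeg core hXB hYB rfl (self_mem_compIn hw) hb hbw.symm
      (r := A.card + 1) (by omega) le_rfl (by omega) (fun u _ => degIn_le_card A u) ?_
    intro u hu
    have hu' := Finset.mem_sdiff.1 (compIn_subset hu)
    refine (degIn_mono fun w hw _ => Finset.mem_of_mem_erase hw).trans
      (core.degIn_le u hu'.1 fun h => hu'.2 (Finset.mem_union_left _ h))
  have hA0 : 0 < A.card := by omega
  by_cases hmiss : ∃ w ∈ D \ (A ∪ B), ∃ a ∈ A, ∀ u ∈ G.compIn (D \ (A ∪ B)) w, ¬ G.Adj u a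
  · obtain ⟨w, hw, a, ha, hwa⟩ := hmiss
    by_cases hB : ∀ u ∈ G.compIn (D \ (A ∪ B)) w, ∀ z ∈ B, ¬ G.Adj u z
    · exact ih.of_component_disjoint hf irr hdeg core hXB hYB rfl (self_mem_compIn hw) hB
    · push Not at hB
      obtain ⟨w', hw', b, hb, hwb⟩ := hB
      have hsub : ∀ u ∈ G.compIn (D \ (A ∪ B)) w', ¬ G.Adj u a := fun u hu =>
        hwa u (mem_compIn.2 ((mem_compIn.1 hw').trans (mem_compIn.1 hu)))
      refine ih.of_component hf hX irr hdeg core hXB hYB rfl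
        (self_mem_compIn (compIn_subset hw')) hb hwb (r := A.card) hA0 (by omega) (by omega) ?_ ?_
      · intro u hu
        rw [← Finset.card_erase_of_mem ha]
        refine (degIn_mono fun z hz huz => ?_).trans (degIn_le_card (A.erase a) u)
        exact Finset.mem_erase.2 ⟨fun h => hsub u hu (h ▸ huz), hz⟩
      · intro u _
        have := degIn_le_card (G := G) (B.erase b) u
        rw [Finset.card_erase_of_mem hb] at this
        omega
  push Not at hmiss
  by_cases hB : ∃ w ∈ D \ (A ∪ B), ∀ u ∈ G.compIn (D \ (A ∪ B)) w, ∀ z ∈ B, ¬ G.Adj u z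
  · obtain ⟨w, hw, hB⟩ := hB
    exact ih.of_component_disjoint hf irr hdeg core hXB hYB rfl (self_mem_compIn hw) hB
  push Not at hB
  obtain ⟨a, ha⟩ := Finset.card_pos.1 hA0
  obtain ⟨b, hb⟩ := core.nonempty_right
  obtain ⟨b₁, hb₁⟩ : (B.erase b).Nonempty := Finset.card_pos.1 (by
    rw [Finset.card_erase_of_mem hb]
    omega)
  have hbD := core.subset_right hb
  have hb₁B := Finset.mem_of_mem_erase hb₁
  set W := D \ (A ∪ B) with hWdef
  have hWm : ∀ u ∈ W, u ∈ D ∧ u ∉ A ∧ u ∉ B := fun u hu => by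
    have := Finset.mem_sdiff.1 hu
    rwa [Finset.mem_union, not_or] at this
  -- Every component of W has a neighbour of a, so Q is connected, and a is adjacent both to b and
  -- to the contracted rest of B.
  set Q := insert a W with hQ
  have hWQ : W ⊆ Q := Finset.subset_insert _ _
  have haQ : a ∈ Q := Finset.mem_insert_self _ _
  have hQm : ∀ u ∈ Q, u ∈ D ∧ u ∉ B ∧ u ∉ A.erase a := by
    intro u hu
    rcases Finset.mem_insert.1 hu with rfl | hu
    · exact ⟨core.subset ha, Finset.disjoint_left.1 hAd ha, Finset.notMem_erase _ _⟩
    · exact ⟨(hWm u hu).1, (hWm u hu).2.2, fun h => (hWm u hu).2.1 (Finset.mem_of_mem_erase h)⟩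
  have ha₁ : a ∈ G.nbs (B.erase b) := ⟨b₁, hb₁, core.adj a ha b₁ hb₁B⟩
  have ha₀ : a ∈ G.nbs {b} := mem_nbs_singleton.2 (core.adj a ha b hb)
  have hreach : ∀ u ∈ Q, G.ConnIn Q u a := by
    intro u hu
    rcases Finset.mem_insert.1 hu with rfl | hu
    · exact .refl haQ
    · obtain ⟨z, hz, hza⟩ := hmiss u hu a ha
      exact ((mem_compIn.1 hz).mono hWQ).tail hza haQ
  by_contra hno
  have hsplit : ∀ p, ∀ q ∈ B, G.Adj p q → p ∈ G.nbs (B.erase b) ∨ p ∈ G.nbs {b} := by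
    intro p q hq hpq
    by_cases hqb : q = b
    · exact .inr (mem_nbs_singleton.2 (hqb ▸ hpq))
    · exact .inl ⟨q, Finset.mem_erase.2 ⟨hqb, hq⟩, hpq⟩
  have hlink : G.Linked Q (G.nbs (B.erase b)) (G.nbs {b}) := by
    refine ⟨?_, fun u hu => ⟨a, ha₁, hreach u hu⟩, fun u hu => ⟨a, ha₀, hreach u hu⟩⟩
    intro v hv c hc hcv
    rcases Finset.mem_insert.1 hv with rfl | hvW
    · exact ⟨v, .inl ha₁, .refl (Finset.mem_erase.2 ⟨hcv.symm, hv⟩)⟩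
    obtain ⟨p, hp, z, hz, hpz⟩ := hB v hvW
    by_cases hcC : c ∈ G.compIn W v
    · by_contra! hcon
      refine hno (ih.of_sub_component hf irr hdeg core hXB hYB rfl (self_mem_compIn hvW) hcC hcv
        hp hz hpz ?_)
      intro u hu y hy huy
      exact hcon u (hsplit u y hy huy) ((mem_compIn.1 hu).mono
        (Finset.erase_subset_erase _ (compIn_subset.trans hWQ)))
    · refine ⟨p, hsplit p z hz hpz, (connIn_compIn (self_mem_compIn hvW) hp).mono ?_⟩
      intro y hy
      exact Finset.mem_erase.2 ⟨fun h => hcC (h ▸ hy), hWQ (compIn_subset hy)⟩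
  have hbQ : b ∉ Q := fun h => (hQm b h).2.1 hb
  have hQD : Q ⊆ D := fun u hu => (hQm u hu).1
  have hcardB := Finset.card_erase_of_mem hb
  have hcardA := Finset.card_erase_of_mem ha
  have h1 := ih Q _ _ (max 1 (k + 1 - A.card)) (Finset.card_lt_card ⟨hQD, fun hsub =>
    hbQ (hsub hbD)⟩) ⟨a, haQ⟩ (mono_nbs hf fun u hu v hv =>
      hX u (core.mem_right (Finset.mem_of_mem_erase hu)) v
        (core.mem_right (Finset.mem_of_mem_erase hv)))
    (mono_nbs_singleton hf b) hlink (by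
      intro hk' u hu
      have h1 := hdeg u (hQD hu)
      have h2 : G.degIn D u ≤ G.degIn Q u + G.degIn (A.erase a ∪ B) u := degIn_le_add
        fun w hw _ => by
          by_cases hwQ : w ∈ Q
          · exact .inl hwQ
          · right
            rw [hQ, Finset.mem_insert, not_or] at hwQ
            have : w ∈ A ∪ B := by
              by_contra h
              exact hwQ.2 (Finset.mem_sdiff.2 ⟨hw, h⟩)
            rcases Finset.mem_union.1 this with h | h
            · exact Finset.mem_union_left _ (Finset.mem_erase.2 ⟨hwQ.1, h⟩)
            · exact Finset.mem_union_right _ h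
      have h3 := degIn_union_le (G := G) (A.erase a) B u
      have h4 := degIn_le_erase_add (G := G) (B := B) b u
      have h5 := ind_of_notMem fun h => (hQm u hu).2.1 (hXB u (hQD hu) h)
      have h6 := ind_of_notMem fun h => (hQm u hu).2.1 ((hYB u (hQD hu)).1 h)
      have h7 := degIn_le_card (G := G) (A.erase a) u
      have h8 := degIn_le_card (G := G) (B.erase b) u
      rcases Nat.eq_zero_or_pos (G.degIn B u) with h9 | h9
      · omega
      · have h10 := core.degIn_eq_zero_of_adj hf hX h9
        have h13 : G.degIn (A.erase a) u ≤ G.degIn A u :=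
          degIn_mono fun w hw _ => Finset.mem_of_mem_erase hw
        rcases Nat.eq_zero_or_pos (G.degIn (B.erase b) u) with h11 | h11
        · omega
        · have h12 : ind (G.nbs (B.erase b)) u = 1 := ind_of_mem (degIn_pos.1 h11)
          omega)
  have h2 := h1.suffix (Y := Y) (.refl (Finset.mem_singleton_self b)) ((hYB b hbD).2 hb)
    (Finset.disjoint_singleton_left.2 hbQ)
  refine hno ((h2.prefix (S := A.erase a ∪ B.erase b) (X := X) (r := A.card) (α := 0)
    (fun s hs j hj => core.exists_pathIn (Finset.erase_subset _ _) (Finset.erase_subset _ _) hs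
      (by omega) (by omega)) ?_ hA0 (by omega)).weaken ?_ (by omega))
  · rw [Finset.disjoint_left]
    intro z hz hz'
    rcases Finset.mem_union.1 hz' with h | h
    · rw [Finset.mem_singleton.1 h] at hz
      rcases Finset.mem_union.1 hz with h | h
      exacts [Finset.disjoint_left.1 hAd (Finset.mem_of_mem_erase h) hb,
        Finset.notMem_erase _ _ h]
    · rcases Finset.mem_union.1 hz with h' | h'
      exacts [(hQm z h).2.2 h', (hQm z h).2.1 (Finset.mem_of_mem_erase h')]
  · exact Finset.union_subset (Finset.union_subset
      ((Finset.erase_subset _ _).trans core.subset)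
      ((Finset.erase_subset _ _).trans core.subset_right))
      (Finset.union_subset (Finset.singleton_subset_iff.2 hbD) hQD)

theorem solvable (hf : ∀ u v, G.Adj u v → f u ≠ f v) (n : ℕ) : Solvable G f n := by
  induction n with
  | zero => exact fun D X Y k hD => absurd hD (Nat.not_lt_zero _)
  | succ n ih =>
    intro D X Y k hD hDne hX hY h hdeg
    have ih' : Solvable G f D.card := fun D' X' Y' k' hD' => ih D' X' Y' k' (by omega)
    obtain ⟨v, hv⟩ := hDne
    obtain ⟨x, hx, hvx⟩ := h.left v hv
    obtain ⟨y, hy, hxy⟩ := h.right x hvx.right_mem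
    rcases Nat.lt_or_ge 1 k with hk | hk
    swap
    · exact .of_connIn hx hy hxy hk
    have hdeg := hdeg hk
    rcases Nat.lt_or_ge 2 k with hk' | hk'
    swap
    · obtain rfl : k = 2 := by omega
      by_cases hz : ∃ u ∈ D, u ≠ v
      · exact twoSolvable hf (n + 1) D X Y v hD hz hX hY h fun u hu _ => hdeg u hu
      · push Not at hz
        have h0 : G.degIn D v = 0 := degIn_eq_zero fun w hw ha => ha.ne' (hz w hw)
        have h1 := hdeg v hv
        have h2 := ind_le_one X v
        have h3 := ind_le_one Y v
        omega
    by_contra hno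
    have irr := ih'.irreducible hf hX hY h hdeg hno
    have hdeg' : ∀ v ∈ D, k + 1 ≤ G.degIn D v + ind Y v + ind X v := fun v hv => by
      have := hdeg v hv
      omega
    obtain ⟨A, B, core⟩ := exists_isCore (G := G) D X ⟨x, hvx.right_mem, hx⟩
    obtain ⟨A', B', core'⟩ := exists_isCore (G := G) D Y ⟨y, hxy.right_mem, hy⟩
    have h1 : ∀ t ∈ D, t ∈ Y → t ∈ A ∨ t ∈ B := by
      intro t htD htY
      by_contra! hcon
      exact hno (ih'.of_core_connIn hf hX hY irr hdeg hk' core htY htD hcon.1 hcon.2)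
    have h2 : ∀ t ∈ D, t ∈ X → t ∈ A' ∨ t ∈ B' := by
      intro t htD htX
      by_contra! hcon
      exact hno (ih'.of_core_connIn hf hY hX irr.symm hdeg' hk' core' htX htD hcon.1 hcon.2).symm
    have h3 := core.subset_of_isCore hf hX hY core' h1 h2
    have h4 := core'.subset_of_isCore hf hY hX core h2 h1
    have h5 : ∀ t ∈ D, t ∈ X → t ∈ B := fun t ht htX => h3 t ht (core'.mem_right (h4 t ht htX))
    exact hno (ih'.of_common_neighbors hf hX irr hdeg core h5 fun t ht =>
      ⟨h3 t ht, fun htB => core'.mem_right (h4 t ht (core.mem_right htB))⟩)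

end PathLengths

end SimpleGraph

namespace SimpleGraph

/-! ### Maximum cuts -/

section MaxCut

open Classical

variable {V : Type*} {G : SimpleGraph V} {f : V → Bool}

/-- The pairs of adjacent vertices that leave `S` and satisfy `P`. -/
noncomputable def exits [Fintype V] (G : SimpleGraph V) (S : Finset V) (P : V → V → Prop) :
    Finset (V × V) :=
  Finset.univ.filter fun p => p.1 ∈ S ∧ p.2 ∉ S ∧ G.Adj p.1 p.2 ∧ P p.1 p.2

theorem mem_exits [Fintype V] {S : Finset V} {P : V → V → Prop} {u v : V} :
    (u, v) ∈ G.exits S P ↔ u ∈ S ∧ v ∉ S ∧ G.Adj u v ∧ P u v := by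
  simp [exits]

/-- Crossing pairs are ordered: they are the exits of S and their reversals. -/
theorem card_crossing [Fintype V] (S : Finset V) {P : V → V → Prop} (hP : ∀ u v, P u v → P v u) :
    (Finset.univ.filter fun p : V × V =>
      ¬ (p.1 ∈ S ↔ p.2 ∈ S) ∧ G.Adj p.1 p.2 ∧ P p.1 p.2).card = 2 * (G.exits S P).card := by
  have hd : Disjoint (G.exits S P) ((G.exits S P).map (Equiv.prodComm V V).toEmbedding) := by
    rw [Finset.disjoint_left]
    rintro ⟨u, v⟩ h h'
    simp only [exits, Finset.mem_map_equiv, Finset.mem_filter, Finset.mem_univ, true_and,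
      Equiv.prodComm_symm, Equiv.prodComm_apply, Prod.swap] at h h'
    exact h'.2.1 h.1
  rw [two_mul]
  nth_rewrite 3 [← Finset.card_map (Equiv.prodComm V V).toEmbedding]
  rw [← Finset.card_union_of_disjoint hd]
  congr 1
  ext ⟨u, v⟩
  simp only [exits, Finset.mem_union, Finset.mem_map_equiv, Finset.mem_filter, Finset.mem_univ,
    true_and, Equiv.prodComm_symm, Equiv.prodComm_apply, Prod.swap, G.adj_comm v u]
  have := hP u v
  have := hP v u
  tauto

/-- A colouring of maximum cut: no vertex set has more monochromatic than bichromatic exits. -/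
theorem exists_max_cut [Fintype V] (G : SimpleGraph V) : ∃ f : V → Bool, ∀ S : Finset V,
    (G.exits S fun u v => f u = f v).card ≤ (G.exits S fun u v => f u ≠ f v).card := by
  obtain ⟨f, hf⟩ := Finite.exists_max fun f : V → Bool =>
    (Finset.univ.filter fun p : V × V => G.Adj p.1 p.2 ∧ f p.1 ≠ f p.2).card
  refine ⟨f, fun S => ?_⟩
  -- Flipping the colours on S exchanges monochromatic and bichromatic crossing pairs and changes
  -- nothing else, and the cut does not grow.
  obtain ⟨g, hg⟩ : ∃ g : V → Bool, ∀ v, g v = if v ∈ S then !f v else f v := ⟨_, fun _ => rfl⟩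
  have h := hf g
  have split : ∀ g : V → Bool,
      (Finset.univ.filter fun p : V × V => G.Adj p.1 p.2 ∧ g p.1 ≠ g p.2).card =
      (Finset.univ.filter fun p : V × V =>
        ¬ (p.1 ∈ S ↔ p.2 ∈ S) ∧ G.Adj p.1 p.2 ∧ g p.1 ≠ g p.2).card +
      (Finset.univ.filter fun p : V × V =>
        (p.1 ∈ S ↔ p.2 ∈ S) ∧ G.Adj p.1 p.2 ∧ g p.1 ≠ g p.2).card := by
    intro g
    rw [← Finset.card_union_of_disjoint]
    · congr 1
      ext p
      simp only [Finset.mem_union, Finset.mem_filter, Finset.mem_univ, true_and]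
      tauto
    · rw [Finset.disjoint_left]
      intro p h h'
      rw [Finset.mem_filter] at h h'
      exact h.2.1 h'.2.1
  rw [split g, split f] at h
  have h1 : (Finset.univ.filter fun p : V × V => ¬ (p.1 ∈ S ↔ p.2 ∈ S) ∧ G.Adj p.1 p.2 ∧
      g p.1 ≠ g p.2) =
      Finset.univ.filter fun p : V × V =>
        ¬ (p.1 ∈ S ↔ p.2 ∈ S) ∧ G.Adj p.1 p.2 ∧ f p.1 = f p.2 := by
    ext p
    simp only [Finset.mem_filter, Finset.mem_univ, true_and]
    by_cases hp : p.1 ∈ S <;> by_cases hq : p.2 ∈ S <;> simp [hg, hp, hq]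
  have h2 : (Finset.univ.filter fun p : V × V => (p.1 ∈ S ↔ p.2 ∈ S) ∧ G.Adj p.1 p.2 ∧
      g p.1 ≠ g p.2) =
      Finset.univ.filter fun p : V × V =>
        (p.1 ∈ S ↔ p.2 ∈ S) ∧ G.Adj p.1 p.2 ∧ f p.1 ≠ f p.2 := by
    ext p
    simp only [Finset.mem_filter, Finset.mem_univ, true_and]
    by_cases hp : p.1 ∈ S <;> by_cases hq : p.2 ∈ S <;> simp [hg, hp, hq]
  rw [h1, h2] at h
  have h3 := card_crossing (G := G) S (P := fun u v => f u = f v) fun _ _ h => h.symm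
  have h4 := card_crossing (G := G) S (P := fun u v => f u ≠ f v) fun _ _ h => h.symm
  have h5 := h3.symm.trans_le ((le_of_eq (by congr)).trans
    ((Nat.le_of_add_le_add_right h).trans_eq ((by congr : _ = _).trans h4)))
  omega

/-- The bichromatic edges of `G`. -/
def bichromatic (G : SimpleGraph V) (f : V → Bool) : SimpleGraph V where
  Adj u v := G.Adj u v ∧ f u ≠ f v
  symm := ⟨fun _ _ h => ⟨h.1.symm, h.2.symm⟩⟩
  loopless := ⟨fun _ h => h.2 rfl⟩

theorem card_exits_singleton [Fintype V] (v : V) (P : V → V → Prop) :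
    (G.exits {v} P).card = (Finset.univ.filter fun w => G.Adj v w ∧ P v w).card := by
  symm
  refine Finset.card_bij (fun w _ => (v, w)) ?_ ?_ ?_
  · intro w hw
    simp only [Finset.mem_filter, Finset.mem_univ, true_and] at hw
    simp [exits, hw, hw.1.ne']
  · intro a _ b _ h
    exact (Prod.ext_iff.1 h).2
  · rintro ⟨a, b⟩ h
    simp only [exits, Finset.mem_filter, Finset.mem_univ, true_and, Finset.mem_singleton] at h
    obtain ⟨rfl, _, h⟩ := h
    exact ⟨b, by simpa using h, rfl⟩

/-- The cut inequality for S = {v}. -/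
theorem degree_le_two_mul_degIn_bichromatic [Fintype V]
    (hf : ∀ S : Finset V,
      (G.exits S fun u v => f u = f v).card ≤ (G.exits S fun u v => f u ≠ f v).card) (v : V) :
    G.degIn Finset.univ v ≤ 2 * (G.bichromatic f).degIn Finset.univ v := by
  have h := hf {v}
  have h1 : G.degIn Finset.univ v ≤
      (G.exits {v} fun u v => f u = f v).card + (G.exits {v} fun u v => f u ≠ f v).card := by
    rw [card_exits_singleton, card_exits_singleton]
    refine (Finset.card_le_card fun w hw => ?_).trans (Finset.card_union_le _ _)
    simp only [Finset.mem_union, Finset.mem_filter, Finset.mem_univ, true_and] at hw ⊢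
    tauto
  have h2 : (G.bichromatic f).degIn Finset.univ v =
      (G.exits {v} fun u v => f u ≠ f v).card := by
    rw [card_exits_singleton]
    unfold degIn
    congr
  omega

/-- The cut inequality for S a component of the bichromatic graph: there are no bichromatic exits,
hence none at all. -/
theorem connIn_bichromatic [Fintype V]
    (hf : ∀ S : Finset V,
      (G.exits S fun u v => f u = f v).card ≤ (G.exits S fun u v => f u ≠ f v).card)
    (hG : G.Preconnected) (u v : V) : (G.bichromatic f).ConnIn Finset.univ u v := by
  set K := (G.bichromatic f).compIn Finset.univ u with hK
  have hno : ∀ a b, a ∈ K → G.Adj a b → b ∈ K := by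
    intro a b ha hab
    by_contra hb
    have h0 : (G.exits K fun u v => f u ≠ f v) = ∅ := by
      refine Finset.eq_empty_of_forall_notMem ?_
      rintro ⟨x, y⟩ h
      obtain ⟨hx, hy, hxy, hne⟩ := mem_exits.1 h
      exact hy (compIn_closed hx ⟨hxy, hne⟩ (Finset.mem_univ _))
    have h1 := hf K
    rw [h0, Finset.card_empty, Nat.le_zero, Finset.card_eq_zero] at h1
    refine Finset.eq_empty_iff_forall_notMem.1 h1 (a, b)
      (mem_exits.2 ⟨ha, hb, hab, ?_⟩)
    by_contra hne
    exact hb (compIn_closed ha ⟨hab, hne⟩ (Finset.mem_univ _))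
  obtain ⟨p⟩ := hG u v
  have hp : ∀ {a b : V} (_ : G.Walk a b), a ∈ K → b ∈ K := by
    intro a b p
    induction p with
    | nil => exact id
    | cons h _ ih => exact fun ha => ih (hno _ _ ha h)
  exact mem_compIn.1 (hp p (self_mem_compIn (Finset.mem_univ _)))

end MaxCut

/-! ### From paths in a minimum pendant set to cycles -/

section Pendant

open Classical

variable {V : Type*} {G H : SimpleGraph V} {f : V → Bool}

theorem PathIn.mono_graph {S : Finset V} {u v : V} {n : ℕ} (h : H.PathIn S u v n) (hHG : H ≤ G) :
    G.PathIn S u v n := by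
  induction h with
  | single hu => exact .single hu
  | cons hu ha _ ih => exact .cons hu (hHG ha) ih

theorem PathIn.even_iff (hf : ∀ u v, H.Adj u v → f u ≠ f v) {S : Finset V} {u v : V} {n : ℕ}
    (h : H.PathIn S u v n) : Even n ↔ f u = f v := by
  induction h with
  | single => simp
  | @cons S u w v n _ ha _ ih =>
    have := hf _ _ ha
    rw [Nat.even_add_one, ih]
    revert this
    cases f u <;> cases f w <;> cases f v <;> simp

theorem PathIn.hasCycleOfLength {S : Finset V} {u v : V} {n : ℕ} (h : G.PathIn S u v n)
    (hn : 2 ≤ n) (hvu : G.Adj v u) : G.HasCycleOfLength (n + 1) := by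
  obtain ⟨p, hp, -, hl⟩ := h.exists_isPath
  refine ⟨v, .cons hvu p, ?_, by simp [hl]⟩
  rw [Walk.cons_isCycle_iff]
  refine ⟨hp, fun hmem => ?_⟩
  cases p with
  | nil => exact hvu.ne rfl
  | @cons _ w _ ha q =>
    rw [Walk.cons_isPath_iff] at hp
    rw [Walk.edges_cons, List.mem_cons] at hmem
    rcases hmem with h | h
    · have hvw : v = w := by
        rcases Sym2.eq_iff.1 h with ⟨h1, _⟩ | ⟨h1, _⟩
        · exact absurd h1 hvu.ne
        · exact h1
      subst hvw
      rw [Walk.isPath_iff_nil] at hp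
      rw [Walk.length_cons, Walk.length_eq_zero_iff.2 hp.1] at hl
      omega
    · exact hp.2 (Walk.snd_mem_support_of_mem_edges q h)

/-- All edges leaving the nonempty set `D` end in `r`. -/
structure Pendant (H : SimpleGraph V) (D : Finset V) (r : V) : Prop where
  nonempty : D.Nonempty
  notMem : r ∉ D
  closed : ∀ u ∈ D, ∀ w, H.Adj u w → w ∈ D ∨ w = r

/-- A pendant set of minimum size. -/
def MinPendant (H : SimpleGraph V) (D : Finset V) (r : V) : Prop :=
  H.Pendant D r ∧ ∀ D' r', H.Pendant D' r' → D.card ≤ D'.card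

theorem Pendant.exists_minPendant {D : Finset V} {r : V} (h : H.Pendant D r) :
    ∃ D' r', H.MinPendant D' r' := by
  have hex : ∃ n D' r', H.Pendant D' r' ∧ D'.card = n := ⟨_, D, r, h, rfl⟩
  obtain ⟨D', r', h', hc⟩ := Nat.find_spec hex
  refine ⟨D', r', h', fun D'' r'' h'' => ?_⟩
  rw [hc]
  exact Nat.find_min' hex ⟨D'', r'', h'', rfl⟩

/-- Otherwise the component of v in D - c would be a smaller pendant set, with root c. -/
theorem MinPendant.reach_root {D : Finset V} {r c v : V} (h : H.MinPendant D r) (hc : c ∈ D)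
    (hv : v ∈ D) (hvc : v ≠ c) : ∃ t ∈ H.nbs {r}, H.ConnIn (D.erase c) v t := by
  by_contra! hcon
  have hK : H.Pendant (H.compIn (D.erase c) v) c := by
    refine ⟨⟨v, self_mem_compIn (Finset.mem_erase.2 ⟨hvc, hv⟩)⟩,
      fun hc' => Finset.notMem_erase c D (compIn_subset hc'), fun u hu w ha => ?_⟩
    rcases h.1.closed u (Finset.mem_of_mem_erase (compIn_subset hu)) w ha with hw | rfl
    · by_contra! hno
      exact hno.2 (eq_of_adj_compIn_erase hu hno.1 ha hw)
    · exact absurd (mem_compIn.1 hu) (hcon u (mem_nbs_singleton.2 ha))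
  exact absurd (h.2 _ _ hK) (not_le.2 (card_compIn_erase_lt hc v))

/-- Otherwise the component of v in D - p would be a smaller pendant set, with the same root r. -/
theorem MinPendant.reach_vertex {D : Finset V} {r p v : V} (h : H.MinPendant D r) (hp : p ∈ D)
    (hv : v ∈ D) (hvp : v ≠ p) : ∃ t ∈ H.nbs {p}, H.ConnIn (D.erase p) v t := by
  by_contra! hcon
  have hK : H.Pendant (H.compIn (D.erase p) v) r := by
    refine ⟨⟨v, self_mem_compIn (Finset.mem_erase.2 ⟨hvp, hv⟩)⟩,
      fun hr => h.1.notMem (Finset.mem_of_mem_erase (compIn_subset hr)), fun u hu w ha => ?_⟩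
    rcases h.1.closed u (Finset.mem_of_mem_erase (compIn_subset hu)) w ha with hw | rfl
    · by_contra! hno
      obtain rfl := eq_of_adj_compIn_erase hu hno.1 ha hw
      exact hcon u (mem_nbs_singleton.2 ha) (mem_compIn.1 hu)
    · exact .inr rfl
  exact absurd (h.2 _ _ hK) (not_le.2 (card_compIn_erase_lt hp v))

theorem MinPendant.linked {D : Finset V} {r p : V} (h : H.MinPendant D r) (hp : p ∈ D) :
    H.Linked (D.erase p) (H.nbs {p}) (H.nbs {r}) where
  left v hv := h.reach_vertex hp (Finset.mem_of_mem_erase hv) (Finset.ne_of_mem_erase hv)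
  right v hv := h.reach_root hp (Finset.mem_of_mem_erase hv) (Finset.ne_of_mem_erase hv)
  cut v hv c hc hcv := by
    obtain ⟨t, ht, hvt⟩ := h.reach_root (Finset.mem_of_mem_erase hc) (Finset.mem_of_mem_erase hv)
      hcv.symm
    refine hvt.escape_of_forall (K := D.erase p) (P := fun t => t ∈ H.nbs {p} ∨ t ∈ H.nbs {r}) hv
      (fun z hz hz' => Finset.mem_erase.2 ⟨Finset.ne_of_mem_erase hz, hz'⟩) (fun _ => .inr ht) ?_
    intro u w _ _ hw hw' ha
    have hwp : w = p := by
      by_contra hwp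
      exact hw' (Finset.mem_erase.2 ⟨hwp, Finset.mem_of_mem_erase hw⟩)
    subst hwp
    exact .inl (mem_nbs_singleton.2 ha)

theorem Pendant.exists_adj [Fintype V] {D : Finset V} {r p : V} (h : H.Pendant D r) (hp : p ∈ D)
    (hdeg : 2 ≤ H.degIn Finset.univ p) : ∃ w ∈ D, H.Adj p w := by
  obtain ⟨w, hw, hwr⟩ := Finset.exists_mem_ne (s := Finset.univ.filter (H.Adj p)) hdeg r
  rw [Finset.mem_filter] at hw
  exact ⟨w, (h.closed p hp w hw.2).resolve_right hwr, hw.2⟩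

/-- The roots are p and r. All neighbours of a vertex of D lie in D or equal r, so no degree is
lost. -/
theorem MinPendant.hasPathLengths [Fintype V] (hf : ∀ u v, H.Adj u v → f u ≠ f v) {D : Finset V} {r p : V}
    (h : H.MinPendant D r) (hp : p ∈ D) {t : ℕ} (ht : 0 < t)
    (hdeg : ∀ v, t + 1 ≤ H.degIn Finset.univ v) :
    H.HasPathLengths (D.erase p) (H.nbs {p}) (H.nbs {r}) t := by
  refine solvable hf _ _ _ _ _ (Nat.lt_succ_self _) ?_ (mono_nbs_singleton hf p)
    (mono_nbs_singleton hf r) (h.linked hp) fun _ v hv => ?_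
  · obtain ⟨w, hw, ha⟩ := h.1.exists_adj hp ((by omega : 2 ≤ t + 1).trans (hdeg p))
    exact ⟨w, Finset.mem_erase.2 ⟨ha.ne', hw⟩⟩
  · refine (hdeg v).trans ?_
    have h1 : H.degIn Finset.univ v ≤ H.degIn (D.erase p) v + H.degIn ({p} ∪ {r}) v := by
      refine degIn_le_add fun w _ ha => ?_
      rcases h.1.closed v (Finset.mem_of_mem_erase hv) w ha with hw | rfl
      · by_cases hwp : w = p
        · exact .inr (by simp [hwp])
        · exact .inl (Finset.mem_erase.2 ⟨hwp, hw⟩)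
      · exact .inr (by simp)
    have h2 := H.degIn_union_le {p} {r} v
    rw [degIn_singleton, degIn_singleton] at h2
    omega

/-- With p in D a neighbour of r, the edge rp and the end edges at p and r add three to the lengths
of the family. The cycles lie in the bipartite graph H, hence are even. -/
theorem MinPendant.hasConsecutiveEvenCycles [Fintype V] (hHG : H ≤ G) (hf : ∀ u v, H.Adj u v → f u ≠ f v)
    {D : Finset V} {r : V} (h : H.MinPendant D r) {t : ℕ} (ht : 0 < t)
    (hdeg : ∀ v, t + 1 ≤ H.degIn Finset.univ v) : G.HasConsecutiveEvenCycles t := by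
  obtain ⟨q, hq⟩ := h.1.nonempty
  obtain ⟨w, hw, hqw⟩ := h.1.exists_adj hq ((by omega : 2 ≤ t + 1).trans (hdeg q))
  obtain ⟨p, hpr, hc⟩ := h.reach_root hw hq hqw.ne
  have hp : p ∈ D := Finset.mem_of_mem_erase hc.right_mem
  obtain ⟨l, hl⟩ := h.hasPathLengths hf hp ht hdeg
  have key : ∀ i < t, ∃ v, H.Adj v r ∧ H.PathIn (insert r D) r v (l + 2 * i + 2) := by
    intro i hi
    obtain ⟨u, hu, v, hv, hP⟩ := hl i hi
    rw [mem_nbs_singleton] at hu hv hpr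
    refine ⟨v, hv, .cons (Finset.mem_insert_self _ _) hpr.symm ?_⟩
    rw [Finset.erase_insert h.1.notMem]
    exact .cons hp hu.symm hP
  refine ⟨l + 3, ?_, fun i hi => ?_⟩
  · obtain ⟨v, hv, hP⟩ := key 0 ht
    have h1 := hP.even_iff hf
    have h2 := hf _ _ hv
    rw [Nat.even_add_one, show l + 2 = l + 2 * 0 + 2 by ring, h1]
    exact h2.symm
  · obtain ⟨v, hv, hP⟩ := key i hi
    have := (hP.mono_graph hHG).hasCycleOfLength (by omega) (hHG hv)
    rwa [show l + 2 * i + 2 + 1 = l + 3 + 2 * i by ring] at this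

/-- Paths of H run from u through D to r and on outside D to v. They are even as u and v have the
same colour, so the edge vu closes them to odd cycles. -/
theorem MinPendant.hasConsecutiveOddCycles [Fintype V] (hHG : H ≤ G) (hf : ∀ u v, H.Adj u v → f u ≠ f v)
    {D : Finset V} {r u v : V} (h : H.MinPendant D r) {t : ℕ} (ht : 0 < t)
    (hdeg : ∀ v, t + 1 ≤ H.degIn Finset.univ v) (hu : u ∈ D) (hvu : G.Adj v u) (huv : f u = f v)
    {S : Finset V} (hd : Disjoint D S) (hrv : H.ConnIn S r v) :
    G.HasConsecutiveOddCycles t := by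
  obtain ⟨l, hl⟩ := h.hasPathLengths hf hu ht hdeg
  obtain ⟨q, hq⟩ := hrv.exists_pathIn
  have key : ∀ i < t, H.PathIn (D ∪ S) u v (l + 2 * i + 1 + q + 1) := by
    intro i hi
    obtain ⟨a, ha, b, hb, hP⟩ := hl i hi
    rw [mem_nbs_singleton] at ha hb
    exact (PathIn.cons hu ha.symm hP).append hb hq hd
  refine ⟨l + q + 3, ?_, fun i hi => ?_⟩
  · have := ((key 0 ht).even_iff hf).2 huv
    rw [show l + q + 3 = l + 2 * 0 + 1 + q + 1 + 1 by ring]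
    exact this.add_one
  · have := ((key i hi).mono_graph hHG).hasCycleOfLength (by omega) hvu
    rwa [show l + 2 * i + 1 + q + 1 + 1 = l + q + 3 + 2 * i by ring] at this

theorem pendant_univ_erase [Fintype V] [Nontrivial V] (r : V) : H.Pendant (Finset.univ.erase r) r where
  nonempty := by
    obtain ⟨v, hv⟩ := exists_ne r
    exact ⟨v, by simpa using hv⟩
  notMem := Finset.notMem_erase _ _
  closed _ _ w _ := by
    by_cases hw : w = r
    · exact .inr hw
    · exact .inl (by simpa using hw)

theorem exists_adj_of_not_isBipartite (hG : ¬ G.IsBipartite) (f : V → Bool) :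
    ∃ u v, G.Adj u v ∧ f u = f v := by
  by_contra! hcon
  exact hG (Coloring.mk f fun {u v} h => hcon u v h).colorable

theorem IsTwoConnected.exists_adj (hG : G.IsTwoConnected) {D : Finset V} {r x y : V} (hr : r ∉ D)
    (hx : x ∈ D) (hy : y ∉ D) (hyr : y ≠ r) :
    ∃ u ∈ D, ∃ v, v ∉ D ∧ v ≠ r ∧ G.Adj u v := by
  obtain ⟨p⟩ := (hG.connected_delete r).preconnected
    ⟨x, fun h : x = r => hr (h ▸ hx)⟩ ⟨y, hyr⟩
  obtain ⟨d, -, h1, h2⟩ := p.exists_boundary_dart {z | z.1 ∈ D} hx hy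
  exact ⟨d.fst, h1, d.snd, h2, d.snd.2, d.adj⟩

/-- If D ∪ {r} is not everything, 2-connectedness yields an edge from D to a vertex outside D ∪ {r};
it is monochromatic because D is pendant in the bichromatic graph. Otherwise the minimum size is |V|
- 1, so the complement of any vertex is a minimum pendant set, and for a monochromatic edge the root
can be placed at one of its ends. -/
theorem MinPendant.hasConsecutiveOddCycles_of_isTwoConnected [Fintype V] [Nontrivial V]
    (hG : G.IsTwoConnected) (hbip : ¬ G.IsBipartite)
    (hcut : ∀ S : Finset V,
      (G.exits S fun u v => f u = f v).card ≤ (G.exits S fun u v => f u ≠ f v).card)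
    {D : Finset V} {r : V} (h : (G.bichromatic f).MinPendant D r) {t : ℕ} (ht : 0 < t)
    (hdeg : ∀ v, t + 1 ≤ (G.bichromatic f).degIn Finset.univ v) :
    G.HasConsecutiveOddCycles t := by
  have hHG : G.bichromatic f ≤ G := fun _ _ h => h.1
  have hf : ∀ u v, (G.bichromatic f).Adj u v → f u ≠ f v := fun _ _ h => h.2
  by_cases hD : ∃ y, y ∉ D ∧ y ≠ r
  · obtain ⟨y, hy, hyr⟩ := hD
    obtain ⟨x, hx⟩ := h.1.nonempty
    obtain ⟨u, hu, v, hv, hvr, ha⟩ := hG.exists_adj h.1.notMem hx hy hyr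
    have huv : f u = f v := by
      by_contra hne
      exact (h.1.closed u hu v ⟨ha, hne⟩).elim hv hvr
    obtain ⟨a, w, -, haD, haw, hw⟩ :=
      (connIn_bichromatic hcut hG.connected.preconnected u v).last_exit D hu hv
    obtain rfl := (h.1.closed a haD w haw).resolve_left (Finset.mem_sdiff.1 hw.left_mem).2
    exact h.hasConsecutiveOddCycles hHG hf ht hdeg hu ha.symm huv Finset.disjoint_sdiff hw
  · push Not at hD
    obtain ⟨u, v, ha, huv⟩ := exists_adj_of_not_isBipartite hbip f
    have hDr : D = Finset.univ.erase r := by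
      ext z
      rw [Finset.mem_erase]
      refine ⟨fun hz => ⟨fun h' => h.1.notMem (h' ▸ hz), Finset.mem_univ _⟩, fun hz => ?_⟩
      by_contra hzD
      exact hz.1 (hD z hzD)
    have hmin : (G.bichromatic f).MinPendant (Finset.univ.erase v) v := by
      refine ⟨pendant_univ_erase v, fun D' r' h' => ?_⟩
      have := h.2 D' r' h'
      rwa [hDr, Finset.card_erase_of_mem (Finset.mem_univ _),
        ← Finset.card_erase_of_mem (Finset.mem_univ v)] at this
    exact hmin.hasConsecutiveOddCycles hHG hf ht hdeg (Finset.mem_erase.2 ⟨ha.ne, Finset.mem_univ _⟩)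
      ha.symm huv (S := {v}) (by simp) (.refl (by simp))

end Pendant

end SimpleGraph

theorem theorem1p3 {V : Type*} [Fintype V] (G : SimpleGraph V) [DecidableRel G.Adj]
    (k : ℕ) (hk : 0 < k) (hdeg : k + 1 ≤ G.minDegree) :
    G.HasConsecutiveEvenCycles (k / 2) ∧
      (G.IsTwoConnected → ¬ G.IsBipartite → G.HasConsecutiveOddCycles (k / 2)) := by
  classical
  rcases Nat.eq_zero_or_pos (k / 2) with ht | ht
  · rw [ht]
    exact ⟨⟨0, Even.zero, by simp⟩, fun _ _ => ⟨1, odd_one, by simp⟩⟩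
  have hdeg' : ∀ v, k + 1 ≤ G.degIn Finset.univ v := by
    intro v
    refine (hdeg.trans (G.minDegree_le_degree v)).trans (Finset.card_le_card fun w hw => ?_)
    simpa using hw
  have hne : Nonempty V := by
    by_contra hV
    rw [not_nonempty_iff] at hV
    simp at hdeg
  obtain ⟨r⟩ := hne
  have hV : Nontrivial V := by
    have hr : 0 < G.degree r := by
      have := G.minDegree_le_degree r
      omega
    obtain ⟨w, hw⟩ := (G.degree_pos_iff_exists_adj r).1 hr
    exact ⟨r, w, hw.ne⟩
  obtain ⟨f, hcut⟩ := G.exists_max_cut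
  -- From k + 1 ≤ 2d follows d ≥ ⌊k/2⌋ + 1, exactly the degree needed for ⌊k/2⌋ lengths.
  have hdegH : ∀ v, k / 2 + 1 ≤ (G.bichromatic f).degIn Finset.univ v := by
    intro v
    have h1 := hdeg' v
    have h2 := SimpleGraph.degree_le_two_mul_degIn_bichromatic hcut v
    omega
  obtain ⟨D, r, h⟩ :=
    (SimpleGraph.pendant_univ_erase (H := G.bichromatic f) r).exists_minPendant
  exact ⟨h.hasConsecutiveEvenCycles (fun _ _ ha => And.left ha) (fun _ _ ha => And.right ha) ht
    hdegH,
    fun hG hbip => h.hasConsecutiveOddCycles_of_isTwoConnected hG hbip hcut ht hdegH⟩
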